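/- **Setting.** Let $G$ be a Lie group with Lie algebra $\mathfrak g$ (the tangent space at $1$, with the bracket of left-invariant vector fields), acting smoothly on a finite-dimensional smooth manifold $M$, let $\omega$ be a $G$-invariant symplectic form on $M$, and let $\mu\colon M\to\mathfrak g^*$ be a smooth equivariant moment map: $\langle\mu(gm),X\rangle=\langle\mu(m),\mathrm{Ad}_{g^{-1}}X\rangle$ and $\iota_{X^\sharp}\omega=d\langle\mu,X\rangle$ for $X\in\mathfrak g$, where $X^\sharp_m=\frac{d}{dt}\big|_{0}\exp(tX)m$. Nothing else is assumed: $0$ need not be a regular value of $\mu$, and the action need not be free or proper. Fix a basis $E_j$ of $\mathfrak g$ with dual basis $\sigma_j$ (the constructions below do not depend on it). *The dg-algebra.* $C^\infty(\mathcal Z)=C^\infty(M)\otimes\Lambda^{-\bullet}\mathfrak g$, with $\Lambda^k\mathfrak g$ in degree $-k$ and the $C^\infty(M)$-linear differential $\iota_\mu=\sum_j\langle\mu,E_j\rangle\,\iota_{\sigma_j}$ (contraction with $\mu$). *The modules.* $\mathfrak g_{\mathcal Z}=C^\infty(\mathcal Z)\otimes\mathfrak g$ and $\mathfrak g^*_{\mathcal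 Z}=C^\infty(\mathcal Z)\otimes\mathfrak g^*$, with differential $\iota_\mu$ on coefficients. The tangent module $T_{\mathcal Z}=\iota_{\mathcal Z}^*T_M\oplus\mathfrak g^*_{\mathcal Z}[-1]$ is generated over $C^\infty(\mathcal Z)$ by the vector fields $W$ on $M$ (degree $0$) and the contractions $\iota_\sigma$, $\sigma\in\mathfrak g^*$ (degree $1$); here $\iota_{\mathcal Z}^*N=C^\infty(\mathcal Z)\otimes_{C^\infty(M)}N$. Its differential is the graded commutator with $\iota_\mu$: $W\mapsto-\sum_jW\langle\mu,E_j\rangle\,\iota_{\sigma_j}$ and $\iota_\sigma\mapsto0$. The cotangent module $T^*_{\mathcal Z}=\mathfrak g_{\mathcal Z}[1]\oplus\iota_{\mathcal Z}^*T^*_M$ is generated by the one-forms $\beta$ on $M$ (degree $0$) and $dX$, $X\in\mathfrak g$ (degree $-1$), with differential $dX\mapsto d\langle\mu,X\rangle$, $\beta\mapsto0$. All differentials $\delta$ are extended by the Leibniz rule $\delta(cx)=\iota_\mu(c)x+(-1)^{|c|}c\,\delta x$. *The tangent and cotangent complexes of the action groupoid $\mathcal Z/G$.* The anchor $\rho=\rho_0+\eta\colon\mathfrak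 g_{\mathcal Z}\to T_{\mathcal Z}$ is the $C^\infty(\mathcal Z)$-linear map with $\rho_0(X)=X^\sharp$ and $\eta(X)=\mathrm{ad}^*_X=-\sum_j[X,E_j]\,\iota_{\sigma_j}$. Its dual $\rho^*\colon T^*_{\mathcal Z}\to\mathfrak g^*_{\mathcal Z}$ is the $C^\infty(\mathcal Z)$-linear map with $\rho^*(\xi)=\sum_j\langle\xi,\rho(E_j)\rangle\,\sigma_j$ for $\xi=dX$ and $\xi=\beta$, the pairing being $\langle dX,c\,\iota_\sigma\rangle=c\,\sigma(X)$, $\langle\beta,cW\rangle=c\,\beta(W)$, $\langle dX,cW\rangle=\langle\beta,c\,\iota_\sigma\rangle=0$. The total complexes are $$\mathrm{Tot}(T_{\mathcal Z/G})=\mathfrak g_{\mathcal Z}[1]\oplus T_{\mathcal Z},\qquad \mathrm{Tot}(T^*_{\mathcal Z/G})=T^*_{\mathcal Z}\oplus\mathfrak g^*_{\mathcal Z}[-1],$$ where the generators $X\in\mathfrak g$ of the former have degree $-1$ and the generators $\sigma\in\mathfrak g^*$ of the last summand have degree $1$. The differential of $\mathrm{Tot}(T_{\mathcal Z/G})$ is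 that of $T_{\mathcal Z}$ on $T_{\mathcal Z}$ and is $\rho(X)$ on the generators $X$; the differential of $\mathrm{Tot}(T^*_{\mathcal Z/G})$ is given on generators by $\beta\mapsto\sum_j\beta(E_j^\sharp)\,\sigma_j=\rho^*(\beta)$, $dX\mapsto d\langle\mu,X\rangle-\rho^*(dX)=d\langle\mu,X\rangle-\sum_j[X,E_j]\,\sigma_j$ and $\sigma\mapsto 0$ (the sign in front of $\rho^*(dX)=\sum_j[X,E_j]\,\sigma_j$ is the Koszul sign of the shift). Both are extended by the Leibniz rule. *The actions of $G$.* An element $g$ acts on $C^\infty(M)$ by $f\mapsto f\circ g^{-1}$, on vector fields by pushforward, on one-forms by pullback along $g^{-1}$, on $\mathfrak g$ by $\mathrm{Ad}_g$ and on $\mathfrak g^*$ by $\sigma\mapsto\sigma\circ\mathrm{Ad}_{g^{-1}}$. This induces actions on $C^\infty(\mathcal Z)$ by algebra automorphisms and on $\mathrm{Tot}(T_{\mathcal Z/G})$ and $\mathrm{Tot}(T^*_{\mathcal Z/G})$. *The map.* Let $\theta=\sum_i\theta_i\otimes E_i$ be the left Maurer–Cartan form of $G$ and $\omega_{\mathrm{red}}=\iota_{\mathcal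 Z}^*\omega+d\theta$. Contraction with $\omega_{\mathrm{red}}$, restricted to the units of the groupoid, gives the $C^\infty(\mathcal Z)$-linear maps - $(\iota_{\mathcal Z}^*\omega)^\flat\colon T_{\mathcal Z}\to T^*_{\mathcal Z}$, $W\mapsto\iota_W\omega$, $\iota_\sigma\mapsto0$; - $\alpha\colon T_{\mathcal Z}\to\mathfrak g^*_{\mathcal Z}[-1]$, $W\mapsto0$, $\iota_{\sigma}\mapsto\sum_i\sigma(E_i)\,\theta_i(1)=\sigma$; - its dual $\alpha^*\colon\mathfrak g_{\mathcal Z}[1]\to T^*_{\mathcal Z}$, $X\mapsto d(\theta_1(X))=dX$; and $\omega_{\mathrm{red}}^\flat=\alpha+(\iota_{\mathcal Z}^*\omega)^\flat+\alpha^*\colon\mathrm{Tot}(T_{\mathcal Z/G})\to\mathrm{Tot}(T^*_{\mathcal Z/G})$. **Theorem (Derived symplectic reduction).** $\mathrm{Tot}(T_{\mathcal Z/G})$ and $\mathrm{Tot}(T^*_{\mathcal Z/G})$ are $G$-equivariant dg-modules over $C^\infty(\mathcal Z)$: they are graded modules, $\delta$ has degree $1$, $\delta^2=0$, the Leibniz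 rule holds, and $G$ acts semilinearly, by maps of degree $0$ that commute with $\delta$. The map $\omega_{\mathrm{red}}^\flat$ is a $G$-equivariant isomorphism of dg-$C^\infty(\mathcal Z)$-modules: it is $C^\infty(\mathcal Z)$-linear of degree $0$, commutes with the differentials and with the actions of $G$, and is bijective. -/

import Mathlib

open scoped Manifold ContDiff TensorProduct Bundle

noncomputable section

namespace DerivedReduction

/-! ## Graded modules over a dg-algebra, with a group action

Throughout, `A` is a commutative ring, `C` a graded algebra over `A` with an `A`-linear differential,
gradings are indexed by `ℤ` and differentials have degree `+1`. -/

section Algebra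

/-- `N`, with the grading `deg` and the `A`-linear differential `d`, is a dg-module over the
dg-algebra `C` with grading `degC` and differential `dC`. -/
structure IsDGModule {A C N : Type*} [CommRing A] [Ring C] [Algebra A C] [AddCommGroup N]
    [Module A N] [Module C N] (degC : ℤ → Submodule A C) (dC : C →ₗ[A] C)
    (deg : ℤ → Submodule A N) (d : N →ₗ[A] N) : Prop where
  isInternal : DirectSum.IsInternal deg
  smul_mem : ∀ {i j : ℤ} {c : C} {x : N}, c ∈ degC i → x ∈ deg j → c • x ∈ deg (i + j)
  d_mem : ∀ {i : ℤ} {x : N}, x ∈ deg i → d x ∈ deg (i + 1)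
  d_d : ∀ x : N, d (d x) = 0
  leibniz : ∀ {i : ℤ} {c : C} (x : N), c ∈ degC i →
    d (c • x) = dC c • x + ((Int.negOnePow i : ℤˣ) : ℤ) • (c • d x)

/-- A dg-module `N` over `C` with an action of the group `G` which is semilinear over an action
`actC` of `G` on `C` by ring homomorphisms, preserves degrees and commutes with the differential. -/
structure IsEquivariantDGModule {A C N G : Type*} [CommRing A] [Ring C] [Algebra A C]
    [AddCommGroup N] [Module A N] [Module C N] [Group G]
    (degC : ℤ → Submodule A C) (dC : C →ₗ[A] C) (actC : G → C →+* C)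
    (deg : ℤ → Submodule A N) (d : N →ₗ[A] N) (act : G → N →+ N) : Prop
    extends IsDGModule degC dC deg d where
  act_one : ∀ x : N, act 1 x = x
  act_mul : ∀ (g h : G) (x : N), act (g * h) x = act g (act h x)
  act_smul : ∀ (g : G) (c : C) (x : N), act g (c • x) = actC g c • act g x
  act_mem : ∀ (g : G) {i : ℤ} {x : N}, x ∈ deg i → act g x ∈ deg i
  act_d : ∀ (g : G) (x : N), act g (d x) = d (act g x)

/-- The `C`-linear extension `C ⊗[R] P → N`, `c ⊗ p ↦ c • f p`, of an `R`-linear map `P → N`. -/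
def extendScalars {R C P N : Type*} [CommSemiring R] [Semiring C] [Algebra R C] [AddCommMonoid P]
    [Module R P] [AddCommMonoid N] [Module R N] [Module C N] [IsScalarTower R C N]
    (f : P →ₗ[R] N) : C ⊗[R] P →ₗ[C] N :=
  haveI : SMulCommClass R C N := IsScalarTower.to_smulCommClass
  TensorProduct.AlgebraTensorModule.lift (LinearMap.toSpanSingleton C (P →ₗ[R] N) f)

/-- An `A`-linear map `C → C` applied to the coefficients of `C ⊗[R] P`. -/
def onCoeff {R A C : Type*} (P : Type*) [CommSemiring R] [CommSemiring A] [Algebra R A]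
    [Semiring C] [Algebra R C] [Algebra A C] [IsScalarTower R A C] [AddCommMonoid P] [Module R P]
    (f : C →ₗ[A] C) : C ⊗[R] P →ₗ[A] C ⊗[R] P :=
  TensorProduct.AlgebraTensorModule.map f LinearMap.id

/-- The `A`-linear map `C → C ⊗[R] P`, `c ↦ c ⊗ p`. -/
def tmulRight {R : Type*} (A C : Type*) {P : Type*} [CommSemiring R] [CommSemiring A]
    [Algebra R A] [Semiring C] [Algebra R C] [Algebra A C] [IsScalarTower R A C] [AddCommMonoid P]
    [Module R P] (p : P) : C →ₗ[A] C ⊗[R] P where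
  toFun c := c ⊗ₜ[R] p
  map_add' c c' := TensorProduct.add_tmul c c' p
  map_smul' a c := (TensorProduct.smul_tmul' a c p).symm

/-- The degree `n` part of `C ⊗[R] P`, where `P` consists of elements of degree `d`. -/
def genDeg {R A C : Type*} (P : Type*) [CommSemiring R] [CommSemiring A] [Algebra R A]
    [Semiring C] [Algebra R C] [Algebra A C] [IsScalarTower R A C] [AddCommMonoid P] [Module R P]
    (degC : ℤ → Submodule A C) (d n : ℤ) : Submodule A (C ⊗[R] P) :=
  Submodule.span A {z | ∃ c ∈ degC (n - d), ∃ p : P, z = c ⊗ₜ[R] p}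

end Algebra

/-! ## The algebra of the derived zero level set

In this section `A` stands for the algebra `C^∞(M)`, `𝔤` for the Lie algebra of `G`, `T` and `Ω`
for the `A`-modules of vector fields and of one-forms on `M`. The graded algebra of functions is
`C^∞(Z) = A ⊗ Λ^{-•} 𝔤`. We write `E_i` for a basis of `𝔤` and `σ_i` for the dual basis.

A shifted module is written through its shifted generators: an element of `C^∞(Z) ⊗ P` has the
degree of its coefficient in `C^∞(Z)` plus the degree of the generators `P`. The identification of
`N` with `N[1]` then involves the sign `c · (p[1]) = (-1)^{|c|} (c · p)[1]`; this is where the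
operator `signZ` in the differentials comes from. All differentials are `A`-linear. -/

section Koszul

variable (A 𝔤 T Ω : Type*) [CommRing A] [Algebra ℝ A] [AddCommGroup 𝔤] [Module ℝ 𝔤]
  [FiniteDimensional ℝ 𝔤] [AddCommGroup T] [Module ℝ T] [Module A T] [IsScalarTower ℝ A T]
  [AddCommGroup Ω] [Module ℝ Ω] [Module A Ω] [IsScalarTower ℝ A Ω]

/-- The algebra `C^∞(Z) = A ⊗ Λ 𝔤`. -/
abbrev FunZ : Type _ := A ⊗[ℝ] ExteriorAlgebra ℝ 𝔤

/-- The component of degree `n` of `C^∞(Z)`: it is `A ⊗ Λ^{-n} 𝔤` for `n ≤ 0`. -/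
def degZ (n : ℤ) : Submodule A (FunZ A 𝔤) :=
  if n ≤ 0 then (⋀[ℝ]^n.natAbs 𝔤).baseChange A else ⊥

/-- The grading operator `c ↦ (-1)^{|c|} c` of `C^∞(Z)`. -/
def signZ : FunZ A 𝔤 →ₗ[A] FunZ A 𝔤 :=
  LinearMap.baseChange A (CliffordAlgebra.involute (Q := (0 : QuadraticForm ℝ 𝔤))).toLinearMap

variable {A 𝔤} in
/-- The differential `ι_μ = ∑ i, ⟨μ, E_i⟩ ι_{σ_i}` of `C^∞(Z)`: the contraction with the moment map,
which is given here as `X ↦ ⟨μ, X⟩`. -/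
def contrMu (μ : 𝔤 →ₗ[ℝ] A) : FunZ A 𝔤 →ₗ[A] FunZ A 𝔤 :=
  ∑ i, μ (Module.finBasis ℝ 𝔤 i) •
    LinearMap.baseChange A (CliffordAlgebra.contractLeft
      (Q := (0 : QuadraticForm ℝ 𝔤)) ((Module.finBasis ℝ 𝔤).coord i))

/-- The trivial module `𝔤_Z = C^∞(Z) ⊗ 𝔤`. -/
abbrev LieZ : Type _ := FunZ A 𝔤 ⊗[ℝ] 𝔤

/-- The trivial module `𝔤^*_Z = C^∞(Z) ⊗ 𝔤^*`. -/
abbrev LieDualZ : Type _ := FunZ A 𝔤 ⊗[ℝ] Module.Dual ℝ 𝔤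

/-- The pullback `ι_Z^* T` of an `A`-module. -/
abbrev PullZ : Type _ := FunZ A 𝔤 ⊗[A] T

/-- The tangent module `T_Z = ι_Z^* T ⊕ 𝔤^*_Z[-1]`. The generator `1 ⊗ σ` of the second summand
is the contraction `ι_σ`, of degree `1`. -/
abbrev TZ : Type _ := PullZ A 𝔤 T × LieDualZ A 𝔤

/-- The cotangent module `T^*_Z = 𝔤_Z[1] ⊕ ι_Z^* Ω`. The generator `1 ⊗ X` of the first summand
is the one-form `dX`, of degree `-1`. -/
abbrev CTZ : Type _ := LieZ A 𝔤 × PullZ A 𝔤 Ω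

/-- The total tangent complex `Tot(𝔤_Z → T_Z) = 𝔤_Z[1] ⊕ T_Z`. -/
abbrev TotT : Type _ := LieZ A 𝔤 × TZ A 𝔤 T

/-- The total cotangent complex `Tot(T^*_Z → 𝔤^*_Z) = T^*_Z ⊕ 𝔤^*_Z[-1]`. -/
abbrev TotCT : Type _ := CTZ A 𝔤 Ω × LieDualZ A 𝔤

/-- The grading of the total tangent complex. -/
def degTotT (n : ℤ) : Submodule A (TotT A 𝔤 T) :=
  (genDeg 𝔤 (degZ A 𝔤) (-1) n).prod
    ((genDeg T (degZ A 𝔤) 0 n).prod (genDeg (Module.Dual ℝ 𝔤) (degZ A 𝔤) 1 n))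

/-- The grading of the total cotangent complex. -/
def degTotCT (n : ℤ) : Submodule A (TotCT A 𝔤 Ω) :=
  ((genDeg 𝔤 (degZ A 𝔤) (-1) n).prod (genDeg Ω (degZ A 𝔤) 0 n)).prod
    (genDeg (Module.Dual ℝ 𝔤) (degZ A 𝔤) 1 n)

variable {A 𝔤 T Ω}

/-! ### The differentials of the tangent and cotangent modules

Here `μ : 𝔤 → A` is `X ↦ ⟨μ, X⟩`, `Dμ : 𝔤 → Ω` is `X ↦ d⟨μ, X⟩`, and `pair` is the pairing of
one-forms with vector fields. -/

/-- The `C^∞(Z)`-linear map `dμ : ι_Z^* T → 𝔤^*_Z`, `W ↦ ∑ j, W⟨μ, E_j⟩ ⊗ σ_j`. -/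
def dMu (pair : Ω →ₗ[A] T →ₗ[A] A) (Dμ : 𝔤 →ₗ[ℝ] Ω) :
    PullZ A 𝔤 T →ₗ[FunZ A 𝔤] LieDualZ A 𝔤 :=
  extendScalars (∑ j, tmulRight A (FunZ A 𝔤) ((Module.finBasis ℝ 𝔤).coord j) ∘ₗ
    Algebra.linearMap A (FunZ A 𝔤) ∘ₗ pair (Dμ (Module.finBasis ℝ 𝔤 j)))

variable (A) in
/-- The `C^∞(Z)`-linear map `(dμ)^* : 𝔤_Z → ι_Z^* Ω`, `X ↦ d⟨μ, X⟩`. -/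
def dMuStar (Dμ : 𝔤 →ₗ[ℝ] Ω) : LieZ A 𝔤 →ₗ[FunZ A 𝔤] PullZ A 𝔤 Ω :=
  extendScalars ((TensorProduct.mk A (FunZ A 𝔤) Ω 1).restrictScalars ℝ ∘ₗ Dμ)

/-- The differential of `T_Z`: the graded commutator with `ι_μ`. On generators it is
`W ↦ [ι_μ, W] = -∑ j, W⟨μ, E_j⟩ ι_{σ_j}` and `ι_σ ↦ [ι_μ, ι_σ] = 0`. -/
def dTZ (μ : 𝔤 →ₗ[ℝ] A) (pair : Ω →ₗ[A] T →ₗ[A] A) (Dμ : 𝔤 →ₗ[ℝ] Ω) :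
    TZ A 𝔤 T →ₗ[A] TZ A 𝔤 T :=
  LinearMap.prod
    (onCoeff T (contrMu μ) ∘ₗ LinearMap.fst _ _ _)
    (onCoeff (Module.Dual ℝ 𝔤) (contrMu μ) ∘ₗ LinearMap.snd _ _ _ -
      onCoeff (Module.Dual ℝ 𝔤) (signZ A 𝔤) ∘ₗ (dMu pair Dμ).restrictScalars A ∘ₗ
        LinearMap.fst _ _ _)

/-- The differential of `T^*_Z`. On generators it is `dX ↦ d⟨μ, X⟩` and `β ↦ 0`. -/
def dCTZ (μ : 𝔤 →ₗ[ℝ] A) (Dμ : 𝔤 →ₗ[ℝ] Ω) : CTZ A 𝔤 Ω →ₗ[A] CTZ A 𝔤 Ω :=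
  LinearMap.prod
    (onCoeff 𝔤 (contrMu μ) ∘ₗ LinearMap.fst _ _ _)
    (onCoeff Ω (contrMu μ) ∘ₗ LinearMap.snd _ _ _ +
      (dMuStar A Dμ).restrictScalars A ∘ₗ onCoeff 𝔤 (signZ A 𝔤) ∘ₗ LinearMap.fst _ _ _)

/-! ### The anchor and its dual

Here `br` is the bracket of `𝔤` and `sharp : 𝔤 → T` is the infinitesimal action `X ↦ X♯`. -/

variable (A) in
/-- The map `η(X) = ad^*_X = -∑ j, [X, E_j] ⊗ σ_j`, an element of `𝔤 ⊗ 𝔤^*`, which is part of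
`C^∞(Z)_{-1} ⊗ 𝔤^*`. -/
def eta (br : 𝔤 →ₗ[ℝ] 𝔤 →ₗ[ℝ] 𝔤) : 𝔤 →ₗ[ℝ] LieDualZ A 𝔤 :=
  ∑ j, tmulRight ℝ (FunZ A 𝔤) ((Module.finBasis ℝ 𝔤).coord j) ∘ₗ
    TensorProduct.mk ℝ A (ExteriorAlgebra ℝ 𝔤) 1 ∘ₗ
    ExteriorAlgebra.ι ℝ ∘ₗ (-(br.flip (Module.finBasis ℝ 𝔤 j)))

variable (A) in
/-- The anchor `ρ = ρ_0 + η : 𝔤_Z → T_Z`, where `ρ_0(X) = X♯`. -/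
def anchor (br : 𝔤 →ₗ[ℝ] 𝔤 →ₗ[ℝ] 𝔤) (sharp : 𝔤 →ₗ[ℝ] T) :
    LieZ A 𝔤 →ₗ[FunZ A 𝔤] TZ A 𝔤 T :=
  LinearMap.prod
    (extendScalars ((TensorProduct.mk A (FunZ A 𝔤) T 1).restrictScalars ℝ ∘ₗ sharp))
    (extendScalars (eta A br))

variable (A 𝔤 T) in
/-- The pairing of `T_Z` with the one-forms `dY`: `⟨dY, ι_σ⟩ = σ(Y)` and `⟨dY, W⟩ = 0`, extended
`C^∞(Z)`-linearly in `T_Z`. -/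
def pairLie : TZ A 𝔤 T →ₗ[FunZ A 𝔤] 𝔤 →ₗ[ℝ] FunZ A 𝔤 :=
  extendScalars (LinearMap.compRight ℝ (Algebra.linearMap ℝ (FunZ A 𝔤))) ∘ₗ
    LinearMap.snd _ _ _

variable (𝔤) in
/-- The pairing of `T_Z` with the one-forms `β` on `M`: `⟨β, W⟩ = β(W)` and `⟨β, ι_σ⟩ = 0`, extended
`C^∞(Z)`-linearly in `T_Z`. -/
def pairForm (pair : Ω →ₗ[A] T →ₗ[A] A) : TZ A 𝔤 T →ₗ[FunZ A 𝔤] Ω →ₗ[A] FunZ A 𝔤 :=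
  extendScalars (LinearMap.compRight A (Algebra.linearMap A (FunZ A 𝔤)) ∘ₗ pair.flip) ∘ₗ
    LinearMap.fst _ _ _

/-- The dual `ρ^* : T^*_Z → 𝔤^*_Z` of the anchor: `ρ^*(ξ) = ∑ j, ⟨ξ, ρ(E_j)⟩ ⊗ σ_j` on the generators
`ξ = dY` and `ξ = β` of `T^*_Z`, extended `C^∞(Z)`-linearly. -/
def anchorStar (pair : Ω →ₗ[A] T →ₗ[A] A) (br : 𝔤 →ₗ[ℝ] 𝔤 →ₗ[ℝ] 𝔤) (sharp : 𝔤 →ₗ[ℝ] T) :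
    CTZ A 𝔤 Ω →ₗ[FunZ A 𝔤] LieDualZ A 𝔤 :=
  LinearMap.coprod
    (extendScalars (∑ j, tmulRight ℝ (FunZ A 𝔤) ((Module.finBasis ℝ 𝔤).coord j) ∘ₗ
      pairLie A 𝔤 T (anchor A br sharp (1 ⊗ₜ Module.finBasis ℝ 𝔤 j))))
    (extendScalars (∑ j, tmulRight A (FunZ A 𝔤) ((Module.finBasis ℝ 𝔤).coord j) ∘ₗ
      pairForm 𝔤 pair (anchor A br sharp (1 ⊗ₜ Module.finBasis ℝ 𝔤 j))))

/-- The differential of the total tangent complex `Tot(𝔤_Z → T_Z)`. On the generators of `𝔤_Z[1]`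
it is the anchor. -/
def dTotT (μ : 𝔤 →ₗ[ℝ] A) (pair : Ω →ₗ[A] T →ₗ[A] A) (Dμ : 𝔤 →ₗ[ℝ] Ω)
    (br : 𝔤 →ₗ[ℝ] 𝔤 →ₗ[ℝ] 𝔤) (sharp : 𝔤 →ₗ[ℝ] T) : TotT A 𝔤 T →ₗ[A] TotT A 𝔤 T :=
  LinearMap.prod
    (onCoeff 𝔤 (contrMu μ) ∘ₗ LinearMap.fst _ _ _)
    (dTZ μ pair Dμ ∘ₗ LinearMap.snd _ _ _ +
      (anchor A br sharp).restrictScalars A ∘ₗ onCoeff 𝔤 (signZ A 𝔤) ∘ₗ LinearMap.fst _ _ _)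

/-- The differential of the total cotangent complex `Tot(T^*_Z → 𝔤^*_Z)`. -/
def dTotCT (μ : 𝔤 →ₗ[ℝ] A) (pair : Ω →ₗ[A] T →ₗ[A] A) (Dμ : 𝔤 →ₗ[ℝ] Ω)
    (br : 𝔤 →ₗ[ℝ] 𝔤 →ₗ[ℝ] 𝔤) (sharp : 𝔤 →ₗ[ℝ] T) : TotCT A 𝔤 Ω →ₗ[A] TotCT A 𝔤 Ω :=
  LinearMap.prod
    (dCTZ μ Dμ ∘ₗ LinearMap.fst _ _ _)
    (onCoeff (Module.Dual ℝ 𝔤) (contrMu μ) ∘ₗ LinearMap.snd _ _ _ +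
      onCoeff (Module.Dual ℝ 𝔤) (signZ A 𝔤) ∘ₗ
        (anchorStar pair br sharp).restrictScalars A ∘ₗ LinearMap.fst _ _ _)

/-! ### The map induced by the reduced form

Here `flat : T → Ω` is `W ↦ ι_W ω`, and `θ₁ : 𝔤 → 𝔤` is the restriction to the unit element of the
left Maurer-Cartan form `θ = ∑ i, θ_i ⊗ E_i`. -/

variable (𝔤) in
/-- The map `(ι_Z^* ω)^♭ : T_Z → T^*_Z`: it sends `W` to `ι_W ω` and `ι_σ` to `0`. -/
def formFlat (flat : T →ₗ[A] Ω) : TZ A 𝔤 T →ₗ[FunZ A 𝔤] CTZ A 𝔤 Ω :=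
  LinearMap.inr _ _ _ ∘ₗ extendScalars (TensorProduct.mk A (FunZ A 𝔤) Ω 1 ∘ₗ flat) ∘ₗ
    LinearMap.fst _ _ _

variable (A T) in
/-- The map `α : T_Z → 𝔤^*_Z[-1]`, given by contraction with `dθ = ∑ i, dθ_i ⊗ E_i + θ_i ⊗ dE_i`
and restriction to the units of the groupoid: it sends `W` to `0` and `ι_σ` to the restriction
`σ ∘ θ₁` of `ι_{ι_σ} dθ = ∑ i, σ(E_i) θ_i` to the unit element. -/
def alpha (θ₁ : 𝔤 →ₗ[ℝ] 𝔤) : TZ A 𝔤 T →ₗ[FunZ A 𝔤] LieDualZ A 𝔤 :=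
  extendScalars (TensorProduct.mk ℝ (FunZ A 𝔤) (Module.Dual ℝ 𝔤) 1 ∘ₗ θ₁.dualMap) ∘ₗ
    LinearMap.snd _ _ _

variable (A Ω) in
/-- The dual map `α^*`, from `𝔤_Z[1]` to `T^*_Z`: it sends `X` to `d(θ₁(X))`. -/
def alphaStar (θ₁ : 𝔤 →ₗ[ℝ] 𝔤) : LieZ A 𝔤 →ₗ[FunZ A 𝔤] CTZ A 𝔤 Ω :=
  LinearMap.inl _ _ _ ∘ₗ extendScalars (TensorProduct.mk ℝ (FunZ A 𝔤) 𝔤 1 ∘ₗ θ₁)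

/-- The map `ω_red^♭ = α + (ι_Z^* ω)^♭ + α^*` between the total complexes. -/
def reducedFlat (flat : T →ₗ[A] Ω) (θ₁ : 𝔤 →ₗ[ℝ] 𝔤) :
    TotT A 𝔤 T →ₗ[FunZ A 𝔤] TotCT A 𝔤 Ω :=
  LinearMap.inr _ _ _ ∘ₗ alpha A T θ₁ ∘ₗ LinearMap.snd _ _ _ +
    LinearMap.inl _ _ _ ∘ₗ formFlat 𝔤 flat ∘ₗ LinearMap.snd _ _ _ +
    LinearMap.inl _ _ _ ∘ₗ alphaStar A Ω θ₁ ∘ₗ LinearMap.fst _ _ _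

/-! ### Induced actions

Here `f : A → A`, `a : 𝔤 → 𝔤`, `a' : 𝔤^* → 𝔤^*` and the `f`-semilinear map `b` are the actions of
one element of `G` on functions, on the Lie algebra, on its dual, and on vector fields or one-forms. -/

/-- The action on `C^∞(Z)`: the tensor product of the actions on `A` and on `𝔤`. -/
def actZ (f : A →ₐ[ℝ] A) (a : 𝔤 →ₗ[ℝ] 𝔤) : FunZ A 𝔤 →ₐ[ℝ] FunZ A 𝔤 :=
  Algebra.TensorProduct.map f (ExteriorAlgebra.map a)

/-- The action on `C^∞(Z)` is semilinear over the action on `A`. -/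
def actZSemilinear (f : A →ₐ[ℝ] A) (a : 𝔤 →ₗ[ℝ] 𝔤) : FunZ A 𝔤 →ₛₗ[f.toRingHom] FunZ A 𝔤 where
  toFun := actZ f a
  map_add' := map_add _
  map_smul' r c := by
    rw [Algebra.smul_def, map_mul, Algebra.smul_def]
    congr 1
    change actZ f a (r ⊗ₜ 1) = (f r) ⊗ₜ 1
    rw [actZ, Algebra.TensorProduct.map_tmul, map_one]

/-- The action on `C^∞(Z) ⊗ V` for a representation `V` of `G`. -/
def actTriv {V : Type*} [AddCommGroup V] [Module ℝ V] (f : A →ₐ[ℝ] A) (a : 𝔤 →ₗ[ℝ] 𝔤)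
    (v : V →ₗ[ℝ] V) : FunZ A 𝔤 ⊗[ℝ] V →+ FunZ A 𝔤 ⊗[ℝ] V :=
  (TensorProduct.map (actZ f a).toLinearMap v).toAddMonoidHom

/-- The action on the pullback `ι_Z^* T`. -/
def actPull (f : A →ₐ[ℝ] A) (a : 𝔤 →ₗ[ℝ] 𝔤) (b : T →ₛₗ[f.toRingHom] T) :
    PullZ A 𝔤 T →+ PullZ A 𝔤 T :=
  (TensorProduct.map (actZSemilinear f a) b).toAddMonoidHom

/-- The action on the total tangent complex. -/
def actTotT (f : A →ₐ[ℝ] A) (a : 𝔤 →ₗ[ℝ] 𝔤) (a' : Module.Dual ℝ 𝔤 →ₗ[ℝ] Module.Dual ℝ 𝔤)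
    (b : T →ₛₗ[f.toRingHom] T) : TotT A 𝔤 T →+ TotT A 𝔤 T :=
  (actTriv f a a).prodMap ((actPull f a b).prodMap (actTriv f a a'))

/-- The action on the total cotangent complex. -/
def actTotCT (f : A →ₐ[ℝ] A) (a : 𝔤 →ₗ[ℝ] 𝔤) (a' : Module.Dual ℝ 𝔤 →ₗ[ℝ] Module.Dual ℝ 𝔤)
    (b : Ω →ₛₗ[f.toRingHom] Ω) : TotCT A 𝔤 Ω →+ TotCT A 𝔤 Ω :=
  ((actTriv f a a).prodMap (actPull f a b)).prodMap (actTriv f a a')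

end Koszul

/-! ## Smooth functions, vector fields and one-forms on a manifold -/

section Manifold

theorem tangent_mk_congr {E : Type*} [NormedAddCommGroup E] [NormedSpace ℝ E] {M : Type*}
    [TopologicalSpace M] [ChartedSpace E M] {x y : M} (h : x = y) (v : E) :
    Bundle.TotalSpace.mk' E (E := (TangentSpace 𝓘(ℝ, E) : M → Type _)) x v =
      Bundle.TotalSpace.mk' E (E := (TangentSpace 𝓘(ℝ, E) : M → Type _)) y v := by
  subst h; rfl

variable (E : Type*) [NormedAddCommGroup E] [NormedSpace ℝ E]
  (M : Type*) [TopologicalSpace M] [ChartedSpace E M]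

/-- The algebra of smooth functions on `M`. -/
abbrev SmoothFun : Type _ := C^∞⟮𝓘(ℝ, E), M; ℝ⟯

variable [IsManifold 𝓘(ℝ, E) ∞ M]

/-- Smooth vector fields on `M`. -/
abbrev VecField : Type _ := Cₛ^∞⟮𝓘(ℝ, E); E, (TangentSpace 𝓘(ℝ, E) : M → Type _)⟯

/-- Smooth one-forms on `M`. -/
abbrev OneForm : Type _ :=
  Cₛ^∞⟮𝓘(ℝ, E); E →L[ℝ] ℝ, fun x : M => TangentSpace 𝓘(ℝ, E) x →L[ℝ] ℝ⟯

variable {E M}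

instance : SMul (SmoothFun E M) (VecField E M) :=
  ⟨fun f V => ⟨fun x => f x • V x, f.contMDiff.smul_section V.contMDiff⟩⟩

instance : SMul (SmoothFun E M) (OneForm E M) :=
  ⟨fun f V => ⟨fun x => f x • V x, f.contMDiff.smul_section V.contMDiff⟩⟩

@[simp] theorem VecField.smul_apply (f : SmoothFun E M) (V : VecField E M) (x : M) :
    (f • V) x = f x • V x := rfl

@[simp] theorem OneForm.smul_apply (f : SmoothFun E M) (V : OneForm E M) (x : M) :
    (f • V) x = f x • V x := rfl

instance : Module (SmoothFun E M) (VecField E M) where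
  one_smul V := by ext x; exact one_smul ℝ (V x)
  mul_smul f g V := by ext x; exact mul_smul (f x) (g x) (V x)
  smul_zero f := by ext x; exact smul_zero (f x)
  smul_add f V W := by ext x; exact smul_add (f x) (V x) (W x)
  add_smul f g V := by ext x; exact add_smul (f x) (g x) (V x)
  zero_smul V := by ext x; exact zero_smul ℝ (V x)

instance : Module (SmoothFun E M) (OneForm E M) where
  one_smul V := by ext x : 1; exact one_smul ℝ (V x)
  mul_smul f g V := by ext x : 1; exact mul_smul (f x) (g x) (V x)
  smul_zero f := by ext x : 1; exact smul_zero (f x)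
  smul_add f V W := by ext x : 1; exact smul_add (f x) (V x) (W x)
  add_smul f g V := by ext x : 1; exact add_smul (f x) (g x) (V x)
  zero_smul V := by ext x : 1; exact zero_smul ℝ (V x)

instance : IsScalarTower ℝ (SmoothFun E M) (VecField E M) :=
  ⟨fun r f V => by ext x; exact mul_smul r (f x) (V x)⟩

instance : IsScalarTower ℝ (SmoothFun E M) (OneForm E M) :=
  ⟨fun r f V => by ext x : 1; exact mul_smul r (f x) (V x)⟩

theorem contMDiff_pairing (β : OneForm E M) (V : VecField E M) :
    ContMDiff 𝓘(ℝ, E) 𝓘(ℝ) ∞ (fun x => (β x (V x) : ℝ)) := by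
  have h : ContMDiff 𝓘(ℝ, E) (𝓘(ℝ, E).prod 𝓘(ℝ)) ∞
      (fun x => Bundle.TotalSpace.mk' ℝ (E := Bundle.Trivial M ℝ) x (β x (V x))) :=
    β.contMDiff.clm_bundle_apply V.contMDiff
  intro x
  have := (Bundle.contMDiffAt_section _).1 (h x)
  simpa using this

/-- The pairing `⟨β, V⟩` of a one-form with a vector field. -/
def pairing : OneForm E M →ₗ[SmoothFun E M] VecField E M →ₗ[SmoothFun E M] SmoothFun E M :=
  LinearMap.mk₂ (SmoothFun E M)
    (fun β V => ⟨fun x => (β x (V x) : ℝ), contMDiff_pairing β V⟩)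
    (fun _ _ _ => by ext x; rfl) (fun _ _ _ => by ext x; rfl)
    (fun β V W => by ext x; exact (β x).map_add (V x) (W x))
    (fun f β V => by ext x; exact (β x).map_smul (f x) (V x))

theorem contMDiff_mvfderiv (f : SmoothFun E M) :
    ContMDiff 𝓘(ℝ, E) (𝓘(ℝ, E).prod 𝓘(ℝ, E →L[ℝ] ℝ)) ∞
      (fun x => Bundle.TotalSpace.mk' (E →L[ℝ] ℝ)
        (E := fun x : M => TangentSpace 𝓘(ℝ, E) x →L[ℝ] ℝ) x (mvfderiv 𝓘(ℝ, E) f x)) := by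
  intro x₀
  rw [contMDiffAt_hom_bundle]
  refine ⟨contMDiffAt_id, ?_⟩
  have h2 := (f.contMDiff x₀).mfderiv_const (m := ∞) (by norm_cast)
  refine h2.congr_of_eventuallyEq ?_
  filter_upwards with x
  ext v
  simp [inTangentCoordinates, ContinuousLinearMap.inCoordinates, mvfderiv]
  rfl

/-- The differential `df` of a smooth function. -/
def dFun : SmoothFun E M →ₗ[ℝ] OneForm E M where
  toFun f := ⟨fun x => mvfderiv 𝓘(ℝ, E) f x, contMDiff_mvfderiv f⟩
  map_add' f g := by
    ext x : 1
    exact mvfderiv_add (f.contMDiff.mdifferentiableAt (by simp))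
      (g.contMDiff.mdifferentiableAt (by simp))
  map_smul' r f := by
    ext x : 1
    have h := mvfderiv_smul (I := 𝓘(ℝ, E)) (x := x) (a := fun _ : M => r)
      mdifferentiableAt_const (f.contMDiff.mdifferentiableAt (by simp))
    rw [mvfderiv_const] at h
    refine h.trans ?_
    ext v
    simp

theorem contMDiff_pushforward {f f' : M → M} (hf : ContMDiff 𝓘(ℝ, E) 𝓘(ℝ, E) ∞ f)
    (hf' : ContMDiff 𝓘(ℝ, E) 𝓘(ℝ, E) ∞ f') (h : ∀ x, f (f' x) = x) (V : VecField E M) :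
    ContMDiff 𝓘(ℝ, E) (𝓘(ℝ, E).prod 𝓘(ℝ, E)) ∞
      (fun x => Bundle.TotalSpace.mk' E (E := (TangentSpace 𝓘(ℝ, E) : M → Type _)) x
        (mfderiv 𝓘(ℝ, E) 𝓘(ℝ, E) f (f' x) (V (f' x)))) := by
  have h1 := (hf.contMDiff_tangentMap (m := ∞) (by norm_cast)).comp (V.contMDiff.comp hf')
  convert h1 using 1
  funext x
  exact tangent_mk_congr (h x).symm _

theorem inCoordinates_comp {x₀ x y₀ y : M} (hy : y ∈ (chartAt E y₀).source)
    (D : TangentSpace 𝓘(ℝ, E) x →L[ℝ] TangentSpace 𝓘(ℝ, E) y)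
    (β : TangentSpace 𝓘(ℝ, E) y →L[ℝ] ℝ) :
    ContinuousLinearMap.inCoordinates E (TangentSpace 𝓘(ℝ, E)) ℝ (Bundle.Trivial M ℝ)
        x₀ x x₀ x (β.comp D) =
      (ContinuousLinearMap.inCoordinates E (TangentSpace 𝓘(ℝ, E)) ℝ (Bundle.Trivial M ℝ)
        y₀ y y₀ y β).comp
      (ContinuousLinearMap.inCoordinates E (TangentSpace 𝓘(ℝ, E)) E (TangentSpace 𝓘(ℝ, E))
        x₀ x y₀ y D) := by
  have hy' : y ∈ (trivializationAt E (TangentSpace 𝓘(ℝ, E)) y₀).baseSet := by simpa using hy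
  rw [ContinuousLinearMap.inCoordinates, ContinuousLinearMap.inCoordinates,
    ContinuousLinearMap.inCoordinates]
  ext v
  simp
  congr 1
  exact (Bundle.Trivialization.symmL_continuousLinearMapAt _ hy' _).symm

theorem contMDiff_pullback {f : M → M} (hf : ContMDiff 𝓘(ℝ, E) 𝓘(ℝ, E) ∞ f) (β : OneForm E M) :
    ContMDiff 𝓘(ℝ, E) (𝓘(ℝ, E).prod 𝓘(ℝ, E →L[ℝ] ℝ)) ∞
      (fun x => Bundle.TotalSpace.mk' (E →L[ℝ] ℝ)
        (E := fun x : M => TangentSpace 𝓘(ℝ, E) x →L[ℝ] ℝ) x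
        ((β (f x)).comp (mfderiv 𝓘(ℝ, E) 𝓘(ℝ, E) f x))) := by
  intro x₀
  rw [contMDiffAt_hom_bundle]
  refine ⟨contMDiffAt_id, ?_⟩
  have hβ := (contMDiffAt_hom_bundle _).1 (β.contMDiff (f x₀))
  have h1 := hβ.2.comp x₀ (hf x₀)
  have h2 := (hf x₀).mfderiv_const (m := ∞) (by norm_cast)
  refine (h1.clm_comp h2).congr_of_eventuallyEq ?_
  filter_upwards [(hf x₀).continuousAt.preimage_mem_nhds
    ((chartAt E (f x₀)).open_source.mem_nhds (mem_chart_source E (f x₀)))] with x hx'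
  exact inCoordinates_comp hx' _ _

variable (E M)

/-- A symplectic form on `M`: a smooth section of the bundle of bilinear forms on the tangent
spaces which is alternating, non-degenerate and closed. -/
structure SymplecticForm where
  form : ∀ x : M, TangentSpace 𝓘(ℝ, E) x →L[ℝ] TangentSpace 𝓘(ℝ, E) x →L[ℝ] ℝ
  contMDiff_form : ContMDiff 𝓘(ℝ, E) (𝓘(ℝ, E).prod 𝓘(ℝ, E →L[ℝ] E →L[ℝ] ℝ)) ∞
    (fun x => Bundle.TotalSpace.mk' (E →L[ℝ] E →L[ℝ] ℝ)
      (E := fun x : M => TangentSpace 𝓘(ℝ, E) x →L[ℝ] TangentSpace 𝓘(ℝ, E) x →L[ℝ] ℝ) x (form x))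
  alternating : ∀ (x : M) (v : TangentSpace 𝓘(ℝ, E) x), form x v v = 0
  nondegenerate : ∀ (x : M) (v : TangentSpace 𝓘(ℝ, E) x), (∀ w, form x v w = 0) → v = 0
  /-- The exterior derivative of the form vanishes in every chart `chartAt E x₀` of the atlas. -/
  closed : ∀ x₀ : M,
    let φ := chartAt E x₀
    let D : E → E →L[ℝ] E := fun y => mfderiv 𝓘(ℝ, E) 𝓘(ℝ, E) φ.symm y
    let loc : E → E →L[ℝ] E →L[ℝ] ℝ := fun y =>
      ContinuousLinearMap.bilinearComp (show E →L[ℝ] E →L[ℝ] ℝ from form (φ.symm y)) (D y) (D y)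
    ∀ y ∈ φ.target, ∀ u v w : E,
      fderiv ℝ loc y u v w - fderiv ℝ loc y v u w + fderiv ℝ loc y w u v = 0

variable {E M}

/-- The contraction `V ↦ ι_V ω = ω(V, ·)`. -/
def SymplecticForm.flat (Ω : SymplecticForm E M) : VecField E M →ₗ[SmoothFun E M] OneForm E M where
  toFun V := ⟨fun x => Ω.form x (V x), Ω.contMDiff_form.clm_bundle_apply V.contMDiff⟩
  map_add' V W := by ext x : 1; exact (Ω.form x).map_add (V x) (W x)
  map_smul' f V := by ext x : 1; exact (Ω.form x).map_smul (f x) (V x)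

end Manifold

/-! ## Lie groups -/

section LieGroup

variable (F : Type*) [NormedAddCommGroup F] [NormedSpace ℝ F]
  (G : Type*) [TopologicalSpace G] [ChartedSpace F G] [Group G]

/-- The Lie algebra of `G`: the tangent space at `1`, with the bracket of left-invariant fields. -/
abbrev LieAlg : Type _ := GroupLieAlgebra 𝓘(ℝ, F) G

instance [FiniteDimensional ℝ F] : FiniteDimensional ℝ (LieAlg F G) :=
  inferInstanceAs (FiniteDimensional ℝ F)

variable {F G}

/-- The adjoint action of `G` on its Lie algebra: the derivative at `1` of `h ↦ g h g⁻¹`. -/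
def Ad (g : G) : LieAlg F G →ₗ[ℝ] LieAlg F G where
  toFun X := mfderiv 𝓘(ℝ, F) 𝓘(ℝ, F) (fun h : G => g * h * g⁻¹) 1 X
  map_add' X Y := map_add (mfderiv 𝓘(ℝ, F) 𝓘(ℝ, F) (fun h : G => g * h * g⁻¹) 1) X Y
  map_smul' r X := map_smul (mfderiv 𝓘(ℝ, F) 𝓘(ℝ, F) (fun h : G => g * h * g⁻¹) 1) r X

/-- The left Maurer-Cartan form of `G` at `g`: the differential at `g` of the left translation by
`g⁻¹`. -/
def maurerCartan (g : G) : TangentSpace 𝓘(ℝ, F) g →ₗ[ℝ] LieAlg F G where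
  toFun X := mfderiv 𝓘(ℝ, F) 𝓘(ℝ, F) (fun h : G => g⁻¹ * h) g X
  map_add' X Y := map_add (mfderiv 𝓘(ℝ, F) 𝓘(ℝ, F) (fun h : G => g⁻¹ * h) g) X Y
  map_smul' r X := map_smul (mfderiv 𝓘(ℝ, F) 𝓘(ℝ, F) (fun h : G => g⁻¹ * h) g) r X

variable [FiniteDimensional ℝ F] [LieGroup 𝓘(ℝ, F) ∞ G]

/-- The bracket of the Lie algebra of `G`, as a bilinear map. -/
def lieBracket : LieAlg F G →ₗ[ℝ] LieAlg F G →ₗ[ℝ] LieAlg F G :=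
  haveI : CompleteSpace F := FiniteDimensional.complete ℝ F
  haveI : LieGroup 𝓘(ℝ, F) (minSmoothness ℝ 3) G := by
    rw [minSmoothness_of_isRCLikeNormedField]
    exact LieGroup.of_le (n := ∞) (WithTop.coe_le_coe.2 (le_top : (3 : ℕ∞) ≤ ⊤))
  LinearMap.mk₂ ℝ (fun X Y : LieAlg F G => ⁅X, Y⁆) add_lie smul_lie lie_add lie_smul

end LieGroup

/-! ## Hamiltonian actions -/

section Hamiltonian

theorem contMDiff_act {E : Type*} [NormedAddCommGroup E] [NormedSpace ℝ E] {M : Type*}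
    [TopologicalSpace M] [ChartedSpace E M] (F : Type*) [NormedAddCommGroup F] [NormedSpace ℝ F] {G : Type*}
    [TopologicalSpace G] [ChartedSpace F G] [Group G] [MulAction G M]
    [ContMDiffSMul 𝓘(ℝ, F) 𝓘(ℝ, E) ∞ G M] (g : G) :
    ContMDiff 𝓘(ℝ, E) 𝓘(ℝ, E) ∞ (fun x : M => g • x) :=
  (contMDiff_smul (I := 𝓘(ℝ, F)) (I' := 𝓘(ℝ, E)) (n := ∞)).comp
    (contMDiff_const.prodMk contMDiff_id)

variable (E : Type*) [NormedAddCommGroup E] [NormedSpace ℝ E]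
  (M : Type*) [TopologicalSpace M] [ChartedSpace E M] [IsManifold 𝓘(ℝ, E) ∞ M]
  (F : Type*) [NormedAddCommGroup F] [NormedSpace ℝ F]
  (G : Type*) [TopologicalSpace G] [ChartedSpace F G] [Group G] [LieGroup 𝓘(ℝ, F) ∞ G]
  [MulAction G M] [ContMDiffSMul 𝓘(ℝ, F) 𝓘(ℝ, E) ∞ G M]

variable {E M F G} in
/-- The value at `x` of the fundamental vector field of `X`: the derivative at `1` of `g ↦ g x`. -/
def fundVec (X : LieAlg F G) (x : M) : TangentSpace 𝓘(ℝ, E) x :=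
  (mfderiv 𝓘(ℝ, F) 𝓘(ℝ, E) (fun g : G => g • x) 1 X : E)

theorem contMDiff_fundVec (X : LieAlg F G) :
    ContMDiff 𝓘(ℝ, E) (𝓘(ℝ, E).prod 𝓘(ℝ, E)) ∞ (fun x => Bundle.TotalSpace.mk' E
      (E := (TangentSpace 𝓘(ℝ, E) : M → Type _)) x (fundVec X x)) := by
  have : IsManifold 𝓘(ℝ, F) ∞ G := LieGroup.toContMDiffMul.toIsManifold
  let fx : M → TangentBundle 𝓘(ℝ, E) M := fun x ↦ Bundle.TotalSpace.mk' E x 0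
  have sfx : ContMDiff 𝓘(ℝ, E) (𝓘(ℝ, E).prod 𝓘(ℝ, E)) ∞ fx := Bundle.contMDiff_zeroSection _ _
  let fv : M → TangentBundle 𝓘(ℝ, F) G := fun _ ↦ Bundle.TotalSpace.mk' F 1 X
  have sfv : ContMDiff 𝓘(ℝ, E) (𝓘(ℝ, F).prod 𝓘(ℝ, F)) ∞ fv := contMDiff_const
  have S₁ := sfv.prodMk sfx
  have S₂ := contMDiff_equivTangentBundleProd_symm (I := 𝓘(ℝ, F)) (M := G) (I' := 𝓘(ℝ, E))
    (M' := M) (n := ∞)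
  have hs : ContMDiff (𝓘(ℝ, F).prod 𝓘(ℝ, E)) 𝓘(ℝ, E) ∞ fun p : G × M => p.1 • p.2 :=
    contMDiff_smul
  have S₃ := hs.contMDiff_tangentMap (m := ∞) (by norm_cast)
  have S := (S₃.comp S₂).comp S₁
  have e : (fun x => Bundle.TotalSpace.mk' E
      (E := (TangentSpace 𝓘(ℝ, E) : M → Type _)) x (fundVec X x)) =
      fun x => Bundle.TotalSpace.mk' E
        (E := (TangentSpace 𝓘(ℝ, E) : M → Type _)) ((1 : G) • x) (fundVec X x) := by
    funext x; exact tangent_mk_congr (one_smul G x).symm _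
  rw [e]
  convert! S with g
  simp only [Function.comp_apply, tangentMap, fx, fv]
  rw [mfderiv_prod_eq_add_apply (hs.mdifferentiableAt (by simp))]
  simp +instances [fundVec]
  exact heq_of_eq ((add_zero (show E from mfderiv 𝓘(ℝ, F) 𝓘(ℝ, E) (fun a : G => a • g) 1 X)).symm.trans
    (congrArg _ (map_zero (mfderiv 𝓘(ℝ, E) 𝓘(ℝ, E) (fun z : M => (1 : G) • z) g)).symm))

/-- The infinitesimal action `X ↦ X♯`, where `X♯` is the fundamental vector field of `X`. -/
def fund : LieAlg F G →ₗ[ℝ] VecField E M where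
  toFun X := ⟨fun x => fundVec X x, contMDiff_fundVec E M F G X⟩
  map_add' X Y := by
    ext x; exact map_add (mfderiv 𝓘(ℝ, F) 𝓘(ℝ, E) (fun g : G => g • x) 1) X Y
  map_smul' r X := by
    ext x; exact map_smul (mfderiv 𝓘(ℝ, F) 𝓘(ℝ, E) (fun g : G => g • x) 1) r X

variable [FiniteDimensional ℝ F]

/-- A Hamiltonian action of `G` on `M`: an invariant symplectic form and an equivariant smooth
moment map `μ` with `ι_{X♯} ω = d⟨μ, X⟩`. No regularity of `μ`, and no freeness or properness of
the action, is required. -/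
structure HamiltonianAction extends SymplecticForm E M where
  invariant : ∀ (g : G) (x : M) (u v : TangentSpace 𝓘(ℝ, E) x),
    form (g • x) (mfderiv 𝓘(ℝ, E) 𝓘(ℝ, E) (fun y : M => g • y) x u)
      (mfderiv 𝓘(ℝ, E) 𝓘(ℝ, E) (fun y : M => g • y) x v) = form x u v
  μ : M → Module.Dual ℝ (LieAlg F G)
  contMDiff_μ : ∀ X : LieAlg F G, ContMDiff 𝓘(ℝ, E) 𝓘(ℝ) ∞ (fun x => μ x X)
  equivariant : ∀ (g : G) (x : M) (X : LieAlg F G), μ (g • x) X = μ x (Ad g⁻¹ X)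
  moment : ∀ (X : LieAlg F G) (x : M) (v : TangentSpace 𝓘(ℝ, E) x),
    form x (fundVec X x) v = mvfderiv 𝓘(ℝ, E) (fun y => μ y X) x v

variable {E M F G}

/-- The function `⟨μ, X⟩`. -/
def HamiltonianAction.comoment (H : HamiltonianAction E M F G) :
    LieAlg F G →ₗ[ℝ] SmoothFun E M where
  toFun X := ⟨fun x => H.μ x X, H.contMDiff_μ X⟩
  map_add' X Y := by ext x; exact map_add (H.μ x) X Y
  map_smul' r X := by ext x; exact map_smul (H.μ x) r X

/-! ### The dg-modules and the map of a Hamiltonian action -/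

variable (E M F G)

/-- The action of `G` on functions: `(g · f)(x) = f(g⁻¹ x)`. -/
def actFun (g : G) : SmoothFun E M →ₐ[ℝ] SmoothFun E M where
  toFun f := ⟨fun x => f (g⁻¹ • x), f.contMDiff.comp (contMDiff_act F g⁻¹)⟩
  map_one' := by ext x; rfl
  map_mul' f h := by ext x; rfl
  map_zero' := by ext x; rfl
  map_add' f h := by ext x; rfl
  commutes' r := by ext x; rfl

/-- The action of `G` on vector fields by pushforward. -/
def actVec (g : G) : VecField E M →ₛₗ[(actFun E M F G g).toRingHom] VecField E M where
  toFun V := ⟨fun x => (mfderiv 𝓘(ℝ, E) 𝓘(ℝ, E) (fun y : M => g • y) (g⁻¹ • x) (V (g⁻¹ • x)) : E),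
    contMDiff_pushforward (contMDiff_act F g) (contMDiff_act F g⁻¹) (smul_inv_smul g) V⟩
  map_add' V W := by
    ext x
    exact map_add (mfderiv 𝓘(ℝ, E) 𝓘(ℝ, E) (fun y : M => g • y) (g⁻¹ • x)) _ _
  map_smul' f V := by
    ext x
    exact map_smul (mfderiv 𝓘(ℝ, E) 𝓘(ℝ, E) (fun y : M => g • y) (g⁻¹ • x)) _ _

/-- The action of `G` on one-forms by pullback along `g⁻¹`. -/
def actForm (g : G) : OneForm E M →ₛₗ[(actFun E M F G g).toRingHom] OneForm E M where
  toFun β := ⟨fun x => (β (g⁻¹ • x)).comp (mfderiv 𝓘(ℝ, E) 𝓘(ℝ, E) (fun y : M => g⁻¹ • y) x),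
    contMDiff_pullback (contMDiff_act F g⁻¹) β⟩
  map_add' β β' := by ext x : 1; rfl
  map_smul' f β := by ext x : 1; rfl

variable {E M F G}

namespace HamiltonianAction

variable (H : HamiltonianAction E M F G)

/-- The algebra `C^∞(Z)` of the derived zero level set of the moment map. -/
abbrev Fun (_H : HamiltonianAction E M F G) : Type _ := FunZ (SmoothFun E M) (LieAlg F G)

/-- The grading of `C^∞(Z)`. -/
abbrev deg (n : ℤ) : Submodule (SmoothFun E M) H.Fun := degZ (SmoothFun E M) (LieAlg F G) n

/-- The differential `ι_μ` of `C^∞(Z)`. -/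
def iotaMu : H.Fun →ₗ[SmoothFun E M] H.Fun := contrMu H.comoment

/-- The action of `G` on `C^∞(Z)`. -/
def act (g : G) : H.Fun →+* H.Fun := (actZ (actFun E M F G g) (Ad g)).toRingHom

/-- The total complex of the tangent complex `ρ : 𝔤_Z → T_Z` of the action groupoid. -/
abbrev Tangent (_H : HamiltonianAction E M F G) : Type _ :=
  TotT (SmoothFun E M) (LieAlg F G) (VecField E M)

/-- The total complex of the cotangent complex `ρ^* : T^*_Z → 𝔤^*_Z` of the action groupoid. -/
abbrev Cotangent (_H : HamiltonianAction E M F G) : Type _ :=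
  TotCT (SmoothFun E M) (LieAlg F G) (OneForm E M)

/-- The grading of the total tangent complex. -/
abbrev degT (n : ℤ) : Submodule (SmoothFun E M) H.Tangent :=
  degTotT (SmoothFun E M) (LieAlg F G) (VecField E M) n

/-- The grading of the total cotangent complex. -/
abbrev degCT (n : ℤ) : Submodule (SmoothFun E M) H.Cotangent :=
  degTotCT (SmoothFun E M) (LieAlg F G) (OneForm E M) n

/-- The differential of the total tangent complex. -/
def dT : H.Tangent →ₗ[SmoothFun E M] H.Tangent :=
  dTotT H.comoment pairing (dFun ∘ₗ H.comoment) lieBracket (fund E M F G)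

/-- The differential of the total cotangent complex. -/
def dCT : H.Cotangent →ₗ[SmoothFun E M] H.Cotangent :=
  dTotCT H.comoment pairing (dFun ∘ₗ H.comoment) lieBracket (fund E M F G)

/-- The action of `G` on the total tangent complex: pushforward on vector fields, adjoint and
coadjoint action on `𝔤` and `𝔤^*`. -/
def actT (g : G) : H.Tangent →+ H.Tangent :=
  actTotT (actFun E M F G g) (Ad g) (Ad g⁻¹).dualMap (actVec E M F G g)

/-- The action of `G` on the total cotangent complex. -/
def actCT (g : G) : H.Cotangent →+ H.Cotangent :=
  actTotCT (actFun E M F G g) (Ad g) (Ad g⁻¹).dualMap (actForm E M F G g)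

/-- The map `ω_red^♭ = α + (ι_Z^* ω)^♭ + α^*` induced by the reduced form
`ω_red = ι_Z^* ω + dθ`. -/
def omegaRed : H.Tangent →ₗ[H.Fun] H.Cotangent :=
  reducedFlat H.toSymplecticForm.flat (maurerCartan (F := F) (1 : G))

end HamiltonianAction

end Hamiltonian

end DerivedReduction

end

open scoped Topology
open Filter

set_option linter.unusedSectionVars false

noncomputable section

/-! Every operator in the statement is determined by its values on generators. The differentials
obey a Leibniz rule (`SatisfiesLeibniz`), the group acts semilinearly, and the reduced form induces
a linear map. An identity such as "the differential squares to zero", "the map is a chain map" or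
"the action commutes with the differential" is therefore stable under sums and multiples. By
`TotT.induction` and `TotCT.induction` it only has to be checked on `X`, `W` and `ι_σ`, or on `dX`,
`β` and `σ`.

On generators each identity becomes one classical fact about Hamiltonian actions. The square of
either differential vanishes because `X♯⟨μ, Y⟩ = -⟨μ, [X, Y]⟩`. The chain map property at `X` is
`ι_{X♯} ω = d⟨μ, X⟩` together with antisymmetry of the bracket; at `W` it is the moment equation
together with antisymmetry of `ω`. Equivariance is the naturality of pairing, differential,
fundamental fields, bracket, moment map and `ω` under one group element, collected in `IsSymmetry`
and `actForm_flat`. Bijectivity holds because, the Maurer–Cartan form being the identity at the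
unit, the map only reassociates the summands and applies `ω^♭` to the middle one. There `ω^♭` is
invertible on smooth sections because `ω` is nondegenerate (`SymplecticForm.bijective_flat`). No
regularity of `μ` or freeness of the action enters.

The analytic core is the infinitesimal equivariance of `μ`. It is obtained by differentiating
`⟨μ(gx), Y⟩ = ⟨μ(x), Ad_{g⁻¹} Y⟩` at `g = 1`, which requires the derivative of `g ↦ Ad_g Y` to be `X
↦ [X, Y]` for the bracket of left-invariant fields (`modelDeriv_adVec`). This is proved in the chart
at `1`: there `Ad` is defined implicitly by comparing the two partial derivatives of the
multiplication, and both sides become the same combination of second derivatives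
(`exists_hasFDerivAt_adjoint`). -/

namespace DerivedReduction

/-! ### Gradings described by projections, and operators acting on coefficients. -/

section GradedModules

section Projections

variable {ι A N N' : Type*} [CommRing A] [AddCommGroup N] [Module A N] [AddCommGroup N']
  [Module A N']

/-- A family of submodules that spans and admits projections onto its members. -/
structure HasProjections (deg : ι → Submodule A N) : Prop where
  iSup_eq_top : iSup deg = ⊤
  exists_proj : ∃ p : ι → N →ₗ[A] N, (∀ n, ∀ x ∈ deg n, p n x = x) ∧
    ∀ n m, n ≠ m → ∀ x ∈ deg m, p n x = 0

/-- The projection onto one member kills the span of all the others, which gives independence.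
Describing a grading by projections is convenient because they are inherited by products and can be
applied to the coefficients of a tensor product, where independence is hard to see directly. -/
theorem HasProjections.isInternal [DecidableEq ι] {deg : ι → Submodule A N}
    (h : HasProjections deg) : DirectSum.IsInternal deg := by
  obtain ⟨p, hp, hp'⟩ := h.exists_proj
  refine DirectSum.isInternal_submodule_of_iSupIndep_of_iSup_eq_top ?_ h.iSup_eq_top
  intro n
  rw [Submodule.disjoint_def]
  intro x hx hx'
  have hle : (⨆ j, ⨆ _ : j ≠ n, deg j) ≤ LinearMap.ker (p n) :=
    iSup₂_le fun m hm y hy => hp' n m hm.symm y hy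
  rw [← hp n x hx]
  exact hle hx'

theorem HasProjections.of_isInternal [DecidableEq ι] {deg : ι → Submodule A N}
    (h : DirectSum.IsInternal deg) : HasProjections deg := by
  let := h.chooseDecomposition
  refine ⟨h.submodule_iSup_eq_top, fun n => (deg n).subtype ∘ₗ DirectSum.component A ι _ n ∘ₗ
    (DirectSum.decomposeLinearEquiv deg).toLinearMap, ?_, ?_⟩
  · intro n x hx
    exact DirectSum.decompose_of_mem_same deg hx
  · intro n m hnm x hx
    exact DirectSum.decompose_of_mem_ne deg hx hnm.symm

theorem HasProjections.prod {deg : ι → Submodule A N} {deg' : ι → Submodule A N'}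
    (h : HasProjections deg) (h' : HasProjections deg') :
    HasProjections fun n => (deg n).prod (deg' n) := by
  obtain ⟨p, hp, hp'⟩ := h.exists_proj
  obtain ⟨q, hq, hq'⟩ := h'.exists_proj
  refine ⟨?_, fun n => (p n).prodMap (q n), ?_, ?_⟩
  · rw [eq_top_iff]
    rintro ⟨x, y⟩ -
    have hx : iSup deg ≤ Submodule.comap (LinearMap.inl A N N') (⨆ n, (deg n).prod (deg' n)) :=
      iSup_le fun n x hx => Submodule.mem_iSup_of_mem n (Submodule.mem_prod.2 ⟨hx, (deg' n).zero_mem⟩)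
    have hy : iSup deg' ≤ Submodule.comap (LinearMap.inr A N N') (⨆ n, (deg n).prod (deg' n)) :=
      iSup_le fun n x hx => Submodule.mem_iSup_of_mem n (Submodule.mem_prod.2 ⟨(deg n).zero_mem, hx⟩)
    rw [h.iSup_eq_top] at hx
    rw [h'.iSup_eq_top] at hy
    have hx' : LinearMap.inl A N N' x ∈ ⨆ n, (deg n).prod (deg' n) := hx Submodule.mem_top
    have hy' : LinearMap.inr A N N' y ∈ ⨆ n, (deg n).prod (deg' n) := hy Submodule.mem_top
    simpa using add_mem hx' hy'
  · rintro n ⟨x, y⟩ ⟨hx, hy⟩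
    exact Prod.ext (hp n x hx) (hq n y hy)
  · rintro n m hnm ⟨x, y⟩ ⟨hx, hy⟩
    exact Prod.ext (hp' n m hnm x hx) (hq' n m hnm y hy)

end Projections

section ExtendScalars

variable {R C P N : Type*} [CommSemiring R] [Semiring C] [Algebra R C] [AddCommMonoid P]
  [Module R P] [AddCommMonoid N] [Module R N] [Module C N] [IsScalarTower R C N]

@[simp] theorem extendScalars_tmul (f : P →ₗ[R] N) (c : C) (p : P) :
    extendScalars f (c ⊗ₜ[R] p) = c • f p := rfl

end ExtendScalars

section Coefficients

variable {R A C : Type*} {P : Type*} [CommRing R] [CommRing A] [Algebra R A]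
  [Ring C] [Algebra R C] [Algebra A C] [IsScalarTower R A C] [AddCommGroup P] [Module R P]

@[simp] theorem onCoeff_tmul (f : C →ₗ[A] C) (c : C) (p : P) :
    onCoeff P f (c ⊗ₜ[R] p) = f c ⊗ₜ p := rfl

@[simp] theorem tmulRight_apply (p : P) (c : C) :
    tmulRight A C p c = c ⊗ₜ[R] p := rfl

/-- A derivation twisted by `s` remains one after tensoring with generators. With `s` the grading
operator this is the Leibniz rule for the coefficient part of all differentials. -/
theorem onCoeff_smul_of_derivation {f s : C →ₗ[A] C}
    (h : ∀ c c', f (c * c') = f c * c' + s c * f c') (c : C) (z : C ⊗[R] P) :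
    onCoeff P f (c • z) = f c • z + s c • onCoeff P f z := by
  induction z with
  | zero => simp
  | add x y hx hy => simp only [smul_add, map_add, hx, hy]; abel
  | tmul c' p => simp [TensorProduct.smul_tmul', h, TensorProduct.add_tmul]

theorem onCoeff_smul_of_multiplicative {s : C →ₗ[A] C}
    (h : ∀ c c', s (c * c') = s c * s c') (c : C) (z : C ⊗[R] P) :
    onCoeff P s (c • z) = s c • onCoeff P s z := by
  induction z with
  | zero => simp
  | add x y hx hy => simp only [smul_add, map_add, hx, hy]
  | tmul c' p => simp [TensorProduct.smul_tmul', h]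

variable {degC : ℤ → Submodule A C}

theorem tmul_mem_genDeg {d n : ℤ} {c : C} (hc : c ∈ degC (n - d)) (p : P) :
    c ⊗ₜ[R] p ∈ genDeg P degC d n :=
  Submodule.subset_span ⟨c, hc, p, rfl⟩

/-- To map `C ⊗ P` additively into a graded module, preserving degrees, it suffices to do so
for pure tensors. -/
theorem map_mem_of_mem_genDeg {N : Type*} [AddCommGroup N] {d n : ℤ} {S : AddSubgroup N}
    (f : C ⊗[R] P →+ N) (h : ∀ c ∈ degC (n - d), ∀ p : P, f (c ⊗ₜ p) ∈ S) {z : C ⊗[R] P}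
    (hz : z ∈ genDeg P degC d n) : f z ∈ S := by
  refine Submodule.closure_induction (p := fun z _ => f z ∈ S) (by simp) ?_ ?_ hz
  · intro x y _ _ hx hy
    rw [map_add]
    exact add_mem hx hy
  · rintro a - ⟨c, hc, p, rfl⟩
    -- The scalar is absorbed into the homogeneous coefficient, so `f` need only be additive. This
    -- matters for the group action, which is only semilinear.
    rw [TensorProduct.smul_tmul']
    exact h _ ((degC _).smul_mem a hc) p

theorem smul_mem_genDeg (hmul : ∀ {i j c c'}, c ∈ degC i → c' ∈ degC j → c * c' ∈ degC (i + j))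
    {i j d : ℤ} {c : C} {z : C ⊗[R] P} (hc : c ∈ degC i) (hz : z ∈ genDeg P degC d j) :
    c • z ∈ genDeg P degC d (i + j) := by
  refine map_mem_of_mem_genDeg (S := (genDeg P degC d (i + j)).toAddSubgroup)
    (DistribSMul.toAddMonoidHom _ c) (fun c' hc' p => ?_) hz
  refine tmul_mem_genDeg (c := c * c') ?_ p
  rw [add_sub_assoc]
  exact hmul hc hc'

theorem onCoeff_mem_genDeg {f : C →ₗ[A] C} {k : ℤ} (hf : ∀ {i c}, c ∈ degC i → f c ∈ degC (i + k))
    {d n : ℤ} {z : C ⊗[R] P} (hz : z ∈ genDeg P degC d n) :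
    onCoeff P f z ∈ genDeg P degC d (n + k) := by
  refine map_mem_of_mem_genDeg (S := (genDeg P degC d (n + k)).toAddSubgroup)
    (onCoeff P f).toAddMonoidHom (fun c hc p => ?_) hz
  refine tmul_mem_genDeg (c := f c) ?_ p
  rw [add_sub_right_comm]
  exact hf hc

theorem HasProjections.genDeg (h : HasProjections degC) (d : ℤ) :
    HasProjections (genDeg (R := R) P degC d) := by
  obtain ⟨p, hp, hp'⟩ := h.exists_proj
  refine ⟨?_, fun n => onCoeff P (p (n - d)), ?_, ?_⟩
  · rw [eq_top_iff]
    rintro z -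
    induction z with
    | zero => exact zero_mem _
    | add x y hx hy => exact add_mem hx hy
    | tmul c q =>
      have hle : iSup degC ≤ (⨆ n, DerivedReduction.genDeg (R := R) P degC d n).comap
          (tmulRight A C q) := by
        -- Here `n` is the degree of the coefficient; the generators contribute the remaining `d`.
        refine iSup_le fun n c hc => Submodule.mem_iSup_of_mem (n + d) ?_
        exact tmul_mem_genDeg (by rwa [add_sub_cancel_right]) q
      rw [h.iSup_eq_top] at hle
      exact hle (Submodule.mem_top (x := c))
  · intro n z hz
    -- Equality with the identity is membership of the difference in the zero subgroup, which can be
    -- tested on pure tensors.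
    have := map_mem_of_mem_genDeg (S := ⊥)
      ((onCoeff P (p (n - d)) - LinearMap.id).toAddMonoidHom) (fun c hc q => ?_) hz
    · exact sub_eq_zero.1 this
    · change onCoeff P (p (n - d)) (c ⊗ₜ q) - c ⊗ₜ q = 0
      rw [onCoeff_tmul, hp _ c hc, sub_self]
  · intro n m hnm z hz
    refine map_mem_of_mem_genDeg (S := ⊥)
      ((onCoeff P (p (n - d))).toAddMonoidHom) (fun c hc q => ?_) hz
    change onCoeff P (p (n - d)) (c ⊗ₜ q) = 0
    rw [onCoeff_tmul, hp' _ _ (by omega) c hc, TensorProduct.zero_tmul]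

end Coefficients

end GradedModules

/-! ### Contraction and parity on the exterior algebra. -/

section ExteriorContraction

variable {K V : Type*} [CommRing K] [AddCommGroup V] [Module K V]

/-- The rule for contracting a vector times an element gives the induction step: each vector moved
past the contraction contributes one sign, and these signs assemble into the parity involution. -/
theorem contractLeft_mul (d : Module.Dual K V) (x y : ExteriorAlgebra K V) :
    CliffordAlgebra.contractLeft (Q := (0 : QuadraticForm K V)) d (x * y) =
      CliffordAlgebra.contractLeft d x * y +
        CliffordAlgebra.involute (Q := (0 : QuadraticForm K V)) x *
          CliffordAlgebra.contractLeft d y := by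
  induction x using CliffordAlgebra.left_induction with
  | algebraMap r => simp [CliffordAlgebra.contractLeft_algebraMap_mul]
  | add x x' hx hx' => simp only [add_mul, map_add, hx, hx']; abel
  | ι_mul x v hx =>
    rw [mul_assoc, CliffordAlgebra.contractLeft_ι_mul, hx, CliffordAlgebra.contractLeft_ι_mul,
      map_mul, CliffordAlgebra.involute_ι]
    simp only [mul_add, sub_mul, smul_mul_assoc, neg_mul, mul_assoc]
    abel

theorem involute_of_mem_exteriorPower {n : ℕ} {x : ExteriorAlgebra K V} (hx : x ∈ ⋀[K]^n V) :
    CliffordAlgebra.involute (Q := (0 : QuadraticForm K V)) x = (-1 : ℤ) ^ n • x := by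
  induction hx using Submodule.pow_induction_on_left' with
  | algebraMap r => simp
  | add x y i _ _ hx hy => rw [map_add, hx, hy, smul_add]
  | mem_mul m hm i x _ hx =>
    obtain ⟨v, rfl⟩ := hm
    rw [map_mul, hx, pow_succ]
    erw [CliffordAlgebra.involute_ι]
    rw [neg_mul, mul_smul_comm, mul_neg_one, neg_smul]

/-- Exterior powers are indexed by naturals, so "degree `n - 1`" splits into two cases: scalars are
annihilated, and `Λ^{k+1}` goes to `Λ^k`. The first case is exactly what makes the contraction
vanish in the top degree `0` of `C^∞(Z)`. -/
theorem contractLeft_mem_exteriorPower (d : Module.Dual K V) {n : ℕ} {x : ExteriorAlgebra K V}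
    (hx : x ∈ ⋀[K]^n V) :
    (n = 0 ∧ CliffordAlgebra.contractLeft (Q := (0 : QuadraticForm K V)) d x = 0) ∨
      ∃ k, n = k + 1 ∧ CliffordAlgebra.contractLeft (Q := (0 : QuadraticForm K V)) d x ∈
        ⋀[K]^k V := by
  induction hx using Submodule.pow_induction_on_left' with
  | algebraMap r => exact Or.inl ⟨rfl, CliffordAlgebra.contractLeft_algebraMap _ _ r⟩
  | add x y i _ _ hx hy =>
    rcases hx with ⟨h0, hx⟩ | ⟨k, hk, hx⟩
    · rcases hy with ⟨-, hy⟩ | ⟨k, hk, hy⟩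
      · exact Or.inl ⟨h0, by rw [map_add, hx, hy, add_zero]⟩
      · omega
    · rcases hy with ⟨h0, -⟩ | ⟨k', hk', hy⟩
      · omega
      · obtain rfl : k = k' := by omega
        exact Or.inr ⟨k, hk, by rw [map_add]; exact add_mem hx hy⟩
  | mem_mul m hm i x hxi hx =>
    obtain ⟨v, rfl⟩ := hm
    refine Or.inr ⟨i, rfl, ?_⟩
    have key := CliffordAlgebra.contractLeft_ι_mul (Q := (0 : QuadraticForm K V)) d v x
    refine Set.mem_of_eq_of_mem key (sub_mem (Submodule.smul_mem _ _ hxi) ?_)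
    rcases hx with ⟨-, hx⟩ | ⟨k, rfl, hx⟩
    · rw [hx, mul_zero]; exact zero_mem _
    · change _ ∈ LinearMap.range (ExteriorAlgebra.ι K : V →ₗ[K] _) ^ (k + 1)
      rw [pow_succ']
      exact Submodule.mul_mem_mul (LinearMap.mem_range_self _ v) hx

theorem exteriorAlgebra_map_mem {V' : Type*} [AddCommGroup V'] [Module K V'] (a : V →ₗ[K] V')
    {n : ℕ} {x : ExteriorAlgebra K V} (hx : x ∈ ⋀[K]^n V) : ExteriorAlgebra.map a x ∈ ⋀[K]^n V' := by
  have h : (⋀[K]^n V).map (ExteriorAlgebra.map a).toLinearMap ≤ ⋀[K]^n V' := by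
    rw [Submodule.map_pow]
    refine pow_le_pow_left' ?_ n
    rintro - ⟨-, ⟨v, rfl⟩, rfl⟩
    exact ⟨a v, (ExteriorAlgebra.map_apply_ι a v).symm⟩
  exact h ⟨x, hx, rfl⟩

end ExteriorContraction

/-! ### The dg-algebra `C^∞(Z)`: grading, parity, contraction with `μ`, induced action. -/

section FunctionsOnZeroLevel

variable {A 𝔤 : Type*} [CommRing A] [Algebra ℝ A] [AddCommGroup 𝔤] [Module ℝ 𝔤]

/-- The generator of degree `-1` of `C^∞(Z)` given by an element of the Lie algebra. -/
def FunZ.lie (A : Type*) [CommRing A] [Algebra ℝ A] : 𝔤 →ₗ[ℝ] FunZ A 𝔤 :=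
  TensorProduct.mk ℝ A (ExteriorAlgebra ℝ 𝔤) 1 ∘ₗ ExteriorAlgebra.ι ℝ

theorem FunZ.lie_apply (X : 𝔤) : FunZ.lie A X = 1 ⊗ₜ ExteriorAlgebra.ι ℝ X := rfl

/-- As a ring, `C^∞(Z)` is generated by functions and by `𝔤` in degree `-1`. Identities between
multiplicative operators or twisted derivations thereby reduce to these two kinds of element. -/
theorem FunZ.induction {p : FunZ A 𝔤 → Prop} (scalar : ∀ a, p (algebraMap A _ a))
    (lie : ∀ X, p (FunZ.lie A X)) (mul : ∀ c c', p c → p c' → p (c * c'))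
    (add : ∀ c c', p c → p c' → p (c + c')) (c : FunZ A 𝔤) : p c := by
  induction c using TensorProduct.induction_on with
  | zero => simpa using scalar 0
  | add x y hx hy => exact add x y hx hy
  | tmul a w =>
    have hw : p (1 ⊗ₜ w) := by
      induction w using ExteriorAlgebra.induction with
      | algebraMap r =>
        -- A real constant can be moved across the tensor product, so scalars of the exterior
        -- algebra are already scalars of `A`.
        have := scalar (algebraMap ℝ A r)
        rwa [Algebra.TensorProduct.algebraMap_apply, Algebra.algebraMap_self_apply,
          Algebra.algebraMap_eq_smul_one r, TensorProduct.smul_tmul,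
          ← Algebra.algebraMap_eq_smul_one] at this
      | ι X => exact lie X
      | mul w w' hw hw' =>
        have := mul _ _ hw hw'
        rwa [Algebra.TensorProduct.tmul_mul_tmul, one_mul] at this
      | add w w' hw hw' => rw [TensorProduct.tmul_add]; exact add _ _ hw hw'
    have := mul _ _ (scalar a) hw
    rwa [Algebra.TensorProduct.algebraMap_apply, Algebra.TensorProduct.tmul_mul_tmul, one_mul,
      mul_one] at this

theorem degZ_neg_natCast (k : ℕ) : degZ A 𝔤 (-k) = (⋀[ℝ]^k 𝔤).baseChange A := by
  simp [degZ]

theorem degZ_of_pos {n : ℤ} (hn : 0 < n) : degZ A 𝔤 n = ⊥ := if_neg (by omega)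

/-- A property of the homogeneous elements of `C^∞(Z)` that is linear in the element holds if it
holds for the elements `1 ⊗ w` with `w ∈ Λ^k 𝔤`. -/
theorem degZ_le_of_forall {n : ℤ} {S : Submodule A (FunZ A 𝔤)}
    (h : ∀ k : ℕ, n = -k → ∀ w ∈ ⋀[ℝ]^k 𝔤, (1 : A) ⊗ₜ w ∈ S) : degZ A 𝔤 n ≤ S := by
  rcases lt_or_ge 0 n with hn | hn
  · rw [degZ_of_pos hn]; exact bot_le
  · obtain ⟨k, rfl⟩ : ∃ k : ℕ, n = -k := ⟨n.natAbs, by omega⟩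
    rw [degZ_neg_natCast, Submodule.baseChange_eq_span, Submodule.span_le]
    rintro - ⟨w, hw, rfl⟩
    exact h k rfl w hw

theorem one_tmul_mem_degZ {k : ℕ} {w : ExteriorAlgebra ℝ 𝔤} (hw : w ∈ ⋀[ℝ]^k 𝔤) :
    (1 : A) ⊗ₜ w ∈ degZ A 𝔤 (-k) := by
  rw [degZ_neg_natCast]
  exact Submodule.tmul_mem_baseChange_of_mem 1 hw

theorem lie_mem_degZ (X : 𝔤) : FunZ.lie A X ∈ degZ A 𝔤 (-1) :=
  one_tmul_mem_degZ (k := 1) (by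
    change _ ∈ LinearMap.range (ExteriorAlgebra.ι ℝ : 𝔤 →ₗ[ℝ] _) ^ 1
    rw [pow_one]
    exact LinearMap.mem_range_self _ X)

theorem one_mem_degZ : (1 : FunZ A 𝔤) ∈ degZ A 𝔤 0 :=
  one_tmul_mem_degZ (k := 0) (by
    change _ ∈ LinearMap.range (ExteriorAlgebra.ι ℝ : 𝔤 →ₗ[ℝ] _) ^ 0
    rw [pow_zero]
    exact Submodule.one_le.1 le_rfl)

theorem algebraMap_mem_degZ (a : A) : algebraMap A (FunZ A 𝔤) a ∈ degZ A 𝔤 0 := by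
  rw [Algebra.algebraMap_eq_smul_one]
  exact Submodule.smul_mem _ a one_mem_degZ

theorem mul_mem_degZ {i j : ℤ} {c c' : FunZ A 𝔤} (hc : c ∈ degZ A 𝔤 i) (hc' : c' ∈ degZ A 𝔤 j) :
    c * c' ∈ degZ A 𝔤 (i + j) := by
  refine degZ_le_of_forall (S := (degZ A 𝔤 (i + j)).comap (LinearMap.mulRight A c')) ?_ hc
  rintro k rfl w hw
  refine degZ_le_of_forall (S := (degZ A 𝔤 (-k + j)).comap (LinearMap.mulLeft A (1 ⊗ₜ w))) ?_ hc'
  rintro l rfl w' hw'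
  have := one_tmul_mem_degZ (A := A) (SetLike.GradedMul.mul_mem hw hw')
  rw [Submodule.mem_comap, LinearMap.mulLeft_apply, Algebra.TensorProduct.tmul_mul_tmul, one_mul]
  convert this using 2
  push_cast
  ring

/-- The grading of the exterior algebra by naturals survives base change to `A`. It is reindexed by
the nonpositive integers, with zero projection in positive degrees. -/
theorem hasProjections_degZ : HasProjections (degZ A 𝔤) := by
  have h : HasProjections fun k : ℕ => (⋀[ℝ]^k 𝔤).baseChange A :=
    .of_isInternal (DirectSum.Decomposition.isInternal _)
  obtain ⟨p, hp, hp'⟩ := h.exists_proj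
  refine ⟨?_, fun n => if n ≤ 0 then p n.natAbs else 0, ?_, ?_⟩
  · rw [eq_top_iff, ← h.iSup_eq_top]
    refine iSup_le fun k => ?_
    rw [← degZ_neg_natCast]
    exact le_iSup _ _
  · intro n x hx
    rcases lt_or_ge 0 n with hn | hn
    · rw [degZ_of_pos hn] at hx
      rw [(Submodule.mem_bot A).1 hx, map_zero]
    · rw [degZ, if_pos hn] at hx
      change (if n ≤ 0 then p n.natAbs else 0) x = x
      rw [if_pos hn]
      exact hp _ x hx
  · intro n m hnm x hx
    rcases lt_or_ge 0 m with hm | hm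
    · rw [degZ_of_pos hm] at hx
      rw [(Submodule.mem_bot A).1 hx, map_zero]
    · rw [degZ, if_pos hm] at hx
      change (if n ≤ 0 then p n.natAbs else 0) x = 0
      split_ifs with hn
      · exact hp' _ _ (by omega) x hx
      · rfl

/-! ### The grading operator -/

theorem signZ_mul (c c' : FunZ A 𝔤) : signZ A 𝔤 (c * c') = signZ A 𝔤 c * signZ A 𝔤 c' :=
  map_mul (Algebra.TensorProduct.map (AlgHom.id A A)
    (CliffordAlgebra.involute (Q := (0 : QuadraticForm ℝ 𝔤)))) c c'

theorem signZ_algebraMap (a : A) : signZ A 𝔤 (algebraMap A _ a) = algebraMap A _ a :=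
  (Algebra.TensorProduct.map (AlgHom.id A A)
    (CliffordAlgebra.involute (Q := (0 : QuadraticForm ℝ 𝔤)))).commutes a

theorem signZ_one : signZ A 𝔤 1 = 1 := by
  rw [← map_one (algebraMap A (FunZ A 𝔤)), signZ_algebraMap]

theorem signZ_lie (X : 𝔤) : signZ A 𝔤 (FunZ.lie A X) = -FunZ.lie A X := by
  rw [FunZ.lie_apply, ← TensorProduct.tmul_neg]
  exact congrArg (fun w => (1 : A) ⊗ₜ[ℝ] w) (CliffordAlgebra.involute_ι X)

theorem signZ_signZ (c : FunZ A 𝔤) : signZ A 𝔤 (signZ A 𝔤 c) = c := by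
  induction c using FunZ.induction with
  | scalar a => simp only [signZ_algebraMap]
  | lie X => simp only [signZ_lie, map_neg, neg_neg]
  | mul c c' hc hc' => rw [signZ_mul, signZ_mul, hc, hc']
  | add c c' hc hc' => rw [map_add, map_add, hc, hc']

theorem signZ_of_mem {n : ℤ} {c : FunZ A 𝔤} (hc : c ∈ degZ A 𝔤 n) :
    signZ A 𝔤 c = ((Int.negOnePow n : ℤˣ) : ℤ) • c := by
  have : degZ A 𝔤 n ≤ LinearMap.ker (signZ A 𝔤 - ((Int.negOnePow n : ℤˣ) : ℤ) • LinearMap.id) := by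
    refine degZ_le_of_forall ?_
    rintro k rfl w hw
    rw [LinearMap.mem_ker, LinearMap.sub_apply, sub_eq_zero, signZ, LinearMap.baseChange_tmul,
      Int.negOnePow_neg]
    change (1 : A) ⊗ₜ[ℝ] CliffordAlgebra.involute (Q := (0 : QuadraticForm ℝ 𝔤)) w = _
    rw [involute_of_mem_exteriorPower hw]
    rw [LinearMap.smul_apply, LinearMap.id_apply, Int.negOnePow_def, zpow_natCast, Units.val_pow_eq_pow_val,
      Units.val_neg, Units.val_one]
    rcases Nat.even_or_odd k with hk | hk
    · rw [hk.neg_one_pow, one_smul, one_smul]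
    · rw [hk.neg_one_pow, neg_one_smul, neg_one_smul, TensorProduct.tmul_neg]
  exact sub_eq_zero.1 (this hc)

theorem signZ_mem {n : ℤ} {c : FunZ A 𝔤} (hc : c ∈ degZ A 𝔤 n) : signZ A 𝔤 c ∈ degZ A 𝔤 n := by
  rw [signZ_of_mem hc]
  exact zsmul_mem hc _

/-! ### The contraction with the moment map -/

section Contraction

variable [FiniteDimensional ℝ 𝔤]

theorem contrMu_mul (μ : 𝔤 →ₗ[ℝ] A) (c c' : FunZ A 𝔤) :
    contrMu μ (c * c') = contrMu μ c * c' + signZ A 𝔤 c * contrMu μ c' := by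
  have key (d : Module.Dual ℝ 𝔤) (c c' : FunZ A 𝔤) :
      LinearMap.baseChange A (CliffordAlgebra.contractLeft (Q := (0 : QuadraticForm ℝ 𝔤)) d)
          (c * c') =
        (show FunZ A 𝔤 from LinearMap.baseChange A
          (CliffordAlgebra.contractLeft (Q := (0 : QuadraticForm ℝ 𝔤)) d) c) * c' +
        signZ A 𝔤 c * (show FunZ A 𝔤 from LinearMap.baseChange A
          (CliffordAlgebra.contractLeft (Q := (0 : QuadraticForm ℝ 𝔤)) d) c') := by
    induction c using TensorProduct.induction_on with
    | zero => simp
    | add x y hx hy => simp only [add_mul, map_add, hx, hy]; abel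
    | tmul a w =>
      induction c' using TensorProduct.induction_on with
      | zero => simp
      | add x y hx hy => simp only [mul_add, map_add, hx, hy]; abel
      | tmul a' w' =>
        rw [Algebra.TensorProduct.tmul_mul_tmul]
        change (a * a') ⊗ₜ[ℝ] (CliffordAlgebra.contractLeft (Q := (0 : QuadraticForm ℝ 𝔤)) d
          (w * w' : ExteriorAlgebra ℝ 𝔤)) = _
        rw [contractLeft_mul, TensorProduct.tmul_add]
        exact congrArg₂ (· + ·) (Algebra.TensorProduct.tmul_mul_tmul _ _ _ _).symm
          (Algebra.TensorProduct.tmul_mul_tmul _ _ _ _).symm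
  simp only [contrMu, LinearMap.sum_apply, LinearMap.smul_apply, key, smul_add,
    Finset.sum_add_distrib, Finset.sum_mul, Finset.mul_sum, smul_mul_assoc, mul_smul_comm]

theorem contrMu_algebraMap (μ : 𝔤 →ₗ[ℝ] A) (a : A) :
    contrMu μ (algebraMap A (FunZ A 𝔤) a) = 0 := by
  rw [contrMu, LinearMap.sum_apply]
  refine Finset.sum_eq_zero fun i _ => ?_
  rw [LinearMap.smul_apply, Algebra.TensorProduct.algebraMap_apply, LinearMap.baseChange_tmul]
  change _ • (_ ⊗ₜ[ℝ] CliffordAlgebra.contractLeft (Q := (0 : QuadraticForm ℝ 𝔤)) _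
    (1 : CliffordAlgebra (0 : QuadraticForm ℝ 𝔤))) = _
  rw [CliffordAlgebra.contractLeft_one, TensorProduct.tmul_zero, smul_zero]

theorem contrMu_one (μ : 𝔤 →ₗ[ℝ] A) : contrMu μ (1 : FunZ A 𝔤) = 0 := by
  rw [← map_one (algebraMap A (FunZ A 𝔤)), contrMu_algebraMap]

/-- Expanding `X` in the chosen basis turns `∑ i, ⟨μ, E_i⟩ σ_i(X)` into `⟨μ, X⟩`. From here on the
contraction is used through this basis-free value. -/
theorem contrMu_lie (μ : 𝔤 →ₗ[ℝ] A) (X : 𝔤) :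
    contrMu μ (FunZ.lie A X) = algebraMap A (FunZ A 𝔤) (μ X) := by
  conv_rhs => rw [← (Module.finBasis ℝ 𝔤).sum_repr X]
  simp only [contrMu, LinearMap.sum_apply, map_sum, map_smul]
  refine Finset.sum_congr rfl fun i _ => ?_
  have h : LinearMap.baseChange A (CliffordAlgebra.contractLeft (Q := (0 : QuadraticForm ℝ 𝔤))
      ((Module.finBasis ℝ 𝔤).coord i)) (FunZ.lie A X) =
      1 ⊗ₜ algebraMap ℝ (ExteriorAlgebra ℝ 𝔤) ((Module.finBasis ℝ 𝔤).coord i X) :=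
    congrArg (fun w => (1 : A) ⊗ₜ[ℝ] w) (CliffordAlgebra.contractLeft_ι _ _ X)
  rw [LinearMap.smul_apply, h, Algebra.algebraMap_eq_smul_one, TensorProduct.tmul_smul,
    Algebra.algebraMap_eq_smul_one, smul_assoc, smul_comm]
  rfl

/-- An operator of odd degree anticommutes with parity. This is what cancels the cross terms when a
twisted derivation is squared. -/
theorem contrMu_signZ (μ : 𝔤 →ₗ[ℝ] A) (c : FunZ A 𝔤) :
    contrMu μ (signZ A 𝔤 c) = -signZ A 𝔤 (contrMu μ c) := by
  induction c using FunZ.induction with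
  | scalar a => simp only [signZ_algebraMap, contrMu_algebraMap, map_zero, neg_zero]
  | lie X => simp only [signZ_lie, contrMu_lie, signZ_algebraMap, map_neg]
  | mul c c' hc hc' =>
    simp only [signZ_mul, contrMu_mul, hc, hc', map_add, signZ_signZ, neg_mul, mul_neg, neg_add]
  | add c c' hc hc' => simp only [map_add, hc, hc', neg_add]

/-- The square vanishes on generators, since `𝔤` is sent to functions and functions to zero. On a
product, the two mixed terms cancel by anticommutation with parity. -/
theorem contrMu_contrMu (μ : 𝔤 →ₗ[ℝ] A) (c : FunZ A 𝔤) : contrMu μ (contrMu μ c) = 0 := by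
  induction c using FunZ.induction with
  | scalar a => simp only [contrMu_algebraMap, map_zero]
  | lie X => simp only [contrMu_lie, contrMu_algebraMap]
  | mul c c' hc hc' =>
    simp only [contrMu_mul, map_add, hc, hc', contrMu_signZ, signZ_signZ, neg_mul, zero_mul,
      mul_zero, zero_add, add_zero, add_neg_cancel]
  | add c c' hc hc' => simp only [map_add, hc, hc', add_zero]

theorem contrMu_mem (μ : 𝔤 →ₗ[ℝ] A) {n : ℤ} {c : FunZ A 𝔤} (hc : c ∈ degZ A 𝔤 n) :
    contrMu μ c ∈ degZ A 𝔤 (n + 1) := by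
  refine degZ_le_of_forall (S := (degZ A 𝔤 (n + 1)).comap (contrMu μ)) ?_ hc
  rintro k rfl w hw
  rw [Submodule.mem_comap, contrMu, LinearMap.sum_apply]
  refine Submodule.sum_mem _ fun i _ => ?_
  rw [LinearMap.smul_apply, LinearMap.baseChange_tmul]
  refine Submodule.smul_mem _ _ ?_
  rcases contractLeft_mem_exteriorPower ((Module.finBasis ℝ 𝔤).coord i) hw with
    ⟨-, h⟩ | ⟨l, rfl, h⟩
  · exact Set.mem_of_eq_of_mem ((congrArg (fun w => (1 : A) ⊗ₜ[ℝ] w) h).trans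
      (TensorProduct.tmul_zero _ _)) (zero_mem _)
  · have := one_tmul_mem_degZ (A := A) h
    rwa [show (-(l : ℤ)) = -((l + 1 : ℕ) : ℤ) + 1 by push_cast; ring] at this

end Contraction

/-! ### The induced action -/

theorem actZ_algebraMap (f : A →ₐ[ℝ] A) (a : 𝔤 →ₗ[ℝ] 𝔤) (r : A) :
    actZ f a (algebraMap A _ r) = algebraMap A _ (f r) := by
  simp only [actZ, Algebra.TensorProduct.algebraMap_apply, Algebra.TensorProduct.map_tmul, map_one]
  rfl

theorem actZ_lie (f : A →ₐ[ℝ] A) (a : 𝔤 →ₗ[ℝ] 𝔤) (X : 𝔤) :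
    actZ f a (FunZ.lie A X) = FunZ.lie A (a X) := by
  simp only [actZ, FunZ.lie_apply, Algebra.TensorProduct.map_tmul, map_one,
    ExteriorAlgebra.map_apply_ι]

theorem actZ_mem (f : A →ₐ[ℝ] A) (a : 𝔤 →ₗ[ℝ] 𝔤) {n : ℤ} {c : FunZ A 𝔤} (hc : c ∈ degZ A 𝔤 n) :
    actZ f a c ∈ degZ A 𝔤 n := by
  -- The preimage of a submodule under a semilinear map is again an `A`-submodule, so it suffices to
  -- treat the elements `1 ⊗ w`.
  let φ : FunZ A 𝔤 →ₛₗ[f.toRingHom] FunZ A 𝔤 := actZSemilinear f a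
  refine degZ_le_of_forall (S := (degZ A 𝔤 n).comap φ) ?_ hc
  rintro k rfl w hw
  change actZ f a (1 ⊗ₜ w) ∈ degZ A 𝔤 (-(k : ℤ))
  rw [actZ, Algebra.TensorProduct.map_tmul, map_one]
  exact one_tmul_mem_degZ (exteriorAlgebra_map_mem a hw)

theorem actZ_signZ (f : A →ₐ[ℝ] A) (a : 𝔤 →ₗ[ℝ] 𝔤) (c : FunZ A 𝔤) :
    actZ f a (signZ A 𝔤 c) = signZ A 𝔤 (actZ f a c) := by
  induction c using FunZ.induction with
  | scalar r => simp only [signZ_algebraMap, actZ_algebraMap]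
  | lie X => simp only [signZ_lie, actZ_lie, map_neg]
  | mul c c' hc hc' => simp only [signZ_mul, map_mul, hc, hc']
  | add c c' hc hc' => simp only [map_add, hc, hc']

/-- Both sides obey the same twisted product rule, so the only condition is on `𝔤`, where it is the
equivariance of the moment map. In particular no change of basis has to be computed. -/
theorem actZ_contrMu [FiniteDimensional ℝ 𝔤] {f : A →ₐ[ℝ] A} {a : 𝔤 →ₗ[ℝ] 𝔤} {μ : 𝔤 →ₗ[ℝ] A}
    (h : ∀ X, f (μ X) = μ (a X)) (c : FunZ A 𝔤) :
    actZ f a (contrMu μ c) = contrMu μ (actZ f a c) := by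
  induction c using FunZ.induction with
  | scalar r => simp only [contrMu_algebraMap, actZ_algebraMap, map_zero]
  | lie X => simp only [contrMu_lie, actZ_lie, actZ_algebraMap, h]
  | mul c c' hc hc' => simp only [contrMu_mul, map_mul, map_add, hc, hc', actZ_signZ]
  | add c c' hc hc' => simp only [map_add, hc, hc']

end FunctionsOnZeroLevel

/-! ### Checking properties and degrees on generators. -/

section Generators

variable {R A C : Type*} {P : Type*} [CommRing R] [CommRing A] [Algebra R A]
  [Ring C] [Algebra R C] [Algebra A C] [IsScalarTower R A C] [AddCommGroup P] [Module R P]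

theorem tensor_generator_induction {p : C ⊗[R] P → Prop} (gen : ∀ q : P, p (1 ⊗ₜ q))
    (smul : ∀ (c : C) z, p z → p (c • z)) (add : ∀ z z', p z → p z' → p (z + z'))
    (z : C ⊗[R] P) : p z := by
  induction z using TensorProduct.induction_on with
  | zero => simpa using gen 0
  | add x y hx hy => exact add x y hx hy
  | tmul c q => simpa [TensorProduct.smul_tmul'] using smul c _ (gen q)

variable {degC : ℤ → Submodule A C}

theorem onCoeff_mem_genDeg_of_preserves {f : C →ₗ[A] C} (hf : ∀ {i c}, c ∈ degC i → f c ∈ degC i)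
    {d n : ℤ} {z : C ⊗[R] P} (hz : z ∈ genDeg P degC d n) :
    onCoeff P f z ∈ genDeg P degC d n := by
  have := onCoeff_mem_genDeg (f := f) (k := 0) (fun hc => by simpa using hf hc) hz
  rwa [add_zero] at this

theorem one_tmul_mem_genDeg (h : 1 ∈ degC 0) (d : ℤ) (p : P) :
    (1 : C) ⊗ₜ[R] p ∈ genDeg P degC d d :=
  tmul_mem_genDeg (by rwa [sub_self]) p

/-- A `C`-linear map given on generators of degree `d` by elements of degree `k` has degree
`k - d`. -/
theorem linearMap_mem {N : Type*} [AddCommGroup N] [Module A N] [Module C N]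
    {degN : ℤ → Submodule A N}
    (hmul : ∀ {i j : ℤ} {c : C} {x : N}, c ∈ degC i → x ∈ degN j → c • x ∈ degN (i + j))
    (L : C ⊗[R] P →ₗ[C] N) {d n k m : ℤ} (h : ∀ p : P, L (1 ⊗ₜ p) ∈ degN k)
    {z : C ⊗[R] P} (hz : z ∈ genDeg P degC d n) (hk : n - d + k = m) : L z ∈ degN m := by
  subst hk
  refine map_mem_of_mem_genDeg (S := (degN (n - d + k)).toAddSubgroup)
    L.toAddMonoidHom (fun c hc p => ?_) hz
  have := hmul hc (h p)
  rwa [← map_smul, TensorProduct.smul_tmul', smul_eq_mul, mul_one] at this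

end Generators

/-! ### The total complexes: values of the differentials on generators and the Leibniz rule. -/

section TotalComplexes

variable {A 𝔤 T Ω : Type*} [CommRing A] [Algebra ℝ A] [AddCommGroup 𝔤] [Module ℝ 𝔤]
  [FiniteDimensional ℝ 𝔤] [AddCommGroup T] [Module ℝ T] [Module A T] [IsScalarTower ℝ A T]
  [AddCommGroup Ω] [Module ℝ Ω] [Module A Ω] [IsScalarTower ℝ A Ω]

/-! ### Elements of `C^∞(Z) ⊗ 𝔤^*` -/

/-- The element `∑ j, φ(E_j) ⊗ σ_j` of `C^∞(Z) ⊗ 𝔤^*` given by a linear map `φ : 𝔤 → C^∞(Z)`. -/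
def dualTensor (φ : 𝔤 →ₗ[ℝ] FunZ A 𝔤) : LieDualZ A 𝔤 :=
  ∑ j, φ (Module.finBasis ℝ 𝔤 j) ⊗ₜ (Module.finBasis ℝ 𝔤).coord j

theorem dualTensor_add (φ ψ : 𝔤 →ₗ[ℝ] FunZ A 𝔤) :
    dualTensor (φ + ψ) = dualTensor φ + dualTensor ψ := by
  simp only [dualTensor, LinearMap.add_apply, TensorProduct.add_tmul, Finset.sum_add_distrib]

theorem dualTensor_zero : dualTensor (0 : 𝔤 →ₗ[ℝ] FunZ A 𝔤) = 0 := by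
  simp only [dualTensor, LinearMap.zero_apply, TensorProduct.zero_tmul, Finset.sum_const_zero]

theorem dualTensor_neg (φ : 𝔤 →ₗ[ℝ] FunZ A 𝔤) : dualTensor (-φ) = -dualTensor φ := by
  simp only [dualTensor, LinearMap.neg_apply, TensorProduct.neg_tmul, Finset.sum_neg_distrib]

theorem onCoeff_dualTensor (f : FunZ A 𝔤 →ₗ[A] FunZ A 𝔤) (φ : 𝔤 →ₗ[ℝ] FunZ A 𝔤) :
    onCoeff (Module.Dual ℝ 𝔤) f (dualTensor φ) = dualTensor (f.restrictScalars ℝ ∘ₗ φ) := by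
  simp only [dualTensor, map_sum, onCoeff_tmul]
  rfl

/-- Expanding `σ_j ∘ b` in the dual basis and exchanging the two sums moves `b` from the argument of
`φ` to the dual factor. This expresses that the canonical element `∑ E_j ⊗ σ_j` does not depend on
the basis. -/
theorem dualTensor_comp (φ : 𝔤 →ₗ[ℝ] FunZ A 𝔤) (b : 𝔤 →ₗ[ℝ] 𝔤) :
    dualTensor (φ ∘ₗ b) =
      ∑ j, φ (Module.finBasis ℝ 𝔤 j) ⊗ₜ ((Module.finBasis ℝ 𝔤).coord j ∘ₗ b) := by
  have h (j) : (Module.finBasis ℝ 𝔤).coord j ∘ₗ b = ∑ k, (Module.finBasis ℝ 𝔤).coord j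
      (b (Module.finBasis ℝ 𝔤 k)) • (Module.finBasis ℝ 𝔤).coord k := by
    refine (Module.finBasis ℝ 𝔤).ext fun l => ?_
    simp [Finsupp.single_apply]
  simp only [h, TensorProduct.tmul_sum]
  rw [Finset.sum_comm]
  refine Finset.sum_congr rfl fun k _ => ?_
  conv_lhs => rw [LinearMap.comp_apply, ← (Module.finBasis ℝ 𝔤).sum_repr (b _), map_sum,
    TensorProduct.sum_tmul]
  refine Finset.sum_congr rfl fun j _ => ?_
  rw [map_smul, TensorProduct.smul_tmul]
  rfl

theorem dualTensor_mem {φ : 𝔤 →ₗ[ℝ] FunZ A 𝔤} {n : ℤ} (h : ∀ X, φ X ∈ degZ A 𝔤 (n - 1)) :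
    dualTensor φ ∈ genDeg (Module.Dual ℝ 𝔤) (degZ A 𝔤) 1 n :=
  Submodule.sum_mem _ fun _ _ => tmul_mem_genDeg (h _) _

/-! ### Values on generators -/

variable {μ : 𝔤 →ₗ[ℝ] A} {pair : Ω →ₗ[A] T →ₗ[A] A} {Dμ : 𝔤 →ₗ[ℝ] Ω}
  {br : 𝔤 →ₗ[ℝ] 𝔤 →ₗ[ℝ] 𝔤} {sharp : 𝔤 →ₗ[ℝ] T}

theorem dMu_generator (W : T) : dMu (𝔤 := 𝔤) pair Dμ (1 ⊗ₜ W) =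
    dualTensor ((Algebra.linearMap A (FunZ A 𝔤) ∘ₗ pair.flip W).restrictScalars ℝ ∘ₗ Dμ) := by
  simp only [dMu, extendScalars_tmul, one_smul, LinearMap.sum_apply, dualTensor]
  rfl

theorem eta_apply (X : 𝔤) : eta A br X = dualTensor (-(FunZ.lie A ∘ₗ br X)) := by
  simp only [eta, LinearMap.sum_apply, dualTensor]
  refine Finset.sum_congr rfl fun j _ => ?_
  change ((1 : A) ⊗ₜ[ℝ] ExteriorAlgebra.ι ℝ (-(br X (Module.finBasis ℝ 𝔤 j)))) ⊗ₜ[ℝ] _ =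
    (-((1 : A) ⊗ₜ[ℝ] ExteriorAlgebra.ι ℝ (br X (Module.finBasis ℝ 𝔤 j)))) ⊗ₜ[ℝ] _
  rw [map_neg, TensorProduct.tmul_neg]

theorem anchor_generator (X : 𝔤) : anchor A br sharp (1 ⊗ₜ X) =
    (1 ⊗ₜ sharp X, dualTensor (-(FunZ.lie A ∘ₗ br X))) := by
  rw [← eta_apply]
  have h₁ : extendScalars ((TensorProduct.mk A (FunZ A 𝔤) T 1).restrictScalars ℝ ∘ₗ sharp)
      ((1 : FunZ A 𝔤) ⊗ₜ[ℝ] X) = 1 ⊗ₜ sharp X :=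
    (extendScalars_tmul _ _ _).trans (one_smul (FunZ A 𝔤) ((1 : FunZ A 𝔤) ⊗ₜ[A] sharp X))
  have h₂ : extendScalars (eta A br) ((1 : FunZ A 𝔤) ⊗ₜ[ℝ] X) = eta A br X :=
    (extendScalars_tmul _ _ _).trans (one_smul (FunZ A 𝔤) (eta A br X))
  exact Prod.ext h₁ h₂

/-- Pairing with `dY` evaluates the corresponding linear map at `Y`; this recovers `φ` from its
tensor and computes the dual of the anchor. -/
theorem pairLie_dualTensor (w : PullZ A 𝔤 T) (φ : 𝔤 →ₗ[ℝ] FunZ A 𝔤) (Y : 𝔤) :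
    pairLie A 𝔤 T (w, dualTensor φ) Y = φ Y := by
  simp only [pairLie, dualTensor, LinearMap.comp_apply, LinearMap.snd_apply, map_sum,
    extendScalars_tmul, LinearMap.sum_apply, LinearMap.smul_apply]
  conv_rhs => rw [← (Module.finBasis ℝ 𝔤).sum_repr Y, map_sum]
  refine Finset.sum_congr rfl fun j _ => ?_
  rw [map_smul]
  change _ * algebraMap ℝ (FunZ A 𝔤) ((Module.finBasis ℝ 𝔤).coord j Y) = _
  rw [← Algebra.commutes, ← Algebra.smul_def]
  rfl

theorem pairForm_generator (W : T) (s : LieDualZ A 𝔤) (β : Ω) :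
    pairForm 𝔤 pair (1 ⊗ₜ W, s) β = algebraMap A _ (pair β W) := by
  simp only [pairForm, LinearMap.comp_apply, LinearMap.fst_apply, extendScalars_tmul, one_smul]
  rfl

theorem anchorStar_lie (X : 𝔤) : anchorStar (A := A) pair br sharp (1 ⊗ₜ X, 0) =
    dualTensor (-(FunZ.lie A ∘ₗ br.flip X)) := by
  simp only [anchorStar, LinearMap.coprod_apply, map_zero, add_zero, extendScalars_tmul, one_smul,
    LinearMap.sum_apply, dualTensor, anchor_generator]
  refine Finset.sum_congr rfl fun j _ => ?_
  rw [LinearMap.comp_apply, tmulRight_apply]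
  congr 1
  exact pairLie_dualTensor _ (-(FunZ.lie A ∘ₗ br _)) X

theorem anchorStar_form (β : Ω) : anchorStar (𝔤 := 𝔤) pair br sharp (0, 1 ⊗ₜ β) =
    dualTensor ((Algebra.linearMap A (FunZ A 𝔤) ∘ₗ pair β).restrictScalars ℝ ∘ₗ sharp) := by
  simp only [anchorStar, LinearMap.coprod_apply, map_zero, zero_add, extendScalars_tmul, one_smul,
    LinearMap.sum_apply, dualTensor, anchor_generator]
  refine Finset.sum_congr rfl fun j _ => ?_
  rw [LinearMap.comp_apply, tmulRight_apply, pairForm_generator]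
  rfl

/-! ### The Leibniz rule and generators -/

theorem TotT.induction {p : TotT A 𝔤 T → Prop} (lie : ∀ X : 𝔤, p (1 ⊗ₜ X, 0, 0))
    (vec : ∀ W : T, p (0, 1 ⊗ₜ W, 0)) (contr : ∀ σ : Module.Dual ℝ 𝔤, p (0, 0, 1 ⊗ₜ σ))
    (smul : ∀ (c : FunZ A 𝔤) x, p x → p (c • x)) (add : ∀ x y, p x → p y → p (x + y))
    (x : TotT A 𝔤 T) : p x := by
  obtain ⟨u, w, s⟩ := x
  have hu : p (u, 0, 0) := tensor_generator_induction (p := fun u => p (u, 0, 0)) lie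
    (fun c z hz => by simpa using smul c _ hz) (fun z z' hz hz' => by simpa using add _ _ hz hz') u
  have hw : p (0, w, 0) := tensor_generator_induction (p := fun w => p (0, w, 0)) vec
    (fun c z hz => by simpa using smul c _ hz) (fun z z' hz hz' => by simpa using add _ _ hz hz') w
  have hs : p (0, 0, s) := tensor_generator_induction (p := fun s => p (0, 0, s)) contr
    (fun c z hz => by simpa using smul c _ hz) (fun z z' hz hz' => by simpa using add _ _ hz hz') s
  simpa using add _ _ hu (add _ _ hw hs)

theorem TotCT.induction {p : TotCT A 𝔤 Ω → Prop} (lie : ∀ X : 𝔤, p ((1 ⊗ₜ X, 0), 0))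
    (form : ∀ β : Ω, p ((0, 1 ⊗ₜ β), 0)) (dual : ∀ σ : Module.Dual ℝ 𝔤, p ((0, 0), 1 ⊗ₜ σ))
    (smul : ∀ (c : FunZ A 𝔤) x, p x → p (c • x)) (add : ∀ x y, p x → p y → p (x + y))
    (x : TotCT A 𝔤 Ω) : p x := by
  obtain ⟨⟨u, w⟩, s⟩ := x
  have hu : p ((u, 0), 0) := tensor_generator_induction (p := fun u => p ((u, 0), 0)) lie
    (fun c z hz => by simpa using smul c _ hz) (fun z z' hz hz' => by simpa using add _ _ hz hz') u
  have hw : p ((0, w), 0) := tensor_generator_induction (p := fun w => p ((0, w), 0)) form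
    (fun c z hz => by simpa using smul c _ hz) (fun z z' hz hz' => by simpa using add _ _ hz hz') w
  have hs : p ((0, 0), s) := tensor_generator_induction (p := fun s => p ((0, 0), s)) dual
    (fun c z hz => by simpa using smul c _ hz) (fun z z' hz hz' => by simpa using add _ _ hz hz') s
  simpa using add _ _ hu (add _ _ hw hs)

/-- An additive operator on a `C^∞(Z)`-module satisfying the Leibniz rule. -/
def SatisfiesLeibniz {N : Type*} [AddCommGroup N] [Module A N] [Module (FunZ A 𝔤) N]
    (μ : 𝔤 →ₗ[ℝ] A) (d : N →ₗ[A] N) : Prop :=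
  ∀ (c : FunZ A 𝔤) (x : N), d (c • x) = contrMu μ c • x + signZ A 𝔤 c • d x

/-- The terms containing one differential of `x` have coefficients `signZ (ι_μ c)` and `ι_μ (signZ
c)`, which are opposite. Hence the vanishing of the square passes from generators to all multiples.
-/
theorem SatisfiesLeibniz.d_d_smul {N : Type*} [AddCommGroup N] [Module A N] [Module (FunZ A 𝔤) N]
    {d : N →ₗ[A] N} (h : SatisfiesLeibniz μ d) (c : FunZ A 𝔤) {x : N} (hx : d (d x) = 0) :
    d (d (c • x)) = 0 := by
  rw [h c x, map_add, h, h, hx, contrMu_contrMu, contrMu_signZ, zero_smul, smul_zero, neg_smul]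
  abel

theorem dTotT_apply (x : TotT A 𝔤 T) : dTotT μ pair Dμ br sharp x =
    (onCoeff 𝔤 (contrMu μ) x.1,
      onCoeff T (contrMu μ) x.2.1 + (anchor A br sharp (onCoeff 𝔤 (signZ A 𝔤) x.1)).1,
      onCoeff (Module.Dual ℝ 𝔤) (contrMu μ) x.2.2 -
        onCoeff (Module.Dual ℝ 𝔤) (signZ A 𝔤) (dMu pair Dμ x.2.1) +
        (anchor A br sharp (onCoeff 𝔤 (signZ A 𝔤) x.1)).2) := rfl

theorem dTotCT_apply (x : TotCT A 𝔤 Ω) : dTotCT μ pair Dμ br sharp x =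
    ((onCoeff 𝔤 (contrMu μ) x.1.1,
      onCoeff Ω (contrMu μ) x.1.2 + dMuStar A Dμ (onCoeff 𝔤 (signZ A 𝔤) x.1.1)),
      onCoeff (Module.Dual ℝ 𝔤) (contrMu μ) x.2 +
        onCoeff (Module.Dual ℝ 𝔤) (signZ A 𝔤) (anchorStar pair br sharp x.1)) := rfl

/-- The contraction on coefficients supplies the derivation term. Every other part is a
`C^∞(Z)`-linear map composed with parity, and so picks up the required sign when a coefficient is
pulled out. -/
theorem satisfiesLeibniz_dTotT : SatisfiesLeibniz μ (dTotT μ pair Dμ br sharp) := by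
  rintro c ⟨u, w, s⟩
  simp only [dTotT_apply, Prod.smul_fst, Prod.smul_snd, Prod.smul_mk, Prod.mk_add_mk,
    onCoeff_smul_of_derivation (contrMu_mul μ), onCoeff_smul_of_multiplicative (s := signZ A 𝔤) signZ_mul, map_smul,
    smul_add, smul_sub]
  refine Prod.ext rfl (Prod.ext ?_ ?_)
  · simp only; abel
  · simp only; abel

theorem satisfiesLeibniz_dTotCT : SatisfiesLeibniz μ (dTotCT μ pair Dμ br sharp) := by
  rintro c ⟨y, s⟩
  simp only [dTotCT_apply, Prod.smul_fst, Prod.smul_snd, Prod.smul_mk, Prod.mk_add_mk,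
    onCoeff_smul_of_derivation (contrMu_mul μ), onCoeff_smul_of_multiplicative (s := signZ A 𝔤) signZ_mul, map_smul,
    smul_add]
  refine Prod.ext (Prod.ext rfl ?_) ?_
  · simp only [Prod.snd_add, Prod.smul_snd]; abel
  · simp only; abel

theorem dTotT_lie (X : 𝔤) : dTotT μ pair Dμ br sharp (1 ⊗ₜ X, 0, 0) =
    (0, 1 ⊗ₜ sharp X, dualTensor (-(FunZ.lie A ∘ₗ br X))) := by
  simp [dTotT_apply, contrMu_one, signZ_one, anchor_generator]

/-- The coefficients `W⟨μ, E_j⟩` are functions of degree `0`, so the parity operator leaves them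
unchanged; the minus sign is the one built into the differential. -/
theorem dTotT_vec (W : T) : dTotT μ pair Dμ br sharp (0, 1 ⊗ₜ W, 0) =
    (0, 0, -dualTensor
      ((Algebra.linearMap A (FunZ A 𝔤) ∘ₗ pair.flip W).restrictScalars ℝ ∘ₗ Dμ)) := by
  have h : (signZ A 𝔤).restrictScalars ℝ ∘ₗ (Algebra.linearMap A (FunZ A 𝔤) ∘ₗ
      pair.flip W).restrictScalars ℝ ∘ₗ Dμ =
      (Algebra.linearMap A (FunZ A 𝔤) ∘ₗ pair.flip W).restrictScalars ℝ ∘ₗ Dμ :=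
    LinearMap.ext fun _ => signZ_algebraMap _
  simp only [dTotT_apply, onCoeff_tmul, contrMu_one, map_zero, TensorProduct.zero_tmul,
    dMu_generator, onCoeff_dualTensor, h, Prod.fst_zero, Prod.snd_zero, add_zero, zero_sub]

theorem dTotT_contr (σ : Module.Dual ℝ 𝔤) :
    dTotT μ pair Dμ br sharp (0, 0, 1 ⊗ₜ σ) = 0 := by
  simp [dTotT_apply, contrMu_one]

/-- Isolates the `𝔤^*` component of a value of the differential, so that a second application
reduces to the contraction composed with `φ`. -/
theorem dTotT_dualTensor (w : PullZ A 𝔤 T) (φ : 𝔤 →ₗ[ℝ] FunZ A 𝔤) :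
    dTotT μ pair Dμ br sharp (0, w, dualTensor φ) = dTotT μ pair Dμ br sharp (0, w, 0) +
      (0, 0, dualTensor ((contrMu μ).restrictScalars ℝ ∘ₗ φ)) := by
  simp only [dTotT_apply, onCoeff_dualTensor, map_zero, Prod.fst_zero, Prod.snd_zero, add_zero,
    Prod.mk_add_mk, sub_eq_neg_add]

/-- The dual anchor contributes `-[E_j, X]`, of coefficient degree `-1`, and parity reverses it to
`[E_j, X]`. This is the Koszul sign of the shift. -/
theorem dTotCT_lie (X : 𝔤) : dTotCT μ pair Dμ br sharp ((1 ⊗ₜ X, 0), 0) =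
    ((0, 1 ⊗ₜ Dμ X), dualTensor (FunZ.lie A ∘ₗ br.flip X)) := by
  have h : (signZ A 𝔤).restrictScalars ℝ ∘ₗ (-(FunZ.lie A ∘ₗ br.flip X)) =
      FunZ.lie A ∘ₗ br.flip X :=
    LinearMap.ext fun _ => by simp [signZ_lie]
  simp only [dTotCT_apply, onCoeff_tmul, contrMu_one, map_zero, TensorProduct.zero_tmul,
    anchorStar_lie, onCoeff_dualTensor, h, signZ_one, zero_add, dMuStar, extendScalars_tmul,
    one_smul]
  rfl

theorem dTotCT_form (β : Ω) : dTotCT μ pair Dμ br sharp ((0, 1 ⊗ₜ β), 0) =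
    (0, dualTensor ((Algebra.linearMap A (FunZ A 𝔤) ∘ₗ pair β).restrictScalars ℝ ∘ₗ sharp)) := by
  have h : (signZ A 𝔤).restrictScalars ℝ ∘ₗ (Algebra.linearMap A (FunZ A 𝔤) ∘ₗ
      pair β).restrictScalars ℝ ∘ₗ sharp =
      (Algebra.linearMap A (FunZ A 𝔤) ∘ₗ pair β).restrictScalars ℝ ∘ₗ sharp :=
    LinearMap.ext fun _ => signZ_algebraMap _
  simp only [dTotCT_apply, onCoeff_tmul, contrMu_one, map_zero, TensorProduct.zero_tmul,
    anchorStar_form, onCoeff_dualTensor, h, zero_add]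
  rfl

theorem dTotCT_dual (σ : Module.Dual ℝ 𝔤) :
    dTotCT μ pair Dμ br sharp ((0, 0), 1 ⊗ₜ σ) = 0 := by
  have h : ((0, 0) : CTZ A 𝔤 Ω) = 0 := rfl
  simp only [dTotCT_apply, onCoeff_tmul, contrMu_one, map_zero, TensorProduct.zero_tmul, h]
  simp

theorem dTotCT_dualTensor (y : CTZ A 𝔤 Ω) (φ : 𝔤 →ₗ[ℝ] FunZ A 𝔤) :
    dTotCT μ pair Dμ br sharp (y, dualTensor φ) = dTotCT μ pair Dμ br sharp (y, 0) +
      (0, dualTensor ((contrMu μ).restrictScalars ℝ ∘ₗ φ)) := by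
  simp only [dTotCT_apply, onCoeff_dualTensor, map_zero, zero_add, Prod.mk_add_mk, add_comm]

end TotalComplexes

/-! ### The dg-module axioms and the isomorphism induced by the reduced form. -/

section DGModules

variable {A 𝔤 T Ω : Type*} [CommRing A] [Algebra ℝ A] [AddCommGroup 𝔤] [Module ℝ 𝔤]
  [FiniteDimensional ℝ 𝔤] [AddCommGroup T] [Module ℝ T] [Module A T] [IsScalarTower ℝ A T]
  [AddCommGroup Ω] [Module ℝ Ω] [Module A Ω] [IsScalarTower ℝ A Ω]

theorem smul_mem_degTotT {i j : ℤ} {c : FunZ A 𝔤} {x : TotT A 𝔤 T} (hc : c ∈ degZ A 𝔤 i)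
    (hx : x ∈ degTotT A 𝔤 T j) : c • x ∈ degTotT A 𝔤 T (i + j) :=
  ⟨smul_mem_genDeg mul_mem_degZ hc hx.1, smul_mem_genDeg mul_mem_degZ hc hx.2.1, smul_mem_genDeg mul_mem_degZ hc hx.2.2⟩

theorem smul_mem_degTotCT {i j : ℤ} {c : FunZ A 𝔤} {x : TotCT A 𝔤 Ω} (hc : c ∈ degZ A 𝔤 i)
    (hx : x ∈ degTotCT A 𝔤 Ω j) : c • x ∈ degTotCT A 𝔤 Ω (i + j) :=
  ⟨⟨smul_mem_genDeg mul_mem_degZ hc hx.1.1, smul_mem_genDeg mul_mem_degZ hc hx.1.2⟩,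
    smul_mem_genDeg mul_mem_degZ hc hx.2⟩

theorem isInternal_degTotT : DirectSum.IsInternal (degTotT A 𝔤 T) :=
  ((hasProjections_degZ.genDeg (-1)).prod
    ((hasProjections_degZ.genDeg 0).prod (hasProjections_degZ.genDeg 1))).isInternal

theorem isInternal_degTotCT : DirectSum.IsInternal (degTotCT A 𝔤 Ω) :=
  (((hasProjections_degZ.genDeg (-1)).prod (hasProjections_degZ.genDeg 0)).prod
    (hasProjections_degZ.genDeg 1)).isInternal

variable {μ : 𝔤 →ₗ[ℝ] A} {pair : Ω →ₗ[A] T →ₗ[A] A} {Dμ : 𝔤 →ₗ[ℝ] Ω}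
  {br : 𝔤 →ₗ[ℝ] 𝔤 →ₗ[ℝ] 𝔤} {sharp : 𝔤 →ₗ[ℝ] T} {flat : T →ₗ[A] Ω}

theorem dMu_mem {n : ℤ} {w : PullZ A 𝔤 T} (hw : w ∈ genDeg T (degZ A 𝔤) 0 n) :
    dMu pair Dμ w ∈ genDeg (Module.Dual ℝ 𝔤) (degZ A 𝔤) 1 (n + 1) := by
  refine linearMap_mem (degN := genDeg (Module.Dual ℝ 𝔤) (degZ A 𝔤) 1) (smul_mem_genDeg mul_mem_degZ)
    (dMu pair Dμ) (k := 1)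
      (fun W => ?_) hw (by ring)
  rw [dMu_generator]
  exact dualTensor_mem fun X => algebraMap_mem_degZ _

theorem dMuStar_mem {n : ℤ} {u : LieZ A 𝔤} (hu : u ∈ genDeg 𝔤 (degZ A 𝔤) (-1) n) :
    dMuStar A Dμ u ∈ genDeg Ω (degZ A 𝔤) 0 (n + 1) := by
  refine linearMap_mem (degN := genDeg Ω (degZ A 𝔤) 0) (smul_mem_genDeg mul_mem_degZ)
    (dMuStar A Dμ) (k := 0)
      (fun X => ?_) hu (by ring)
  rw [dMuStar, extendScalars_tmul, one_smul]
  exact one_tmul_mem_genDeg one_mem_degZ 0 _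

/-- The generator `X` sits in degree `-1`, while `X♯` and `[X, E_j] ⊗ σ_j` both have total degree
`0`. The anchor therefore raises degree by one on the shifted module. -/
theorem anchor_mem {n : ℤ} {u : LieZ A 𝔤} (hu : u ∈ genDeg 𝔤 (degZ A 𝔤) (-1) n) :
    anchor A br sharp u ∈ (genDeg T (degZ A 𝔤) 0 (n + 1)).prod
      (genDeg (Module.Dual ℝ 𝔤) (degZ A 𝔤) 1 (n + 1)) := by
  refine linearMap_mem (degN := fun n => (genDeg T (degZ A 𝔤) 0 n).prod
      (genDeg (Module.Dual ℝ 𝔤) (degZ A 𝔤) 1 n))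
    (fun hc hx => ⟨smul_mem_genDeg mul_mem_degZ hc hx.1, smul_mem_genDeg mul_mem_degZ hc hx.2⟩)
    (anchor A br sharp) (k := 0)
      (fun X => ?_) hu (by ring)
  rw [anchor_generator]
  exact ⟨one_tmul_mem_genDeg one_mem_degZ 0 _, dualTensor_mem fun Y => neg_mem (lie_mem_degZ _)⟩

theorem anchorStar_mem {n : ℤ} {y : CTZ A 𝔤 Ω} (hu : y.1 ∈ genDeg 𝔤 (degZ A 𝔤) (-1) n)
    (hw : y.2 ∈ genDeg Ω (degZ A 𝔤) 0 n) :
    anchorStar pair br sharp y ∈ genDeg (Module.Dual ℝ 𝔤) (degZ A 𝔤) 1 (n + 1) := by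
  have h : y = LinearMap.inl (FunZ A 𝔤) _ _ y.1 + LinearMap.inr (FunZ A 𝔤) _ _ y.2 := by simp
  rw [h, map_add]
  refine add_mem ?_ ?_
  · refine linearMap_mem (degN := genDeg (Module.Dual ℝ 𝔤) (degZ A 𝔤) 1) (smul_mem_genDeg mul_mem_degZ)
      (anchorStar pair br sharp ∘ₗ LinearMap.inl _ _ _) (k := 0)
      (fun X => ?_) hu (by ring)
    rw [LinearMap.comp_apply, LinearMap.inl_apply, anchorStar_lie]
    exact dualTensor_mem fun Y => neg_mem (lie_mem_degZ _)
  · refine linearMap_mem (degN := genDeg (Module.Dual ℝ 𝔤) (degZ A 𝔤) 1) (smul_mem_genDeg mul_mem_degZ)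
      (anchorStar pair br sharp ∘ₗ LinearMap.inr _ _ _) (k := 1)
      (fun X => ?_) hw (by ring)
    rw [LinearMap.comp_apply, LinearMap.inr_apply, anchorStar_form]
    exact dualTensor_mem fun Y => algebraMap_mem_degZ _

theorem dTotT_mem {n : ℤ} {x : TotT A 𝔤 T} (hx : x ∈ degTotT A 𝔤 T n) :
    dTotT μ pair Dμ br sharp x ∈ degTotT A 𝔤 T (n + 1) := by
  obtain ⟨hu, hw, hs⟩ := hx
  have ha := anchor_mem (br := br) (sharp := sharp) (onCoeff_mem_genDeg_of_preserves signZ_mem hu)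
  exact ⟨onCoeff_mem_genDeg (contrMu_mem μ) hu, add_mem (onCoeff_mem_genDeg (contrMu_mem μ) hw) ha.1,
    add_mem (sub_mem (onCoeff_mem_genDeg (contrMu_mem μ) hs) (onCoeff_mem_genDeg_of_preserves signZ_mem (dMu_mem hw))) ha.2⟩

theorem dTotCT_mem {n : ℤ} {x : TotCT A 𝔤 Ω} (hx : x ∈ degTotCT A 𝔤 Ω n) :
    dTotCT μ pair Dμ br sharp x ∈ degTotCT A 𝔤 Ω (n + 1) := by
  obtain ⟨⟨hu, hw⟩, hs⟩ := hx
  exact ⟨⟨onCoeff_mem_genDeg (contrMu_mem μ) hu, add_mem (onCoeff_mem_genDeg (contrMu_mem μ) hw)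
    (dMuStar_mem (onCoeff_mem_genDeg_of_preserves signZ_mem hu))⟩,
    add_mem (onCoeff_mem_genDeg (contrMu_mem μ) hs) (onCoeff_mem_genDeg_of_preserves signZ_mem (anchorStar_mem hu hw))⟩

theorem SatisfiesLeibniz.leibniz {N : Type*} [AddCommGroup N] [Module A N] [Module (FunZ A 𝔤) N]
    {d : N →ₗ[A] N} (h : SatisfiesLeibniz μ d) {i : ℤ} {c : FunZ A 𝔤} (x : N)
    (hc : c ∈ degZ A 𝔤 i) :
    d (c • x) = contrMu μ c • x + ((Int.negOnePow i : ℤˣ) : ℤ) • (c • d x) := by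
  rw [h, signZ_of_mem hc, smul_assoc]

/-- The infinitesimal equivariance of the moment map: `X♯⟨μ, Y⟩ = -⟨μ, [X, Y]⟩`. -/
def InfinitesimallyEquivariant (μ : 𝔤 →ₗ[ℝ] A) (pair : Ω →ₗ[A] T →ₗ[A] A) (Dμ : 𝔤 →ₗ[ℝ] Ω)
    (br : 𝔤 →ₗ[ℝ] 𝔤 →ₗ[ℝ] 𝔤) (sharp : 𝔤 →ₗ[ℝ] T) : Prop :=
  ∀ X Y, pair (Dμ Y) (sharp X) = -μ (br X Y)

/-- Only the generator `X` is not immediate. Its two contributions, `-X♯⟨μ, Y⟩` from the fundamental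
field and `-⟨μ, [X, Y]⟩` from the coadjoint part, cancel by infinitesimal equivariance. -/
theorem dTotT_dTotT (h : InfinitesimallyEquivariant μ pair Dμ br sharp) (x : TotT A 𝔤 T) :
    dTotT μ pair Dμ br sharp (dTotT μ pair Dμ br sharp x) = 0 := by
  induction x using TotT.induction with
  | lie X =>
    rw [dTotT_lie, dTotT_dualTensor, dTotT_vec, Prod.mk_add_mk, Prod.mk_add_mk, ← dualTensor_neg,
      ← dualTensor_add, add_zero, add_zero]
    refine Prod.ext rfl (Prod.ext rfl
      ((congrArg dualTensor (LinearMap.ext fun Y => ?_)).trans dualTensor_zero))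
    change -(algebraMap A (FunZ A 𝔤) (pair (Dμ Y) (sharp X))) +
      contrMu μ (-(FunZ.lie A (br X Y))) = 0
    rw [map_neg, contrMu_lie, h, map_neg, neg_neg, add_neg_cancel]
  | vec W =>
    rw [dTotT_vec, ← dualTensor_neg, dTotT_dualTensor, ← Prod.zero_eq_mk, ← Prod.zero_eq_mk,
      map_zero, zero_add]
    have h0 : (contrMu μ).restrictScalars ℝ ∘ₗ
        (-((Algebra.linearMap A (FunZ A 𝔤) ∘ₗ pair.flip W).restrictScalars ℝ ∘ₗ Dμ)) = 0 := by
      rw [LinearMap.comp_neg, neg_eq_zero]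
      exact LinearMap.ext fun _ => contrMu_algebraMap μ _
    rw [h0, dualTensor_zero]
    rfl
  | contr σ => rw [dTotT_contr, map_zero]
  | smul c x hx => exact satisfiesLeibniz_dTotT.d_d_smul c hx
  | add x y hx hy => rw [map_add, map_add, hx, hy, add_zero]

/-- At `dX` the contributions are `Y♯⟨μ, X⟩` and `⟨μ, [Y, X]⟩`: the same cancellation as on the
tangent side with the two arguments exchanged. -/
theorem dTotCT_dTotCT (h : InfinitesimallyEquivariant μ pair Dμ br sharp) (x : TotCT A 𝔤 Ω) :
    dTotCT μ pair Dμ br sharp (dTotCT μ pair Dμ br sharp x) = 0 := by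
  induction x using TotCT.induction with
  | lie X =>
    rw [dTotCT_lie, dTotCT_dualTensor, dTotCT_form, Prod.mk_add_mk, ← dualTensor_add, add_zero]
    refine Prod.ext rfl ((congrArg dualTensor (LinearMap.ext fun Y => ?_)).trans dualTensor_zero)
    change algebraMap A (FunZ A 𝔤) (pair (Dμ X) (sharp Y)) +
      contrMu μ (FunZ.lie A (br Y X)) = 0
    rw [contrMu_lie, h, map_neg, neg_add_cancel]
  | form β =>
    rw [dTotCT_form, dTotCT_dualTensor, ← Prod.zero_eq_mk, map_zero, zero_add]
    have h0 : (contrMu μ).restrictScalars ℝ ∘ₗ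
        ((Algebra.linearMap A (FunZ A 𝔤) ∘ₗ pair β).restrictScalars ℝ ∘ₗ sharp) = 0 :=
      LinearMap.ext fun _ => contrMu_algebraMap μ _
    rw [h0, dualTensor_zero]
    rfl
  | dual σ => rw [dTotCT_dual, map_zero]
  | smul c x hx => exact satisfiesLeibniz_dTotCT.d_d_smul c hx
  | add x y hx hy => rw [map_add, map_add, hx, hy, add_zero]

theorem isDGModule_dTotT (h : InfinitesimallyEquivariant μ pair Dμ br sharp) :
    IsDGModule (degZ A 𝔤) (contrMu μ) (degTotT A 𝔤 T) (dTotT μ pair Dμ br sharp) where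
  isInternal := isInternal_degTotT
  smul_mem := smul_mem_degTotT
  d_mem := dTotT_mem
  d_d := dTotT_dTotT h
  leibniz := satisfiesLeibniz_dTotT.leibniz

theorem isDGModule_dTotCT (h : InfinitesimallyEquivariant μ pair Dμ br sharp) :
    IsDGModule (degZ A 𝔤) (contrMu μ) (degTotCT A 𝔤 Ω) (dTotCT μ pair Dμ br sharp) where
  isInternal := isInternal_degTotCT
  smul_mem := smul_mem_degTotCT
  d_mem := dTotCT_mem
  d_d := dTotCT_dTotCT h
  leibniz := satisfiesLeibniz_dTotCT.leibniz

/-! ### The map induced by the reduced form -/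

theorem reducedFlat_lie (X : 𝔤) :
    reducedFlat flat (LinearMap.id : 𝔤 →ₗ[ℝ] 𝔤) ((1 ⊗ₜ X, 0, 0) : TotT A 𝔤 T) =
      ((1 ⊗ₜ X, 0), 0) := by
  simp [reducedFlat, alpha, formFlat, alphaStar]

theorem reducedFlat_vec (W : T) :
    reducedFlat flat (LinearMap.id : 𝔤 →ₗ[ℝ] 𝔤) ((0, 1 ⊗ₜ W, 0) : TotT A 𝔤 T) =
      ((0, 1 ⊗ₜ flat W), 0) := by
  simp [reducedFlat, alpha, formFlat, alphaStar]

/-- Stated for an arbitrary element and not just a generator, because differentials of `X` and `W`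
land in this summand with non-constant coefficients. -/
theorem reducedFlat_contr (s : LieDualZ A 𝔤) :
    reducedFlat flat (LinearMap.id : 𝔤 →ₗ[ℝ] 𝔤) ((0, 0, s) : TotT A 𝔤 T) = ((0, 0), s) := by
  have h : extendScalars (TensorProduct.mk ℝ (FunZ A 𝔤) (Module.Dual ℝ 𝔤) 1) s = s := by
    induction s using tensor_generator_induction with
    | gen σ => rw [extendScalars_tmul, one_smul]; rfl
    | smul c z hz => rw [map_smul, hz]
    | add z z' hz hz' => rw [map_add, hz, hz']
  simp [reducedFlat, alpha, formFlat, alphaStar]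
  exact h

/-- The map is the identity on the two Lie algebra summands and the base change of `flat` on the
middle one, so an inverse of `flat` inverts all of it. -/
theorem bijective_reducedFlat (hflat : Function.Bijective flat) :
    Function.Bijective (reducedFlat flat (LinearMap.id : 𝔤 →ₗ[ℝ] 𝔤)) := by
  let e : T ≃ₗ[A] Ω := LinearEquiv.ofBijective flat hflat
  let φ := (TensorProduct.AlgebraTensorModule.congr (LinearEquiv.refl (FunZ A 𝔤) (FunZ A 𝔤)) e)
  have h (x : TotT A 𝔤 T) : reducedFlat flat (LinearMap.id : 𝔤 →ₗ[ℝ] 𝔤) x =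
      ((x.1, φ x.2.1), x.2.2) := by
    induction x using TotT.induction with
    | lie X => rw [reducedFlat_lie]; simp
    | vec W => rw [reducedFlat_vec]; simp [φ, e]
    | contr σ => rw [reducedFlat_contr]; simp
    | smul c x hx => rw [map_smul, hx]; simp
    | add x y hx hy => rw [map_add, hx, hy]; simp
  constructor
  · intro x y hxy
    rw [h, h, Prod.mk.injEq, Prod.mk.injEq] at hxy
    exact Prod.ext hxy.1.1 (Prod.ext (φ.injective hxy.1.2) hxy.2)
  · rintro ⟨⟨u, w⟩, s⟩
    refine ⟨(u, φ.symm w, s), ?_⟩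
    rw [h, LinearEquiv.apply_symm_apply]

theorem reducedFlat_mem {n : ℤ} {x : TotT A 𝔤 T} (hx : x ∈ degTotT A 𝔤 T n) :
    reducedFlat flat (LinearMap.id : 𝔤 →ₗ[ℝ] 𝔤) x ∈ degTotCT A 𝔤 Ω n := by
  obtain ⟨u, w, s⟩ := x
  obtain ⟨hu, hw, hs⟩ := hx
  have h : ((u, w, s) : TotT A 𝔤 T) = LinearMap.inl (FunZ A 𝔤) _ _ u +
    (LinearMap.inr (FunZ A 𝔤) _ _ ∘ₗ LinearMap.inl (FunZ A 𝔤) _ _) w + (0, 0, s) := by simp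
  rw [h, map_add, map_add]
  refine add_mem (add_mem ?_ ?_) ?_
  · refine linearMap_mem (degN := degTotCT A 𝔤 Ω) smul_mem_degTotCT
      (reducedFlat flat (LinearMap.id : 𝔤 →ₗ[ℝ] 𝔤) ∘ₗ LinearMap.inl _ _ _) (k := (-1))
      (fun X => ?_) hu (by ring)
    refine Set.mem_of_eq_of_mem (reducedFlat_lie X) ⟨⟨?_, zero_mem _⟩, zero_mem _⟩
    exact one_tmul_mem_genDeg one_mem_degZ _ _
  · refine linearMap_mem (degN := degTotCT A 𝔤 Ω) smul_mem_degTotCT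
      (reducedFlat flat (LinearMap.id : 𝔤 →ₗ[ℝ] 𝔤) ∘ₗ LinearMap.inr _ _ _ ∘ₗ
        LinearMap.inl (FunZ A 𝔤) _ _) (k := 0)
      (fun W => ?_) hw (by ring)
    refine Set.mem_of_eq_of_mem (reducedFlat_vec W) ⟨⟨zero_mem _, ?_⟩, zero_mem _⟩
    exact one_tmul_mem_genDeg one_mem_degZ _ _
  · rw [reducedFlat_contr]
    exact ⟨⟨zero_mem _, zero_mem _⟩, hs⟩

/-- At `X` the components are the moment equation `flat (sharp X) = Dμ X` and `-[X, Y] = [Y, X]`. At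
`W` one needs `-W⟨μ, Y⟩ = ω(W, Y♯)`, which is the moment equation for `Y` after exchanging the
arguments of `ω`. -/
theorem reducedFlat_dTotT (hbr : ∀ X Y, br X Y = -br Y X) (hsharp : ∀ X, flat (sharp X) = Dμ X)
    (hskew : ∀ V W, pair (flat V) W = -pair (flat W) V) (x : TotT A 𝔤 T) :
    reducedFlat flat (LinearMap.id : 𝔤 →ₗ[ℝ] 𝔤) (dTotT μ pair Dμ br sharp x) =
      dTotCT μ pair Dμ br sharp (reducedFlat flat (LinearMap.id : 𝔤 →ₗ[ℝ] 𝔤) x) := by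
  induction x using TotT.induction with
  | lie X =>
    have h (w : PullZ A 𝔤 T) (s : LieDualZ A 𝔤) :
      ((0, w, s) : TotT A 𝔤 T) = (0, w, 0) + (0, 0, s) := by simp
    rw [dTotT_lie, h, map_add, reducedFlat_vec, reducedFlat_contr, reducedFlat_lie, dTotCT_lie,
      hsharp, Prod.mk_add_mk, Prod.mk_add_mk, zero_add, add_zero, zero_add]
    congr 2
    ext Y
    simp [hbr X Y]
  | vec W =>
    rw [dTotT_vec, reducedFlat_contr, reducedFlat_vec, dTotCT_form, ← dualTensor_neg]
    refine Prod.ext rfl (congrArg dualTensor ?_)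
    refine LinearMap.ext fun Y => ?_
    change -(algebraMap A (FunZ A 𝔤) (pair (Dμ Y) W)) =
      algebraMap A (FunZ A 𝔤) (pair (flat W) (sharp Y))
    rw [← hsharp, hskew W, map_neg]
  | contr σ => rw [dTotT_contr, reducedFlat_contr, map_zero, dTotCT_dual]
  | smul c x hx => rw [satisfiesLeibniz_dTotT, map_add, map_smul, map_smul, map_smul,
      satisfiesLeibniz_dTotCT, hx]
  | add x y hx hy => rw [map_add, map_add, map_add, map_add, hx, hy]

end DGModules

/-! ### Compatibility of the group action with the differentials and the map. -/

section Equivariance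

variable {A 𝔤 T Ω : Type*} [CommRing A] [Algebra ℝ A] [AddCommGroup 𝔤] [Module ℝ 𝔤]
  [FiniteDimensional ℝ 𝔤] [AddCommGroup T] [Module ℝ T] [Module A T] [IsScalarTower ℝ A T]
  [AddCommGroup Ω] [Module ℝ Ω] [Module A Ω] [IsScalarTower ℝ A Ω]

theorem actZ_eq_self {f : A →ₐ[ℝ] A} {a : 𝔤 →ₗ[ℝ] 𝔤} (hf : ∀ r, f r = r) (ha : ∀ X, a X = X)
    (c : FunZ A 𝔤) : actZ f a c = c := by
  induction c using FunZ.induction with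
  | scalar r => rw [actZ_algebraMap, hf]
  | lie X => rw [actZ_lie, ha]
  | mul c c' hc hc' => rw [map_mul, hc, hc']
  | add c c' hc hc' => rw [map_add, hc, hc']

theorem actZ_eq_actZ_actZ {f f' f'' : A →ₐ[ℝ] A} {a a' a'' : 𝔤 →ₗ[ℝ] 𝔤}
    (hf : ∀ r, f r = f' (f'' r)) (ha : ∀ X, a X = a' (a'' X)) (c : FunZ A 𝔤) :
    actZ f a c = actZ f' a' (actZ f'' a'' c) := by
  induction c using FunZ.induction with
  | scalar r => simp only [actZ_algebraMap, hf]
  | lie X => simp only [actZ_lie, ha]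
  | mul c c' hc hc' => simp only [map_mul, hc, hc']
  | add c c' hc hc' => simp only [map_add, hc, hc']

section OneElement

variable {V : Type*} [AddCommGroup V] [Module ℝ V] {f : A →ₐ[ℝ] A} {a : 𝔤 →ₗ[ℝ] 𝔤}
  {b : T →ₛₗ[f.toRingHom] T} {b' : Ω →ₛₗ[f.toRingHom] Ω}

theorem actTriv_tmul (v : V →ₗ[ℝ] V) (c : FunZ A 𝔤) (p : V) :
    actTriv f a v (c ⊗ₜ p) = actZ f a c ⊗ₜ v p := rfl

theorem actPull_tmul (c : FunZ A 𝔤) (p : T) :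
    actPull f a b (c ⊗ₜ p) = actZ f a c ⊗ₜ b p := rfl

theorem actTriv_one_tmul (v : V →ₗ[ℝ] V) (p : V) :
    actTriv f a v ((1 : FunZ A 𝔤) ⊗ₜ p) = 1 ⊗ₜ v p := by
  rw [actTriv_tmul, map_one]

theorem actPull_one_tmul (p : T) :
    actPull f a b ((1 : FunZ A 𝔤) ⊗ₜ p) = 1 ⊗ₜ b p := by
  rw [actPull_tmul, map_one]

theorem actTriv_smul (v : V →ₗ[ℝ] V) (c : FunZ A 𝔤) (z : FunZ A 𝔤 ⊗[ℝ] V) :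
    actTriv f a v (c • z) = actZ f a c • actTriv f a v z := by
  induction z using TensorProduct.induction_on with
  | zero => simp only [smul_zero, map_zero]
  | add x y hx hy => simp only [smul_add, map_add, hx, hy]
  | tmul c' p =>
    rw [TensorProduct.smul_tmul', actTriv_tmul, actTriv_tmul, smul_eq_mul, map_mul]
    rfl

theorem actPull_smul (c : FunZ A 𝔤) (z : PullZ A 𝔤 T) :
    actPull f a b (c • z) = actZ f a c • actPull f a b z := by
  induction z using TensorProduct.induction_on with
  | zero => simp only [smul_zero, map_zero]
  | add x y hx hy => simp only [smul_add, map_add, hx, hy]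
  | tmul c' p =>
    rw [TensorProduct.smul_tmul', actPull_tmul, actPull_tmul, smul_eq_mul, map_mul]
    rfl

theorem actTriv_mem (v : V →ₗ[ℝ] V) {d n : ℤ} {z : FunZ A 𝔤 ⊗[ℝ] V}
    (hz : z ∈ genDeg V (degZ A 𝔤) d n) : actTriv f a v z ∈ genDeg V (degZ A 𝔤) d n :=
  map_mem_of_mem_genDeg (S := (genDeg V (degZ A 𝔤) d n).toAddSubgroup) (actTriv f a v)
    (fun _ hc p => tmul_mem_genDeg (actZ_mem f a hc) (v p)) hz

theorem actPull_mem {d n : ℤ} {z : PullZ A 𝔤 T}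
    (hz : z ∈ genDeg T (degZ A 𝔤) d n) : actPull f a b z ∈ genDeg T (degZ A 𝔤) d n :=
  map_mem_of_mem_genDeg (S := (genDeg T (degZ A 𝔤) d n).toAddSubgroup) (actPull f a b)
    (fun _ hc p => tmul_mem_genDeg (actZ_mem f a hc) (b p)) hz

/-- The contragredient action on `𝔤^*` becomes precomposition with `e` on the corresponding linear
map, so equivariance can be checked pointwise in `Y ∈ 𝔤`. -/
theorem actTriv_dualTensor (φ : 𝔤 →ₗ[ℝ] FunZ A 𝔤) (e : 𝔤 →ₗ[ℝ] 𝔤) :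
    actTriv f a e.dualMap (dualTensor φ) = dualTensor ((actZ f a).toLinearMap ∘ₗ φ ∘ₗ e) := by
  rw [← LinearMap.comp_assoc, dualTensor_comp, dualTensor, map_sum]
  rfl

variable {a' : Module.Dual ℝ 𝔤 →ₗ[ℝ] Module.Dual ℝ 𝔤}

theorem actTotT_apply (u : LieZ A 𝔤) (w : PullZ A 𝔤 T) (s : LieDualZ A 𝔤) :
    actTotT f a a' b (u, w, s) = (actTriv f a a u, actPull f a b w, actTriv f a a' s) := rfl

theorem actTotCT_apply (u : LieZ A 𝔤) (w : PullZ A 𝔤 Ω) (s : LieDualZ A 𝔤) :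
    actTotCT f a a' b' ((u, w), s) = ((actTriv f a a u, actPull f a b' w), actTriv f a a' s) := rfl

theorem actTotT_smul (c : FunZ A 𝔤) (x : TotT A 𝔤 T) :
    actTotT f a a' b (c • x) = actZ f a c • actTotT f a a' b x :=
  Prod.ext (actTriv_smul _ _ _) (Prod.ext (actPull_smul _ _) (actTriv_smul _ _ _))

theorem actTotCT_smul (c : FunZ A 𝔤) (x : TotCT A 𝔤 Ω) :
    actTotCT f a a' b' (c • x) = actZ f a c • actTotCT f a a' b' x :=
  Prod.ext (Prod.ext (actTriv_smul _ _ _) (actPull_smul _ _)) (actTriv_smul _ _ _)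

theorem actTotT_mem {n : ℤ} {x : TotT A 𝔤 T} (hx : x ∈ degTotT A 𝔤 T n) :
    actTotT f a a' b x ∈ degTotT A 𝔤 T n :=
  ⟨actTriv_mem _ hx.1, actPull_mem hx.2.1, actTriv_mem _ hx.2.2⟩

theorem actTotCT_mem {n : ℤ} {x : TotCT A 𝔤 Ω} (hx : x ∈ degTotCT A 𝔤 Ω n) :
    actTotCT f a a' b' x ∈ degTotCT A 𝔤 Ω n :=
  ⟨⟨actTriv_mem _ hx.1.1, actPull_mem hx.1.2⟩, actTriv_mem _ hx.2⟩

end OneElement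

variable {μ : 𝔤 →ₗ[ℝ] A} {pair : Ω →ₗ[A] T →ₗ[A] A} {Dμ : 𝔤 →ₗ[ℝ] Ω}
  {br : 𝔤 →ₗ[ℝ] 𝔤 →ₗ[ℝ] 𝔤} {sharp : 𝔤 →ₗ[ℝ] T} {flat : T →ₗ[A] Ω}

/-- The maps `f`, `a`, `b`, `b'` on functions, on the Lie algebra, on vector fields and on one-forms
are compatible with the moment map, the bracket, the infinitesimal action and the pairing; the map
`e` is a right inverse of `a`. -/
structure IsSymmetry (μ : 𝔤 →ₗ[ℝ] A) (pair : Ω →ₗ[A] T →ₗ[A] A) (Dμ : 𝔤 →ₗ[ℝ] Ω)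
    (br : 𝔤 →ₗ[ℝ] 𝔤 →ₗ[ℝ] 𝔤) (sharp : 𝔤 →ₗ[ℝ] T) (f : A →ₐ[ℝ] A) (a e : 𝔤 →ₗ[ℝ] 𝔤)
    (b : T →ₛₗ[f.toRingHom] T) (b' : Ω →ₛₗ[f.toRingHom] Ω) : Prop where
  apply_inv : ∀ X, a (e X) = X
  map_μ : ∀ X, f (μ X) = μ (a X)
  map_Dμ : ∀ X, b' (Dμ X) = Dμ (a X)
  map_sharp : ∀ X, b (sharp X) = sharp (a X)
  map_br : ∀ X Y, a (br X Y) = br (a X) (a Y)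
  map_pair : ∀ β W, f (pair β W) = pair (b' β) (b W)

section OneElement

variable {f : A →ₐ[ℝ] A} {a e : 𝔤 →ₗ[ℝ] 𝔤} {b : T →ₛₗ[f.toRingHom] T}
  {b' : Ω →ₛₗ[f.toRingHom] Ω}

/-- On generators the substitution `Y ↦ e Y` is undone by `a ∘ e = id`: for `X` after `a` is
distributed over the bracket, for `W` after it is carried through the pairing and `Dμ`.
Compatibility with `μ` enters only through the coefficients. -/
theorem IsSymmetry.actTotT_dTotT (h : IsSymmetry μ pair Dμ br sharp f a e b b')
    (x : TotT A 𝔤 T) :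
    actTotT f a e.dualMap b (dTotT μ pair Dμ br sharp x) =
      dTotT μ pair Dμ br sharp (actTotT f a e.dualMap b x) := by
  induction x using TotT.induction with
  | lie X =>
    rw [dTotT_lie, actTotT_apply, actTotT_apply, map_zero, map_zero, map_zero, actTriv_one_tmul,
      actPull_one_tmul, dTotT_lie, h.map_sharp, actTriv_dualTensor]
    refine Prod.ext rfl (Prod.ext rfl (congrArg dualTensor (LinearMap.ext fun Y => ?_)))
    change actZ f a (-(FunZ.lie A (br X (e Y)))) = -(FunZ.lie A (br (a X) Y))
    rw [map_neg, actZ_lie, h.map_br, h.apply_inv]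
  | vec W =>
    rw [dTotT_vec, actTotT_apply, actTotT_apply, map_zero, map_zero, map_zero, map_neg,
      actPull_one_tmul, dTotT_vec, actTriv_dualTensor]
    refine Prod.ext rfl (Prod.ext rfl (congrArg Neg.neg (congrArg dualTensor
      (LinearMap.ext fun Y => ?_))))
    change actZ f a (algebraMap A (FunZ A 𝔤) (pair (Dμ (e Y)) W)) =
      algebraMap A (FunZ A 𝔤) (pair (Dμ Y) (b W))
    rw [actZ_algebraMap, h.map_pair, h.map_Dμ, h.apply_inv]
  | contr σ =>
    rw [dTotT_contr, map_zero, actTotT_apply, map_zero, map_zero, actTriv_one_tmul, dTotT_contr]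
  | smul c x hx =>
    rw [satisfiesLeibniz_dTotT, map_add, actTotT_smul, actTotT_smul, actTotT_smul,
      satisfiesLeibniz_dTotT, hx, actZ_contrMu h.map_μ, actZ_signZ]
  | add x y hx hy => rw [map_add, map_add, map_add, map_add, hx, hy]

theorem IsSymmetry.actTotCT_dTotCT (h : IsSymmetry μ pair Dμ br sharp f a e b b')
    (x : TotCT A 𝔤 Ω) :
    actTotCT f a e.dualMap b' (dTotCT μ pair Dμ br sharp x) =
      dTotCT μ pair Dμ br sharp (actTotCT f a e.dualMap b' x) := by
  induction x using TotCT.induction with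
  | lie X =>
    rw [dTotCT_lie, actTotCT_apply, actTotCT_apply, map_zero, map_zero, map_zero,
      actTriv_one_tmul, actPull_one_tmul, dTotCT_lie, h.map_Dμ, actTriv_dualTensor]
    refine Prod.ext rfl (congrArg dualTensor (LinearMap.ext fun Y => ?_))
    change actZ f a (FunZ.lie A (br (e Y) X)) = FunZ.lie A (br Y (a X))
    rw [actZ_lie, h.map_br, h.apply_inv]
  | form β =>
    rw [dTotCT_form, ← Prod.mk_zero_zero, actTotCT_apply, actTotCT_apply, map_zero, map_zero,
      map_zero, actPull_one_tmul, dTotCT_form, actTriv_dualTensor]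
    refine Prod.ext rfl (congrArg dualTensor (LinearMap.ext fun Y => ?_))
    change actZ f a (algebraMap A (FunZ A 𝔤) (pair β (sharp (e Y)))) =
      algebraMap A (FunZ A 𝔤) (pair (b' β) (sharp Y))
    rw [actZ_algebraMap, h.map_pair, h.map_sharp, h.apply_inv]
  | dual σ =>
    rw [dTotCT_dual, map_zero, actTotCT_apply, map_zero, map_zero, actTriv_one_tmul, dTotCT_dual]
  | smul c x hx =>
    rw [satisfiesLeibniz_dTotCT, map_add, actTotCT_smul, actTotCT_smul, actTotCT_smul,
      satisfiesLeibniz_dTotCT, hx, actZ_contrMu h.map_μ, actZ_signZ]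
  | add x y hx hy => rw [map_add, map_add, map_add, map_add, hx, hy]

/-- The Lie algebra summands are carried over unchanged and bear the same action on both sides, so
only the naturality of `flat` is needed, and `a'` may be arbitrary. -/
theorem reducedFlat_actTotT {a' : Module.Dual ℝ 𝔤 →ₗ[ℝ] Module.Dual ℝ 𝔤}
    (h : ∀ W, b' (flat W) = flat (b W)) (x : TotT A 𝔤 T) :
    reducedFlat flat (LinearMap.id : 𝔤 →ₗ[ℝ] 𝔤) (actTotT f a a' b x) =
      actTotCT f a a' b' (reducedFlat flat (LinearMap.id : 𝔤 →ₗ[ℝ] 𝔤) x) := by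
  induction x using TotT.induction with
  | lie X =>
    rw [reducedFlat_lie, actTotT_apply, actTotCT_apply, map_zero, map_zero, map_zero,
      actTriv_one_tmul, reducedFlat_lie]
  | vec W =>
    rw [reducedFlat_vec, actTotT_apply, actTotCT_apply, map_zero, map_zero, actPull_one_tmul,
      actPull_one_tmul, reducedFlat_vec, h]
  | contr σ =>
    rw [reducedFlat_contr, actTotT_apply, actTotCT_apply, map_zero, map_zero, map_zero,
      reducedFlat_contr]
  | smul c x hx => rw [actTotT_smul, map_smul, hx, map_smul, actTotCT_smul]
  | add x y hx hy => rw [map_add, map_add, map_add, map_add, hx, hy]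

end OneElement

section Groups

variable {G : Type*} [Group G] {f : G → A →ₐ[ℝ] A} {a : G → 𝔤 →ₗ[ℝ] 𝔤}
  {b : ∀ g, T →ₛₗ[(f g).toRingHom] T} {b' : ∀ g, Ω →ₛₗ[(f g).toRingHom] Ω}

theorem isEquivariantDGModule_dTotT (h : InfinitesimallyEquivariant μ pair Dμ br sharp)
    (hs : ∀ g, IsSymmetry μ pair Dμ br sharp (f g) (a g) (a g⁻¹) (b g) (b' g))
    (hf₁ : ∀ r, f 1 r = r) (hf : ∀ g g' r, f (g * g') r = f g (f g' r))
    (ha₁ : ∀ X, a 1 X = X) (ha : ∀ g g' X, a (g * g') X = a g (a g' X))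
    (hb₁ : ∀ W, b 1 W = W) (hb : ∀ g g' W, b (g * g') W = b g (b g' W)) :
    IsEquivariantDGModule (degZ A 𝔤) (contrMu μ) (fun g => (actZ (f g) (a g)).toRingHom)
      (degTotT A 𝔤 T) (dTotT μ pair Dμ br sharp)
      (fun g => actTotT (f g) (a g) (a g⁻¹).dualMap (b g)) where
  toIsDGModule := isDGModule_dTotT h
  act_one x := by
    induction x using TotT.induction with
    | lie X =>
      rw [actTotT_apply, map_zero, map_zero, actTriv_one_tmul, ha₁]
    | vec W =>
      rw [actTotT_apply, map_zero, map_zero, actPull_one_tmul, hb₁]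
    | contr σ =>
      have : (a 1⁻¹).dualMap σ = σ := LinearMap.ext fun X => by
        rw [LinearMap.dualMap_apply, inv_one, ha₁]
      rw [actTotT_apply, map_zero, map_zero, actTriv_one_tmul, this]
    | smul c x hx => rw [actTotT_smul, hx, actZ_eq_self hf₁ ha₁]
    | add x y hx hy => rw [map_add, hx, hy]
  act_mul g g' x := by
    induction x using TotT.induction with
    | lie X =>
      simp only [actTotT_apply, map_zero, actTriv_one_tmul, ha]
    | vec W =>
      simp only [actTotT_apply, map_zero, actPull_one_tmul, hb]
    | contr σ =>
      -- Inversion and dualization each reverse the order of composition, so together they give a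
      -- left action.
      have : (a (g * g')⁻¹).dualMap σ = (a g⁻¹).dualMap ((a g'⁻¹).dualMap σ) :=
        LinearMap.ext fun X => by simp only [LinearMap.dualMap_apply, mul_inv_rev, ha]
      simp only [actTotT_apply, map_zero, actTriv_one_tmul, this]
    | smul c x hx =>
      rw [actTotT_smul, hx, actTotT_smul, actTotT_smul, actZ_eq_actZ_actZ (hf g g') (ha g g')]
    | add x y hx hy => rw [map_add, map_add, map_add, hx, hy]
  act_smul _ c x := actTotT_smul c x
  act_mem _ _ _ hx := actTotT_mem hx
  act_d g x := (hs g).actTotT_dTotT x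

theorem isEquivariantDGModule_dTotCT (h : InfinitesimallyEquivariant μ pair Dμ br sharp)
    (hs : ∀ g, IsSymmetry μ pair Dμ br sharp (f g) (a g) (a g⁻¹) (b g) (b' g))
    (hf₁ : ∀ r, f 1 r = r) (hf : ∀ g g' r, f (g * g') r = f g (f g' r))
    (ha₁ : ∀ X, a 1 X = X) (ha : ∀ g g' X, a (g * g') X = a g (a g' X))
    (hb₁ : ∀ β, b' 1 β = β) (hb : ∀ g g' β, b' (g * g') β = b' g (b' g' β)) :
    IsEquivariantDGModule (degZ A 𝔤) (contrMu μ) (fun g => (actZ (f g) (a g)).toRingHom)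
      (degTotCT A 𝔤 Ω) (dTotCT μ pair Dμ br sharp)
      (fun g => actTotCT (f g) (a g) (a g⁻¹).dualMap (b' g)) where
  toIsDGModule := isDGModule_dTotCT h
  act_one x := by
    induction x using TotCT.induction with
    | lie X =>
      rw [actTotCT_apply, map_zero, map_zero, actTriv_one_tmul, ha₁]
    | form β =>
      rw [actTotCT_apply, map_zero, map_zero, actPull_one_tmul, hb₁]
    | dual σ =>
      have : (a 1⁻¹).dualMap σ = σ := LinearMap.ext fun X => by
        rw [LinearMap.dualMap_apply, inv_one, ha₁]
      rw [actTotCT_apply, map_zero, map_zero, actTriv_one_tmul, this]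
    | smul c x hx => rw [actTotCT_smul, hx, actZ_eq_self hf₁ ha₁]
    | add x y hx hy => rw [map_add, hx, hy]
  act_mul g g' x := by
    induction x using TotCT.induction with
    | lie X =>
      simp only [actTotCT_apply, map_zero, actTriv_one_tmul, ha]
    | form β =>
      simp only [actTotCT_apply, map_zero, actPull_one_tmul, hb]
    | dual σ =>
      have : (a (g * g')⁻¹).dualMap σ = (a g⁻¹).dualMap ((a g'⁻¹).dualMap σ) :=
        LinearMap.ext fun X => by simp only [LinearMap.dualMap_apply, mul_inv_rev, ha]
      simp only [actTotCT_apply, map_zero, actTriv_one_tmul, this]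
    | smul c x hx =>
      rw [actTotCT_smul, hx, actTotCT_smul, actTotCT_smul, actZ_eq_actZ_actZ (hf g g') (ha g g')]
    | add x y hx hy => rw [map_add, map_add, map_add, hx, hy]
  act_smul _ c x := actTotCT_smul c x
  act_mem _ _ _ hx := actTotCT_mem hx
  act_d g x := (hs g).actTotCT_dTotCT x

end Groups

end Equivariance

/-! ### The derivative of the adjoint action in a local Lie group. -/

section LocalGroup

variable {F : Type*} [NormedAddCommGroup F] [NormedSpace ℝ F] [CompleteSpace F]

/-- In a local Lie group with multiplication `m` and unit `p`, the derivative at `p` of the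
adjoint action `y ↦ A y` on a vector `Y` is the bracket with `Y`. -/
theorem exists_hasFDerivAt_adjoint {m : F × F → F} {p Y : F} {A : F → F}
    (hm : ContDiffAt ℝ 2 m (p, p)) (hr : ∀ᶠ y in 𝓝 p, m (y, p) = y)
    (hl : ∀ᶠ y in 𝓝 p, m (p, y) = y)
    (hA : ∀ᶠ y in 𝓝 p, fderiv ℝ m (p, y) (A y, 0) = fderiv ℝ m (y, p) (0, Y)) :
    ∃ L : F →L[ℝ] F, HasFDerivAt A L p ∧ ∀ X, L X =
      VectorField.lieBracket ℝ (fun y => fderiv ℝ m (y, p) (0, X))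
        (fun y => fderiv ℝ m (y, p) (0, Y)) p := by
  have hmd : HasFDerivAt m (fderiv ℝ m (p, p)) (p, p) :=
    (hm.differentiableAt (by norm_num)).hasFDerivAt
  have hp₁ : HasFDerivAt (fun y : F => (y, p)) (ContinuousLinearMap.inl ℝ F F) p :=
    hasFDerivAt_prodMk_left p p
  have hp₂ : HasFDerivAt (fun y : F => (p, y)) (ContinuousLinearMap.inr ℝ F F) p :=
    hasFDerivAt_prodMk_right p p
  -- Both partial derivatives of the multiplication at the unit are the identity, since `p` is a
  -- two-sided unit near `p`.
  have h₁ : (fderiv ℝ m (p, p)).comp (ContinuousLinearMap.inl ℝ F F) = .id ℝ F :=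
    (HasFDerivAt.comp (f := fun y : F => (y, p)) p hmd hp₁).unique ((hasFDerivAt_id p).congr_of_eventuallyEq hr)
  have h₂ : (fderiv ℝ m (p, p)).comp (ContinuousLinearMap.inr ℝ F F) = .id ℝ F :=
    (hmd.comp p hp₂).unique ((hasFDerivAt_id p).congr_of_eventuallyEq hl)
  have h₁' (v : F) : fderiv ℝ m (p, p) (v, 0) = v := DFunLike.congr_fun h₁ v
  have h₂' (v : F) : fderiv ℝ m (p, p) (0, v) = v := DFunLike.congr_fun h₂ v
  set D' := fderiv ℝ (fderiv ℝ m) (p, p)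
  have hD : HasFDerivAt (fderiv ℝ m) D' (p, p) :=
    ((hm.fderiv_right (m := 1) (by norm_num)).differentiableAt (by norm_num)).hasFDerivAt
  have hV (X : F) : HasFDerivAt (fun y => fderiv ℝ m (y, p) (0, X))
      ((D'.comp (.inl ℝ F F)).flip (0, X)) p := by
    simpa using (HasFDerivAt.comp (g := fderiv ℝ m) (f := fun y : F => (y, p)) p hD hp₁).clm_apply
      (hasFDerivAt_const ((0, X) : F × F) p)
  set B : F → F →L[ℝ] F := fun y => (fderiv ℝ m (p, y)).comp (.inl ℝ F F)
  have hB : HasFDerivAt B (((ContinuousLinearMap.compL ℝ F (F × F) F).flip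
      (.inl ℝ F F)).comp (D'.comp (.inr ℝ F F))) p :=
    ((ContinuousLinearMap.compL ℝ F (F × F) F).flip
      (.inl ℝ F F)).hasFDerivAt.comp p (HasFDerivAt.comp (g := fderiv ℝ m) p hD hp₂)
  have hBp : B p = .id ℝ F := h₁
  have hinv : DifferentiableAt ℝ (fun y => (B y).inverse (fderiv ℝ m (y, p) (0, Y))) p := by
    refine DifferentiableAt.clm_apply ?_ (hV Y).differentiableAt
    refine DifferentiableAt.comp (g := ContinuousLinearMap.inverse) p ?_ hB.differentiableAt
    rw [hBp]
    exact ((contDiffAt_map_inverse (n := 1) (ContinuousLinearEquiv.refl ℝ F)).differentiableAt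
      (by norm_num))
  -- `A` is given only implicitly by `B y (A y) = ∂₂m(y, p) Y`. Since `B p` is the identity and
  -- invertible operators form a neighbourhood of it, the equation can be solved near `p`, and `A`
  -- inherits differentiability from the operator inverse.
  have hAd : DifferentiableAt ℝ A p := by
    refine hinv.congr_of_eventuallyEq ?_
    have hBi : ∀ᶠ y in 𝓝 p, (B y).IsInvertible := by
      have := hB.continuousAt.preimage_mem_nhds (t := Set.range ((↑) : (F ≃L[ℝ] F) → F →L[ℝ] F)) (by
        rw [hBp]; exact ContinuousLinearEquiv.nhds (ContinuousLinearEquiv.refl ℝ F))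
      exact this
    filter_upwards [hA, hBi] with y hy hBy
    obtain ⟨e, he⟩ := hBy
    have h : B y (A y) = fderiv ℝ m (y, p) (0, Y) := hy
    rw [← h, ← he]
    simp
  refine ⟨fderiv ℝ A p, hAd.hasFDerivAt, fun X => ?_⟩
  have hAp : A p = Y := by
    have := hA.self_of_nhds
    rwa [h₁', h₂'] at this
  -- Differentiating the defining equation at `p` gives `A'(X) + D²m((0,X),(Y,0)) =
  -- D²m((X,0),(0,Y))`.
  have hE := (hB.clm_apply hAd.hasFDerivAt).unique ((hV Y).congr_of_eventuallyEq hA)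
  have hE' := DFunLike.congr_fun hE X
  -- Symmetry of the second derivative turns the mixed term into the derivative of the field of `X`
  -- in direction `Y`, the second half of the bracket.
  have hsymm : D' (0, X) (Y, 0) = D' (Y, 0) (0, X) :=
    (hm.isSymmSndFDerivAt (by simp)).eq _ _
  rw [VectorField.lieBracket_eq]
  beta_reduce
  rw [(hV X).fderiv, (hV Y).fderiv]
  simp [hBp, hAp, h₂'] at hE' ⊢
  rw [← hE', hsymm]
  abel

end LocalGroup

/-! ### Derivatives of maps of manifolds, read on the model spaces. -/

section ModelDeriv

variable (E : Type*) [NormedAddCommGroup E] [NormedSpace ℝ E]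
  (E' : Type*) [NormedAddCommGroup E'] [NormedSpace ℝ E']
  (E'' : Type*) [NormedAddCommGroup E''] [NormedSpace ℝ E'']
  {M : Type*} [TopologicalSpace M] [ChartedSpace E M]
  {M' : Type*} [TopologicalSpace M'] [ChartedSpace E' M']
  {M'' : Type*} [TopologicalSpace M''] [ChartedSpace E'' M'']

/-- The derivative of a map between manifolds, as a map between the model spaces, to which all
tangent spaces are equal by definition. -/
def modelDeriv (f : M → M') (x : M) : E →L[ℝ] E' := mfderiv 𝓘(ℝ, E) 𝓘(ℝ, E') f x

/-- The base point of `g` and the composite are only required to agree through hypotheses. Points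
such as `1 • x` or `g * 1 * g⁻¹` can then be simplified without transporting tangent vectors between
fibres. -/
theorem modelDeriv_comp {f : M → M'} {g : M' → M''} {h : M → M''} {x : M} {y : M'}
    (hg : MDifferentiableAt 𝓘(ℝ, E') 𝓘(ℝ, E'') g y)
    (hf : MDifferentiableAt 𝓘(ℝ, E) 𝓘(ℝ, E') f x) (hy : f x = y) (hh : h =ᶠ[𝓝 x] g ∘ f) :
    modelDeriv E E'' h x = (modelDeriv E' E'' g y).comp (modelDeriv E E' f x) := by
  subst hy
  exact hh.mfderiv_eq.trans (mfderiv_comp x hg hf)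

theorem modelDeriv_comp_apply {f : M → M'} {g : M' → M''} {h : M → M''} {x : M} {y : M'}
    (hg : MDifferentiableAt 𝓘(ℝ, E') 𝓘(ℝ, E'') g y)
    (hf : MDifferentiableAt 𝓘(ℝ, E) 𝓘(ℝ, E') f x) (hy : f x = y) (hh : h =ᶠ[𝓝 x] g ∘ f) (v : E) :
    modelDeriv E E'' h x v = modelDeriv E' E'' g y (modelDeriv E E' f x v) :=
  DFunLike.congr_fun (modelDeriv_comp E E' E'' hg hf hy hh) v

theorem modelDeriv_eq_fderiv (f : E → E') (x : E) : modelDeriv E E' f x = fderiv ℝ f x :=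
  mfderiv_eq_fderiv

theorem modelDeriv_id (x : M) : modelDeriv E E (fun y : M => y) x = .id ℝ E :=
  mfderiv_id

end ModelDeriv

/-! ### The adjoint action, the bracket in the chart at the unit, and the derivative of `Ad`. -/

section LieGroup

variable {F : Type*} [NormedAddCommGroup F] [NormedSpace ℝ F]
  {G : Type*} [TopologicalSpace G] [ChartedSpace F G] [Group G]

theorem maurerCartan_one : maurerCartan (F := F) (1 : G) = LinearMap.id := by
  have h : (fun h : G => (1 : G)⁻¹ * h) = fun h => h := by funext h; simp
  refine LinearMap.ext fun X => ?_
  change modelDeriv F F (fun h : G => (1 : G)⁻¹ * h) 1 X = X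
  rw [h, modelDeriv_id]
  rfl

theorem Ad_one (X : LieAlg F G) : Ad (1 : G) X = X := by
  have h : (fun h : G => 1 * h * 1⁻¹) = fun h => h := by funext h; simp
  change modelDeriv F F (fun h : G => 1 * h * 1⁻¹) 1 X = X
  rw [h, modelDeriv_id]
  rfl

variable [LieGroup 𝓘(ℝ, F) ∞ G]

variable (F) in
theorem mdifferentiable_mul_left (g : G) :
    MDifferentiable 𝓘(ℝ, F) 𝓘(ℝ, F) (fun h : G => g * h) :=
  (contMDiff_mul_left (I := 𝓘(ℝ, F)) (n := ∞)).mdifferentiable (by simp)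

variable (F) in
theorem mdifferentiable_mul_right (g : G) :
    MDifferentiable 𝓘(ℝ, F) 𝓘(ℝ, F) (fun h : G => h * g) :=
  (contMDiff_mul_right (I := 𝓘(ℝ, F)) (n := ∞)).mdifferentiable (by simp)

variable (F) in
theorem mdifferentiable_conj (g : G) :
    MDifferentiable 𝓘(ℝ, F) 𝓘(ℝ, F) (fun h : G => g * h * g⁻¹) :=
  (mdifferentiable_mul_right F g⁻¹).comp (mdifferentiable_mul_left F g)

theorem Ad_mul (g g' : G) (X : LieAlg F G) : Ad (g * g') X = Ad g (Ad g' X) :=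
  modelDeriv_comp_apply F F F (mdifferentiable_conj F g 1) (mdifferentiable_conj F g' 1) (by simp)
    (.of_forall fun h => by simp [mul_assoc]) X

/-- The derivatives at `1` of right translation after conjugation and of left translation agree. -/
theorem modelDeriv_mul_right_Ad (g : G) (X : LieAlg F G) :
    modelDeriv F F (fun h : G => h * g) 1 (Ad g X) = modelDeriv F F (fun h : G => g * h) 1 X :=
  (modelDeriv_comp_apply F F F (mdifferentiable_mul_right F g 1) (mdifferentiable_conj F g 1)
    (by simp) (.of_forall fun h => by simp) X).symm

/-- Differentiating `h * h⁻¹ = 1` at the unit, by the product rule, makes the derivatives of the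
identity and of inversion sum to zero. -/
theorem modelDeriv_inv_one (X : LieAlg F G) : modelDeriv F F (fun h : G => h⁻¹) 1 X = -X := by
  have hi : MDifferentiableAt 𝓘(ℝ, F) 𝓘(ℝ, F) (fun h : G => h⁻¹) 1 :=
    ((contMDiff_inv 𝓘(ℝ, F) ∞).mdifferentiable (by simp)) 1
  have hid : MDifferentiableAt 𝓘(ℝ, F) 𝓘(ℝ, F) (fun h : G => h) 1 := mdifferentiableAt_id
  have hm : MDifferentiableAt (𝓘(ℝ, F).prod 𝓘(ℝ, F)) 𝓘(ℝ, F) (fun p : G × G => p.1 * p.2)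
    (1, (1 : G)⁻¹) := ((contMDiff_mul 𝓘(ℝ, F) ∞).mdifferentiable (by simp)) _
  have h := mfderiv_comp_apply (I := 𝓘(ℝ, F)) (1 : G) (g := fun p : G × G => p.1 * p.2)
    (f := fun h : G => (h, h⁻¹)) hm (hid.prodMk hi) X
  rw [mfderiv_prod_eq_add_apply hm, mfderiv_prodMk hid hi] at h
  have e : (fun p : G × G => p.1 * p.2) ∘ (fun h : G => (h, h⁻¹)) = fun _ => 1 := by
    funext h; simp
  rw [e, mfderiv_const] at h
  have e₁ : (fun z : G => z * (1 : G)⁻¹) = fun z => z := by funext; simp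
  have e₂ : (fun z : G => (1 : G) * z) = fun z => z := by funext; simp
  change 0 = modelDeriv F F (fun z : G => z * (1 : G)⁻¹) 1 (modelDeriv F F (fun h : G => h) 1 X) +
    modelDeriv F F (fun z : G => 1 * z) (1 : G)⁻¹ (modelDeriv F F (fun h : G => h⁻¹) 1 X) at h
  rw [e₁, e₂, modelDeriv_id, modelDeriv_id] at h
  exact (neg_eq_of_add_eq_zero_right h.symm).symm

/-! ### The derivative of the adjoint action -/

variable (F G) in
/-- The multiplication of `G` in the chart at `1`. -/
def chartMul (z : F × F) : F :=
  extChartAt 𝓘(ℝ, F) (1 : G) ((extChartAt 𝓘(ℝ, F) (1 : G)).symm z.1 *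
    (extChartAt 𝓘(ℝ, F) (1 : G)).symm z.2)

local notation "φ₁" => extChartAt 𝓘(ℝ, F) (1 : G)

theorem contDiffAt_chartMul {y z : F} (hy : y ∈ (φ₁).target) (hz : z ∈ (φ₁).target)
    (h : (φ₁).symm y * (φ₁).symm z ∈ (φ₁).source) : ContDiffAt ℝ ∞ (chartMul F G) (y, z) := by
  have : IsManifold 𝓘(ℝ, F) ∞ G := LieGroup.toContMDiffMul.toIsManifold
  have hs {y : F} (hy : y ∈ (φ₁).target) : ContMDiffAt 𝓘(ℝ, F) 𝓘(ℝ, F) ∞ (φ₁).symm y :=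
    (contMDiffOn_extChartAt_symm (1 : G)).contMDiffAt (extChartAt_target_mem_nhds' hy)
  have h1 : ContMDiffAt 𝓘(ℝ, F × F) 𝓘(ℝ, F) ∞ (fun z : F × F => (φ₁).symm z.1) (y, z) :=
    ContMDiffAt.comp (g := (φ₁).symm) (f := Prod.fst) (y, z) (hs hy) contDiff_fst.contMDiff.contMDiffAt
  have h2 : ContMDiffAt 𝓘(ℝ, F × F) 𝓘(ℝ, F) ∞ (fun z : F × F => (φ₁).symm z.2) (y, z) :=
    ContMDiffAt.comp (g := (φ₁).symm) (f := Prod.snd) (y, z) (hs hz) contDiff_snd.contMDiff.contMDiffAt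
  rw [← contMDiffAt_iff_contDiffAt]
  refine ContMDiffAt.comp (g := φ₁) (y, z) (contMDiffAt_extChartAt' ?_) (h1.mul h2)
  simpa using h

theorem modelDeriv_extChartAt_symm :
    modelDeriv F F (φ₁).symm ((φ₁) 1) = .id ℝ F := by
  have : IsManifold 𝓘(ℝ, F) ∞ G := LieGroup.toContMDiffMul.toIsManifold
  have : IsManifold 𝓘(ℝ, F) 1 G := .of_le (n := ∞) (by simp)
  have h := mfderivWithin_range_extChartAt_symm (I := 𝓘(ℝ, F)) (x := (1 : G))
  rw [ModelWithCorners.range_eq_univ, mfderivWithin_univ] at h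
  exact h

/-- With the first variable fixed, the chart multiplication is left translation conjugated by the
chart. The inverse chart has derivative the identity at the image of `1`, so only translation and
chart remain. The result is the left-invariant field of `X` in coordinates. -/
theorem fderiv_chartMul_inr {y : F} (hy : y ∈ (φ₁).target) (X : F) :
    fderiv ℝ (chartMul F G) (y, (φ₁) 1) (0, X) = modelDeriv F F (φ₁) ((φ₁).symm y)
      (modelDeriv F F (fun h : G => (φ₁).symm y * h) 1 X) := by
  have : IsManifold 𝓘(ℝ, F) ∞ G := LieGroup.toContMDiffMul.toIsManifold
  have : IsManifold 𝓘(ℝ, F) 1 G := .of_le (n := ∞) (by simp)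
  have h1 : (φ₁).symm ((φ₁) 1) = 1 := extChartAt_to_inv _
  have hm := (contDiffAt_chartMul hy (mem_extChartAt_target (1 : G))
    (by rw [h1, mul_one]; exact (φ₁).map_target hy)).differentiableAt (by simp)
  have hφ : MDifferentiableAt 𝓘(ℝ, F) 𝓘(ℝ, F) (φ₁) ((φ₁).symm y) :=
    mdifferentiableAt_extChartAt (by simpa using (φ₁).map_target hy)
  have hφs : MDifferentiableAt 𝓘(ℝ, F) 𝓘(ℝ, F) (φ₁).symm ((φ₁) 1) := by
    have := mdifferentiableWithinAt_extChartAt_symm (I := 𝓘(ℝ, F)) (mem_extChartAt_target (I := 𝓘(ℝ, F)) (1 : G))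
    rwa [ModelWithCorners.range_eq_univ, mdifferentiableWithinAt_univ] at this
  have hmul := mdifferentiable_mul_left F ((φ₁).symm y) 1
  have hφ' : MDifferentiableAt 𝓘(ℝ, F) 𝓘(ℝ, F) (φ₁) ((φ₁).symm y * 1) := by rwa [mul_one]
  have e := HasFDerivAt.comp (f := fun z : F => (y, z)) ((φ₁) 1) hm.hasFDerivAt
    (hasFDerivAt_prodMk_right y ((φ₁) 1))
  calc fderiv ℝ (chartMul F G) (y, (φ₁) 1) (0, X)
      = fderiv ℝ (chartMul F G ∘ fun z : F => (y, z)) ((φ₁) 1) X := by rw [e.fderiv]; rfl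
    _ = modelDeriv F F (fun z => (φ₁) ((φ₁).symm y * z)) 1
          (modelDeriv F F (φ₁).symm ((φ₁) 1) X) := by
        rw [← modelDeriv_eq_fderiv]
        exact modelDeriv_comp_apply F F F (hφ'.comp 1 hmul) hφs h1 (.of_forall fun _ => rfl) X
    _ = _ := by
        rw [modelDeriv_extChartAt_symm]
        exact modelDeriv_comp_apply F F F hφ hmul (mul_one _) (.of_forall fun _ => rfl) X

theorem fderiv_chartMul_inl {y : F} (hy : y ∈ (φ₁).target) (X : F) :
    fderiv ℝ (chartMul F G) ((φ₁) 1, y) (X, 0) = modelDeriv F F (φ₁) ((φ₁).symm y)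
      (modelDeriv F F (fun h : G => h * (φ₁).symm y) 1 X) := by
  have : IsManifold 𝓘(ℝ, F) ∞ G := LieGroup.toContMDiffMul.toIsManifold
  have : IsManifold 𝓘(ℝ, F) 1 G := .of_le (n := ∞) (by simp)
  have h1 : (φ₁).symm ((φ₁) 1) = 1 := extChartAt_to_inv _
  have hm := (contDiffAt_chartMul (mem_extChartAt_target (1 : G)) hy
    (by rw [h1, one_mul]; exact (φ₁).map_target hy)).differentiableAt (by simp)
  have hφ : MDifferentiableAt 𝓘(ℝ, F) 𝓘(ℝ, F) (φ₁) ((φ₁).symm y) :=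
    mdifferentiableAt_extChartAt (by simpa using (φ₁).map_target hy)
  have hφs : MDifferentiableAt 𝓘(ℝ, F) 𝓘(ℝ, F) (φ₁).symm ((φ₁) 1) := by
    have := mdifferentiableWithinAt_extChartAt_symm (I := 𝓘(ℝ, F)) (mem_extChartAt_target (I := 𝓘(ℝ, F)) (1 : G))
    rwa [ModelWithCorners.range_eq_univ, mdifferentiableWithinAt_univ] at this
  have hmul := mdifferentiable_mul_right F ((φ₁).symm y) 1
  have hφ' : MDifferentiableAt 𝓘(ℝ, F) 𝓘(ℝ, F) (φ₁) (1 * (φ₁).symm y) := by rwa [one_mul]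
  have e := HasFDerivAt.comp (f := fun z : F => (z, y)) ((φ₁) 1) hm.hasFDerivAt
    (hasFDerivAt_prodMk_left ((φ₁) 1) y)
  calc fderiv ℝ (chartMul F G) ((φ₁) 1, y) (X, 0)
      = fderiv ℝ (chartMul F G ∘ fun z : F => (z, y)) ((φ₁) 1) X := by rw [e.fderiv]; rfl
    _ = modelDeriv F F (fun z => (φ₁) (z * (φ₁).symm y)) 1
          (modelDeriv F F (φ₁).symm ((φ₁) 1) X) := by
        rw [← modelDeriv_eq_fderiv]
        exact modelDeriv_comp_apply F F F (hφ'.comp 1 hmul) hφs h1 (.of_forall fun _ => rfl) X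
    _ = _ := by
        rw [modelDeriv_extChartAt_symm]
        exact modelDeriv_comp_apply F F F hφ hmul (one_mul _) (.of_forall fun _ => rfl) X

variable (F) in
/-- The adjoint action of `G`, on the model space of the Lie algebra. -/
def adVec (g : G) : F →L[ℝ] F := modelDeriv F F (fun h : G => g * h * g⁻¹) 1

/-- Pulling back along the inverse chart applies the inverse of its derivative, which is the
derivative of the chart. -/
theorem mpullbackWithin_mulInvariantVectorField (X : F) {y : F} (hy : y ∈ (φ₁).target) :
    VectorField.mpullbackWithin 𝓘(ℝ, F) 𝓘(ℝ, F) (φ₁).symm (mulInvariantVectorField (G := G) X)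
      (Set.range 𝓘(ℝ, F)) y = fderiv ℝ (chartMul F G) (y, (φ₁) 1) (0, X) := by
  have : IsManifold 𝓘(ℝ, F) ∞ G := LieGroup.toContMDiffMul.toIsManifold
  have : IsManifold 𝓘(ℝ, F) 1 G := .of_le (n := ∞) (by simp)
  rw [fderiv_chartMul_inr hy, VectorField.mpullbackWithin_apply,
    ContinuousLinearMap.inverse_eq (mfderivWithin_extChartAt_symm_comp_mfderiv_extChartAt hy)
      (mfderiv_extChartAt_comp_mfderivWithin_extChartAt_symm hy)]
  rfl

theorem adVec_mul (g h : G) (Y : F) : adVec F (g * h) Y = adVec F g (adVec F h Y) :=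
  Ad_mul g h Y

variable [FiniteDimensional ℝ F]

variable (G) in
/-- The bracket of the Lie algebra of `G`, on its model space. -/
def brVec (X Y : F) : F := lieBracket (F := F) (G := G) X Y

/-- The bracket on a manifold is computed from coordinate fields in the chart at the point and then
carried back. At `1` carrying back is the identity, so the bracket is literally that of the
coordinate expressions of the invariant fields. -/
theorem brVec_eq_chart (X Y : F) : brVec G X Y =
    VectorField.lieBracket ℝ (fun y => fderiv ℝ (chartMul F G) (y, (φ₁) 1) (0, X))
      (fun y => fderiv ℝ (chartMul F G) (y, (φ₁) 1) (0, Y)) ((φ₁) 1) := by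
  have : IsManifold 𝓘(ℝ, F) ∞ G := LieGroup.toContMDiffMul.toIsManifold
  have : IsManifold 𝓘(ℝ, F) 1 G := .of_le (n := ∞) (by simp)
  have ht : (φ₁).target ∈ 𝓝 ((φ₁) (1 : G)) := extChartAt_target_mem_nhds 1
  have hV (X : F) : VectorField.mpullbackWithin 𝓘(ℝ, F) 𝓘(ℝ, F) (φ₁).symm
      (mulInvariantVectorField (G := G) X) (Set.range 𝓘(ℝ, F)) =ᶠ[𝓝 ((φ₁) (1 : G))]
        fun y => fderiv ℝ (chartMul F G) (y, (φ₁) 1) (0, X) := by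
    filter_upwards [ht] with y hy using mpullbackWithin_mulInvariantVectorField X hy
  have hi : (mfderiv 𝓘(ℝ, F) 𝓘(ℝ, F) (φ₁) (1 : G)).inverse = (.id ℝ F : F →L[ℝ] F) :=
    (congrArg ContinuousLinearMap.inverse (mfderiv_extChartAt_self (I := 𝓘(ℝ, F)) (x := (1 : G)))).trans
      (ContinuousLinearMap.inverse_id (R := ℝ) (M := F))
  rw [← (hV X).lieBracket_vectorField_eq (hV Y)]
  change VectorField.mlieBracketWithin 𝓘(ℝ, F) (mulInvariantVectorField X)
    (mulInvariantVectorField Y) Set.univ (1 : G) = _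
  refine (DFunLike.congr_fun hi _).trans ?_
  have hs : (φ₁).symm ⁻¹' Set.univ ∩ Set.range 𝓘(ℝ, F) = Set.univ := by simp
  exact (congrArg (fun s => VectorField.lieBracketWithin ℝ _ _ s ((φ₁) (1 : G))) hs).trans
    (congrFun VectorField.lieBracketWithin_univ _)

theorem exists_modelDeriv_adVec (Y : F) :
    MDifferentiableAt 𝓘(ℝ, F) 𝓘(ℝ, F) (fun g : G => adVec F g Y) 1 ∧
      ∀ X : F, modelDeriv F F (fun g : G => adVec F g Y) 1 X = brVec G X Y := by
  have : IsManifold 𝓘(ℝ, F) ∞ G := LieGroup.toContMDiffMul.toIsManifold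
  have : IsManifold 𝓘(ℝ, F) 1 G := .of_le (n := ∞) (by simp)
  have : CompleteSpace F := FiniteDimensional.complete ℝ F
  have ht : (φ₁).target ∈ 𝓝 ((φ₁) (1 : G)) := extChartAt_target_mem_nhds 1
  have h1 : (φ₁).symm ((φ₁) 1) = 1 := extChartAt_to_inv _
  obtain ⟨L, hL, hL'⟩ := exists_hasFDerivAt_adjoint (m := chartMul F G) (p := (φ₁) 1) (Y := Y)
    (A := fun y => adVec F ((φ₁).symm y) Y)
    ((contDiffAt_chartMul (mem_extChartAt_target 1) (mem_extChartAt_target 1)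
      (by rw [h1, mul_one]; exact mem_extChartAt_source 1)).of_le (by norm_cast))
    (by filter_upwards [ht] with y hy
        rw [chartMul, h1, mul_one, (φ₁).right_inv hy])
    (by filter_upwards [ht] with y hy
        rw [chartMul, h1, one_mul, (φ₁).right_inv hy])
    (by filter_upwards [ht] with y hy
        rw [fderiv_chartMul_inl hy, fderiv_chartMul_inr hy]
        -- This is `R_g ∘ (conjugation by g) = L_g`, differentiated at `1`: the implicit equation
        -- for `Ad` in coordinates.
        exact congrArg _ (modelDeriv_mul_right_Ad _ Y))
  have hφ : MDifferentiableAt 𝓘(ℝ, F) 𝓘(ℝ, F) (φ₁) (1 : G) :=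
    mdifferentiableAt_extChartAt (mem_chart_source F 1)
  have hA : MDifferentiableAt 𝓘(ℝ, F) 𝓘(ℝ, F) (fun y => adVec F ((φ₁).symm y) Y) ((φ₁) 1) :=
    hL.differentiableAt.mdifferentiableAt
  have he : (fun g : G => adVec F g Y) =ᶠ[𝓝 1] (fun y => adVec F ((φ₁).symm y) Y) ∘ (φ₁) := by
    filter_upwards [extChartAt_source_mem_nhds (I := 𝓘(ℝ, F)) (1 : G)] with g hg
    rw [Function.comp_apply, (φ₁).left_inv hg]
  refine ⟨(hA.comp 1 hφ).congr_of_eventuallyEq he, fun X => ?_⟩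
  rw [modelDeriv_comp_apply F F F hA hφ rfl he, modelDeriv_eq_fderiv, hL.fderiv,
    brVec_eq_chart, ← hL']
  exact congrArg L (DFunLike.congr_fun (mfderiv_extChartAt_self (I := 𝓘(ℝ, F)) (x := (1 : G))) X)

theorem mdifferentiableAt_adVec (Y : F) :
    MDifferentiableAt 𝓘(ℝ, F) 𝓘(ℝ, F) (fun g : G => adVec F g Y) 1 :=
  (exists_modelDeriv_adVec Y).1

/-- The derivative at `1` of `g ↦ Ad_g Y` is `X ↦ [X, Y]`. -/
theorem modelDeriv_adVec (X Y : F) :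
    modelDeriv F F (fun g : G => adVec F g Y) 1 X = brVec G X Y :=
  (exists_modelDeriv_adVec Y).2 X

/-- Differentiate `Ad_g Ad_h Y = Ad_{g h g⁻¹} (Ad_g Y)` in `h` at `1` along `X`. -/
theorem adVec_brVec (g : G) (X Y : F) :
    adVec F g (brVec G X Y) = brVec G (adVec F g X) (adVec F g Y) := by
  have h : modelDeriv F F (fun h : G => adVec F g (adVec F h Y)) 1 X = adVec F g (brVec G X Y) := by
    rw [modelDeriv_comp_apply F F F (g := adVec F g)
      (adVec F g).differentiableAt.mdifferentiableAt
      (mdifferentiableAt_adVec Y) rfl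
      (h := fun h : G => adVec F g (adVec F h Y)) (.of_forall fun _ => rfl), modelDeriv_adVec,
      modelDeriv_eq_fderiv, (adVec F g).fderiv]
  rw [← h, modelDeriv_comp_apply F F F (g := fun h : G => adVec F h (adVec F g Y))
    (mdifferentiableAt_adVec _) (mdifferentiable_conj F g 1) (by simp)
    (.of_forall fun h => by
      rw [Function.comp_apply, ← adVec_mul, ← adVec_mul, inv_mul_cancel_right])]
  exact modelDeriv_adVec (adVec F g X) (adVec F g Y)

theorem Ad_lieBracket (g : G) (X Y : LieAlg F G) :
    Ad g (lieBracket X Y) = lieBracket (Ad g X) (Ad g Y) :=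
  adVec_brVec (F := F) g X Y

theorem lieBracket_skew (X Y : LieAlg F G) : lieBracket X Y = -lieBracket Y X :=
  have : CompleteSpace F := FiniteDimensional.complete ℝ F
  have : LieGroup 𝓘(ℝ, F) (minSmoothness ℝ 3) G := by
    rw [minSmoothness_of_isRCLikeNormedField]
    exact LieGroup.of_le (n := ∞) (WithTop.coe_le_coe.2 (le_top : (3 : ℕ∞) ≤ ⊤))
  (lie_skew X Y).symm

end LieGroup

/-! ### Smoothness of preimages under invertible bundle maps. -/

section BundleInverse

variable {E : Type*} [NormedAddCommGroup E] [NormedSpace ℝ E]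
  {M : Type*} [TopologicalSpace M] [ChartedSpace E M]
  {F₁ : Type*} [NormedAddCommGroup F₁] [NormedSpace ℝ F₁] [CompleteSpace F₁]
  {F₂ : Type*} [NormedAddCommGroup F₂] [NormedSpace ℝ F₂]
  {E₁ : M → Type*} [∀ x, AddCommGroup (E₁ x)] [∀ x, Module ℝ (E₁ x)]
  [TopologicalSpace (Bundle.TotalSpace F₁ E₁)] [∀ x, TopologicalSpace (E₁ x)]
  [FiberBundle F₁ E₁] [VectorBundle ℝ F₁ E₁]
  {E₂ : M → Type*} [∀ x, AddCommGroup (E₂ x)] [∀ x, Module ℝ (E₂ x)]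
  [TopologicalSpace (Bundle.TotalSpace F₂ E₂)] [∀ x, TopologicalSpace (E₂ x)]
  [FiberBundle F₂ E₂] [VectorBundle ℝ F₂ E₂] [∀ x, IsTopologicalAddGroup (E₂ x)]
  [∀ x, ContinuousSMul ℝ (E₂ x)]

/-- The preimage of a smooth section under a smooth invertible bundle map is smooth. -/
theorem contMDiff_of_isInvertible {φ : ∀ x, E₁ x →L[ℝ] E₂ x} {V : ∀ x, E₁ x}
    (hφ : ContMDiff 𝓘(ℝ, E) (𝓘(ℝ, E).prod 𝓘(ℝ, F₁ →L[ℝ] F₂)) ∞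
      (fun x => Bundle.TotalSpace.mk' (F₁ →L[ℝ] F₂) (E := fun x => E₁ x →L[ℝ] E₂ x) x (φ x)))
    (hinv : ∀ x, (φ x).IsInvertible)
    (hβ : ContMDiff 𝓘(ℝ, E) (𝓘(ℝ, E).prod 𝓘(ℝ, F₂)) ∞
      (fun x => Bundle.TotalSpace.mk' F₂ (E := E₂) x (φ x (V x)))) :
    ContMDiff 𝓘(ℝ, E) (𝓘(ℝ, E).prod 𝓘(ℝ, F₁)) ∞
      (fun x => Bundle.TotalSpace.mk' F₁ (E := E₁) x (V x)) := by
  intro x₀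
  have hc := ((contMDiffAt_hom_bundle _).1 (hφ x₀)).2
  have hb := (Bundle.contMDiffAt_section _).1 (hβ x₀)
  rw [Bundle.contMDiffAt_section]
  set c := fun x => ContinuousLinearMap.inCoordinates F₁ E₁ F₂ E₂ x₀ x x₀ x (φ x)
  have h1 : (trivializationAt F₁ E₁ x₀).baseSet ∈ 𝓝 x₀ :=
    (trivializationAt F₁ E₁ x₀).open_baseSet.mem_nhds (FiberBundle.mem_baseSet_trivializationAt' _)
  have h2 : (trivializationAt F₂ E₂ x₀).baseSet ∈ 𝓝 x₀ :=
    (trivializationAt F₂ E₂ x₀).open_baseSet.mem_nhds (FiberBundle.mem_baseSet_trivializationAt' _)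
  have hci {x : M} (hx₁ : x ∈ (trivializationAt F₁ E₁ x₀).baseSet)
      (hx₂ : x ∈ (trivializationAt F₂ E₂ x₀).baseSet) : ∃ e : F₁ ≃L[ℝ] F₂, (e : F₁ →L[ℝ] F₂) = c x ∧
        e (trivializationAt F₁ E₁ x₀ ⟨x, V x⟩).2 = (trivializationAt F₂ E₂ x₀ ⟨x, φ x (V x)⟩).2 := by
    obtain ⟨f, hf⟩ := hinv x
    refine ⟨(((trivializationAt F₁ E₁ x₀).continuousLinearEquivAt ℝ x hx₁).symm.trans f).trans
      ((trivializationAt F₂ E₂ x₀).continuousLinearEquivAt ℝ x hx₂), ?_, ?_⟩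
    · change _ = ContinuousLinearMap.inCoordinates F₁ E₁ F₂ E₂ x₀ x x₀ x (φ x)
      rw [ContinuousLinearMap.inCoordinates_eq hx₁ hx₂, ← hf]
      rfl
    · rw [← hf]
      change _ = (trivializationAt F₂ E₂ x₀).continuousLinearEquivAt ℝ x hx₂ (f (V x))
      change (trivializationAt F₂ E₂ x₀).continuousLinearEquivAt ℝ x hx₂
        (f (((trivializationAt F₁ E₁ x₀).continuousLinearEquivAt ℝ x hx₁).symm
          ((trivializationAt F₁ E₁ x₀).continuousLinearEquivAt ℝ x hx₁ (V x)))) = _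
      rw [ContinuousLinearEquiv.symm_apply_apply]
  -- In trivializations the bundle map is a smooth family of operators, and operator inversion is
  -- smooth at an invertible operator because the model fibre is complete.
  have hi : ContMDiffAt 𝓘(ℝ, E) 𝓘(ℝ, F₂ →L[ℝ] F₁) ∞ (fun x => (c x).inverse) x₀ := by
    obtain ⟨e, he, -⟩ := hci (mem_of_mem_nhds h1) (mem_of_mem_nhds h2)
    have h : ContDiffAt ℝ ∞ ContinuousLinearMap.inverse (c x₀) := by
      rw [← he]; exact contDiffAt_map_inverse e
    exact h.contMDiffAt.comp x₀ hc
  refine (hi.clm_apply hb).congr_of_eventuallyEq ?_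
  filter_upwards [h1, h2] with x hx₁ hx₂
  obtain ⟨e, he, hV⟩ := hci hx₁ hx₂
  rw [← he, ContinuousLinearMap.inverse_equiv, ← hV]
  exact (e.symm_apply_apply _).symm

end BundleInverse

/-! ### Nondegeneracy and antisymmetry of the symplectic form. -/

section Symplectic

variable {E : Type*} [NormedAddCommGroup E] [NormedSpace ℝ E]

/-- Nondegeneracy is injectivity, and a finite-dimensional space has the same dimension as its dual.
This and the automatic continuity of the inverse are where finite dimension of `M` is used. -/
theorem isInvertible_of_forall_apply_eq_zero [FiniteDimensional ℝ E] (B : E →L[ℝ] E →L[ℝ] ℝ)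
    (h : ∀ v, (∀ w, B v w = 0) → v = 0) : B.IsInvertible := by
  have hinj : Function.Injective B.toLinearMap := by
    rw [← LinearMap.ker_eq_bot, LinearMap.ker_eq_bot']
    exact fun v hv => h v fun w => DFunLike.congr_fun hv w
  have hdim : Module.finrank ℝ E = Module.finrank ℝ (E →L[ℝ] ℝ) := by
    rw [← (LinearMap.toContinuousLinearMap (𝕜 := ℝ) (E := E) (F' := ℝ)).finrank_eq]
    exact Subspace.dual_finrank_eq.symm
  exact ⟨(LinearEquiv.ofInjectiveOfFinrankEq B.toLinearMap hinj hdim).toContinuousLinearEquiv,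
    ContinuousLinearMap.ext fun _ => rfl⟩

theorem apply_eq_neg_of_alternating (B : E →L[ℝ] E →L[ℝ] ℝ) (h : ∀ v, B v v = 0) (u v : E) :
    B u v = -B v u := by
  -- Polarization of the alternating condition.
  have h := h (u + v)
  simp only [map_add, add_apply, ‹∀ v, B v v = 0›] at h
  linarith

variable {M : Type*} [TopologicalSpace M] [ChartedSpace E M] [IsManifold 𝓘(ℝ, E) ∞ M]

theorem SymplecticForm.isInvertible [FiniteDimensional ℝ E] (Ω : SymplecticForm E M) (x : M) :
    (Ω.form x).IsInvertible :=
  isInvertible_of_forall_apply_eq_zero (E := E) (Ω.form x) (Ω.nondegenerate x)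

theorem SymplecticForm.bijective_flat [FiniteDimensional ℝ E] (Ω : SymplecticForm E M) :
    Function.Bijective Ω.flat := by
  have : CompleteSpace E := FiniteDimensional.complete ℝ E
  constructor
  · rw [← LinearMap.ker_eq_bot, LinearMap.ker_eq_bot']
    intro V hV
    ext x
    exact Ω.nondegenerate x (V x) fun w => DFunLike.congr_fun (DFunLike.congr_fun hV x) w
  · intro β
    have hsurj (x : M) : ∃ v, Ω.form x v = β x := by
      obtain ⟨e, he⟩ := Ω.isInvertible x
      exact ⟨e.symm (β x), by rw [← he]; exact e.apply_symm_apply _⟩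
    -- The equation is solved fibre by fibre; smoothness of the solution then follows from
    -- invertibility of the form and smoothness of `β`.
    choose V hV using hsurj
    have hs : ContMDiff 𝓘(ℝ, E) (𝓘(ℝ, E).prod 𝓘(ℝ, E)) ∞
        (fun x => Bundle.TotalSpace.mk' E (E := (TangentSpace 𝓘(ℝ, E) : M → Type _)) x (V x)) := by
      refine contMDiff_of_isInvertible Ω.contMDiff_form Ω.isInvertible ?_
      simp_rw [hV]
      exact β.contMDiff
    exact ⟨⟨V, hs⟩, by ext x : 1; exact hV x⟩

theorem SymplecticForm.form_skew (Ω : SymplecticForm E M) (x : M) (u v : TangentSpace 𝓘(ℝ, E) x) :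
    Ω.form x u v = -Ω.form x v u :=
  apply_eq_neg_of_alternating (E := E) (Ω.form x) (Ω.alternating x) u v

theorem SymplecticForm.pairing_flat_skew (Ω : SymplecticForm E M) (V W : VecField E M) :
    pairing (Ω.flat V) W = -pairing (Ω.flat W) V := by
  ext x
  exact Ω.form_skew x (V x) (W x)

end Symplectic

/-! ### Derivatives of the translations of a group action. -/

section Translations

variable (E : Type*) [NormedAddCommGroup E] [NormedSpace ℝ E]
  {M : Type*} [TopologicalSpace M] [ChartedSpace E M] {G : Type*} [Group G] [MulAction G M]

theorem modelDeriv_one_smul (x : M) : modelDeriv E E (fun y : M => (1 : G) • y) x = .id ℝ E := by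
  have h : (fun y : M => (1 : G) • y) = fun y => y := by funext y; exact one_smul G y
  rw [h, modelDeriv_id]

variable {E}

theorem modelDeriv_mul_smul (hG : ∀ g : G, MDifferentiable 𝓘(ℝ, E) 𝓘(ℝ, E) (fun x : M => g • x))
    (g h : G) (x : M) (v : E) :
    modelDeriv E E (fun y : M => (g * h) • y) x v =
      modelDeriv E E (fun y : M => g • y) (h • x) (modelDeriv E E (fun y : M => h • y) x v) :=
  modelDeriv_comp_apply E E E (hG g _) (hG h x) rfl (.of_forall fun y => mul_smul g h y) v

theorem modelDeriv_smul_inv_smul (hG : ∀ g : G, MDifferentiable 𝓘(ℝ, E) 𝓘(ℝ, E) (fun x : M => g • x))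
    (g : G) (x : M) (v : E) :
    modelDeriv E E (fun y : M => g • y) (g⁻¹ • x) (modelDeriv E E (fun y : M => g⁻¹ • y) x v) = v := by
  rw [← modelDeriv_mul_smul hG, mul_inv_cancel, modelDeriv_one_smul E]
  rfl

theorem modelDeriv_inv_smul_smul (hG : ∀ g : G, MDifferentiable 𝓘(ℝ, E) 𝓘(ℝ, E) (fun x : M => g • x))
    (g : G) (x : M) (v : E) :
    modelDeriv E E (fun y : M => g⁻¹ • y) x (modelDeriv E E (fun y : M => g • y) (g⁻¹ • x) v) = v := by
  have h := modelDeriv_mul_smul hG g⁻¹ g (g⁻¹ • x) v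
  rw [smul_inv_smul, inv_mul_cancel, modelDeriv_one_smul E] at h
  exact h.symm

end Translations

theorem mdifferentiable_smul (E : Type*) [NormedAddCommGroup E] [NormedSpace ℝ E]
    (M : Type*) [TopologicalSpace M] [ChartedSpace E M] (F : Type*) [NormedAddCommGroup F]
    [NormedSpace ℝ F] (G : Type*) [TopologicalSpace G] [ChartedSpace F G] [Group G] [MulAction G M]
    [ContMDiffSMul 𝓘(ℝ, F) 𝓘(ℝ, E) ∞ G M] (g : G) :
    MDifferentiable 𝓘(ℝ, E) 𝓘(ℝ, E) (fun x : M => g • x) :=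
  (contMDiff_act F g).mdifferentiable (by simp)

/-! ### Naturality under the group and infinitesimal equivariance of the moment map. -/

section Hamiltonian

variable {E : Type*} [NormedAddCommGroup E] [NormedSpace ℝ E]
  {M : Type*} [TopologicalSpace M] [ChartedSpace E M] [IsManifold 𝓘(ℝ, E) ∞ M]
  {F : Type*} [NormedAddCommGroup F] [NormedSpace ℝ F]
  {G : Type*} [TopologicalSpace G] [ChartedSpace F G] [Group G] [LieGroup 𝓘(ℝ, F) ∞ G]
  [MulAction G M] [ContMDiffSMul 𝓘(ℝ, F) 𝓘(ℝ, E) ∞ G M]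

/-- The value of a vector field, in the model space. -/
def VecField.val (V : VecField E M) (x : M) : E := V x

/-- The value of a one-form, on the model space. -/
def OneForm.val (β : OneForm E M) (x : M) : E →L[ℝ] ℝ := β x

/-- The value of a symplectic form, on the model space. -/
def SymplecticForm.val (Ω : SymplecticForm E M) (x : M) : E →L[ℝ] E →L[ℝ] ℝ := Ω.form x

theorem VecField.ext_val {V W : VecField E M} (h : ∀ x, V.val x = W.val x) : V = W := by
  ext x; exact h x

theorem OneForm.ext_val {β β' : OneForm E M} (h : ∀ x v, β.val x v = β'.val x v) : β = β' := by
  ext x : 1; exact ContinuousLinearMap.ext (h x)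

theorem mdifferentiable_const_smul (x : M) :
    MDifferentiable 𝓘(ℝ, F) 𝓘(ℝ, E) (fun g : G => g • x) :=
  ((contMDiff_smul (I := 𝓘(ℝ, F)) (I' := 𝓘(ℝ, E)) (n := ∞)).comp
    (contMDiff_id.prodMk contMDiff_const)).mdifferentiable (by simp)

variable (g h : G)

theorem actVec_val (V : VecField E M) (x : M) : (actVec E M F G g V).val x =
    modelDeriv E E (fun y : M => g • y) (g⁻¹ • x) (V.val (g⁻¹ • x)) := rfl

theorem actForm_val (β : OneForm E M) (x : M) (v : E) : (actForm E M F G g β).val x v =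
    β.val (g⁻¹ • x) (modelDeriv E E (fun y : M => g⁻¹ • y) x v) := rfl

theorem actFun_one (r : SmoothFun E M) : actFun E M F G 1 r = r := by
  ext x
  change r ((1 : G)⁻¹ • x) = r x
  rw [inv_one, one_smul]

theorem actFun_mul (r : SmoothFun E M) :
    actFun E M F G (g * h) r = actFun E M F G g (actFun E M F G h r) := by
  ext x
  change r ((g * h)⁻¹ • x) = r (h⁻¹ • g⁻¹ • x)
  rw [mul_inv_rev, mul_smul]

theorem actVec_one (V : VecField E M) : actVec E M F G 1 V = V :=
  VecField.ext_val fun x => by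
    rw [actVec_val, modelDeriv_one_smul E, inv_one, one_smul]
    rfl

theorem actVec_mul (V : VecField E M) :
    actVec E M F G (g * h) V = actVec E M F G g (actVec E M F G h V) :=
  VecField.ext_val fun x => by
    rw [actVec_val, actVec_val, actVec_val, modelDeriv_mul_smul (mdifferentiable_smul E M F G), mul_inv_rev, mul_smul,
      smul_inv_smul]

theorem actForm_one (β : OneForm E M) : actForm E M F G 1 β = β :=
  OneForm.ext_val fun x v => by
    rw [actForm_val, inv_one, modelDeriv_one_smul E, one_smul]
    rfl

theorem actForm_mul (β : OneForm E M) :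
    actForm E M F G (g * h) β = actForm E M F G g (actForm E M F G h β) :=
  OneForm.ext_val fun x v => by
    rw [actForm_val, actForm_val, actForm_val, mul_inv_rev, modelDeriv_mul_smul (mdifferentiable_smul E M F G), mul_smul]

/-- Pulling the form back along `g⁻¹` and pushing the field forward along `g` insert mutually
inverse derivatives. -/
theorem actFun_pairing (β : OneForm E M) (V : VecField E M) : actFun E M F G g (pairing β V) =
    pairing (actForm E M F G g β) (actVec E M F G g V) := by
  ext x
  change β.val (g⁻¹ • x) (V.val (g⁻¹ • x)) =
    (actForm E M F G g β).val x ((actVec E M F G g V).val x)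
  rw [actForm_val, actVec_val, modelDeriv_inv_smul_smul (mdifferentiable_smul E M F G)]

theorem dFun_val (f : SmoothFun E M) (x : M) : (dFun f).val x = modelDeriv E ℝ f x := rfl

theorem actForm_dFun (f : SmoothFun E M) :
    actForm E M F G g (dFun f) = dFun (actFun E M F G g f) :=
  OneForm.ext_val fun x v => by
    rw [actForm_val, dFun_val, dFun_val]
    exact (modelDeriv_comp_apply E E ℝ (f.contMDiff.mdifferentiable (by simp) _)
      (mdifferentiable_smul E M F G g⁻¹ x) rfl (.of_forall fun _ => rfl) v).symm

theorem fund_val (X : LieAlg F G) (x : M) :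
    (fund E M F G X).val x = modelDeriv F E (fun g : G => g • x) 1 X := rfl

/-- Both sides are the derivative at `1` of `h ↦ (g h g⁻¹) • x`. It factors either as the orbit map
at `g⁻¹ • x` followed by translation, or as conjugation followed by the orbit map at `x`. -/
theorem actVec_fund (X : LieAlg F G) :
    actVec E M F G g (fund E M F G X) = fund E M F G (Ad g X) :=
  VecField.ext_val fun x => by
    rw [actVec_val, fund_val, fund_val]
    have h₁ := modelDeriv_comp_apply F E E (h := fun h : G => (g * h * g⁻¹) • x)
      (mdifferentiable_smul E M F G g (g⁻¹ • x)) (mdifferentiable_const_smul (g⁻¹ • x) 1)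
      (one_smul G _) (.of_forall fun h => by simp [mul_smul]) X
    have h₂ := modelDeriv_comp_apply F F E (h := fun h : G => (g * h * g⁻¹) • x)
      (mdifferentiable_const_smul x 1) (mdifferentiable_conj F g 1) (by simp)
      (.of_forall fun h => rfl) X
    exact h₁.symm.trans h₂

variable [FiniteDimensional ℝ F]

theorem mdifferentiableAt_adVec_inv (Y : F) :
    MDifferentiableAt 𝓘(ℝ, F) 𝓘(ℝ, F) (fun g : G => adVec F g⁻¹ Y) 1 :=
  MDifferentiableAt.comp_of_eq (g := fun g : G => adVec F g Y) 1 (mdifferentiableAt_adVec Y)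
    ((contMDiff_inv 𝓘(ℝ, F) ∞).mdifferentiable (by simp) 1) inv_one

/-- Inversion has derivative `-1` at the unit, which reverses the sign of the derivative of `Ad`. -/
theorem modelDeriv_adVec_inv (X Y : F) :
    modelDeriv F F (fun g : G => adVec F g⁻¹ Y) 1 X = -brVec G X Y := by
  rw [modelDeriv_comp_apply F F F (h := fun g : G => adVec F g⁻¹ Y) (mdifferentiableAt_adVec Y)
    ((contMDiff_inv 𝓘(ℝ, F) ∞).mdifferentiable (by simp) 1) inv_one (.of_forall fun _ => rfl),
    modelDeriv_adVec]
  refine (congrArg (fun X => brVec G X Y) (modelDeriv_inv_one X)).trans ?_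
  exact LinearMap.congr_fun (map_neg (lieBracket (F := F) (G := G)) X) Y

namespace HamiltonianAction

variable (H : HamiltonianAction E M F G)

theorem actFun_comoment (X : LieAlg F G) :
    actFun E M F G g (H.comoment X) = H.comoment (Ad g X) := by
  ext x
  change H.μ (g⁻¹ • x) X = H.μ x (Ad g X)
  rw [H.equivariant, inv_inv]

theorem flat_fund (X : LieAlg F G) :
    H.toSymplecticForm.flat (fund E M F G X) = dFun (H.comoment X) :=
  OneForm.ext_val fun x v => H.moment X x v

theorem val_smul (g : G) (x : M) (u v : E) :
    H.toSymplecticForm.val (g • x) (modelDeriv E E (fun y : M => g • y) x u)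
      (modelDeriv E E (fun y : M => g • y) x v) = H.toSymplecticForm.val x u v :=
  H.invariant g x u v

theorem actForm_flat (V : VecField E M) : actForm E M F G g (H.toSymplecticForm.flat V) =
    H.toSymplecticForm.flat (actVec E M F G g V) :=
  OneForm.ext_val fun x v => by
    rw [actForm_val]
    change H.toSymplecticForm.val (g⁻¹ • x) (V.val (g⁻¹ • x)) _ =
      H.toSymplecticForm.val x ((actVec E M F G g V).val x) v
    rw [actVec_val, ← H.val_smul g, modelDeriv_smul_inv_smul (mdifferentiable_smul E M F G), smul_inv_smul]

/-- Compute the derivative at `g = 1` of `⟨μ(gx), Y⟩ = ⟨μ(x), Ad_{g⁻¹} Y⟩` in two ways: along the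
orbit on the left, and through the derivative of `Ad_{g⁻¹}` on the right. -/
theorem modelDeriv_comoment (X Y : F) (x : M) :
    modelDeriv E ℝ (fun y => H.μ y Y) x (modelDeriv F E (fun g : G => g • x) 1 X) =
      -H.μ x (brVec (F := F) G X Y) := by
  -- The value of the moment map at `x` is continuous because `𝔤` is finite-dimensional, so it can
  -- be differentiated through.
  let m : F →L[ℝ] ℝ := LinearMap.toContinuousLinearMap (H.μ x : F →ₗ[ℝ] ℝ)
  have h₁ := modelDeriv_comp_apply F E ℝ (h := fun g : G => m (adVec F g⁻¹ Y))
    ((H.contMDiff_μ Y).mdifferentiable (by simp) x) (mdifferentiable_const_smul x 1)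
    (one_smul G x) (.of_forall fun g => (H.equivariant g x Y).symm) X
  have h₂ := modelDeriv_comp_apply F F ℝ (h := fun g : G => m (adVec F g⁻¹ Y))
    m.differentiableAt.mdifferentiableAt (mdifferentiableAt_adVec_inv Y) rfl
    (.of_forall fun g => rfl) X
  rw [← h₁, h₂, modelDeriv_adVec_inv, modelDeriv_eq_fderiv, m.fderiv, map_neg]
  rfl

theorem infinitesimallyEquivariant : InfinitesimallyEquivariant H.comoment pairing
    (dFun ∘ₗ H.comoment) lieBracket (fund E M F G) := fun X Y => by
  ext x
  exact modelDeriv_comoment (F := F) H X Y x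

theorem isSymmetry : IsSymmetry H.comoment pairing (dFun ∘ₗ H.comoment) lieBracket (fund E M F G)
    (actFun E M F G g) (Ad g) (Ad g⁻¹) (actVec E M F G g) (actForm E M F G g) where
  apply_inv X := by rw [← Ad_mul, mul_inv_cancel, Ad_one]
  map_μ := H.actFun_comoment g
  map_Dμ X := by
    rw [LinearMap.comp_apply, LinearMap.comp_apply, actForm_dFun, H.actFun_comoment]
  map_sharp := actVec_fund g
  map_br := Ad_lieBracket g
  map_pair := actFun_pairing g

end HamiltonianAction

end Hamiltonian

end DerivedReduction

end

theorem theorem8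
    {E : Type*} [NormedAddCommGroup E] [NormedSpace ℝ E] [FiniteDimensional ℝ E]
    {M : Type*} [TopologicalSpace M] [ChartedSpace E M] [IsManifold 𝓘(ℝ, E) ∞ M]
    {F : Type*} [NormedAddCommGroup F] [NormedSpace ℝ F] [FiniteDimensional ℝ F]
    {G : Type*} [TopologicalSpace G] [ChartedSpace F G] [Group G] [LieGroup 𝓘(ℝ, F) ∞ G]
    [MulAction G M] [ContMDiffSMul 𝓘(ℝ, F) 𝓘(ℝ, E) ∞ G M]
    (H : DerivedReduction.HamiltonianAction E M F G) :
    DerivedReduction.IsEquivariantDGModule H.deg H.iotaMu H.act H.degT H.dT H.actT ∧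
    DerivedReduction.IsEquivariantDGModule H.deg H.iotaMu H.act H.degCT H.dCT H.actCT ∧
    (∀ (n : ℤ) (x : H.Tangent), x ∈ H.degT n → H.omegaRed x ∈ H.degCT n) ∧
    (∀ x : H.Tangent, H.omegaRed (H.dT x) = H.dCT (H.omegaRed x)) ∧
    (∀ (g : G) (x : H.Tangent), H.omegaRed (H.actT g x) = H.actCT g (H.omegaRed x)) ∧
    Function.Bijective H.omegaRed := by
  -- Left translation by the unit is the identity, so restricting the Maurer–Cartan form to the
  -- units makes `α` and `α^*` the evident identifications.
  have hω : H.omegaRed = DerivedReduction.reducedFlat H.toSymplecticForm.flat LinearMap.id := by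
    rw [DerivedReduction.HamiltonianAction.omegaRed, DerivedReduction.maurerCartan_one]
  rw [hω]
  exact ⟨DerivedReduction.isEquivariantDGModule_dTotT H.infinitesimallyEquivariant
      (fun g => H.isSymmetry g) DerivedReduction.actFun_one DerivedReduction.actFun_mul
      DerivedReduction.Ad_one DerivedReduction.Ad_mul DerivedReduction.actVec_one
      DerivedReduction.actVec_mul,
    DerivedReduction.isEquivariantDGModule_dTotCT H.infinitesimallyEquivariant
      (fun g => H.isSymmetry g) DerivedReduction.actFun_one DerivedReduction.actFun_mul
      DerivedReduction.Ad_one DerivedReduction.Ad_mul DerivedReduction.actForm_one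
      DerivedReduction.actForm_mul,
    fun _ _ hx => DerivedReduction.reducedFlat_mem hx,
    DerivedReduction.reducedFlat_dTotT DerivedReduction.lieBracket_skew H.flat_fund
      H.toSymplecticForm.pairing_flat_skew,
    fun g => DerivedReduction.reducedFlat_actTotT (H.actForm_flat g),
    DerivedReduction.bijective_reducedFlat H.toSymplecticForm.bijective_flat⟩
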